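/- All objects are smooth. Let $d\ge 3$, let $M$ be a $d$-manifold with a conformal class $\boldsymbol c$ of Riemannian metrics (all $\Omega^2 g$, $0<\Omega\in C^\infty M$), and let $\Sigma\subset M$ be a separating embedded hypersurface, i.e. $\Sigma$ has a *defining function* $s\in C^\infty M$: $\Sigma=\{s=0\}$ and $ds\neq0$ along $\Sigma$. Write $P$ and $J=\operatorname{tr}_gP$ for the Schouten tensor of $g$ ($Ric=(d-2)P+Jg$) and its trace, and $\circ$ for trace-free symmetric parts. We say that $\boldsymbol c$ *contains an asymptotically Poincaré–Einstein metric* if there are $g\in\boldsymbol c$ and a defining function $s$ such that on $M\setminus\Sigma$ the metric $g^o=s^{-2}g$ satisfies $\mathring P^{g^o}=s^{d-3}\,T$ for a rank two tensor $T$ smooth on $M$. *Asymptotic unit defining densities.* For $g\in\boldsymbol c$ and $s\in C^\infty M$ put $n=ds$, $\rho=-\frac1d(\Delta s+Js)$, $I_\sigma^2=|ds|_g^2+2s\rho$. The density $\sigma=[g;s]=[\Omega^2g;\Omega s]$ is an asymptotic unit defining density if $s$ is a defining function and $I_\sigma^2=1+s^dB$ with $B$ smooth. The canonical extension of the trace-free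 second fundamental form is $E_{ab}=\nabla_an_b+sP_{ab}+\rho g_{ab}$, of weight $1$. *Canonical fundamental forms.* On trace-free symmetric tensors $t_{ab}$ of weight $w$ let $$\begin{aligned}\mathbf{ID}\,t_{ab}=&(d+2w-6)\Big([\nabla_n+(w-2)\rho]t_{ab}-\tfrac{2(w-2)}{(w-3)(d+w-2)}n_{(a}\nabla\!\cdot t_{b)\circ}+\tfrac2{w-3}\big[n_c\nabla_{(a}t^c{}_{b)\circ}+(\nabla n)_{(a}\!\cdot t_{b)\circ}\big]\Big)\\&-s\Big(\Delta t_{ab}+(w-2)Jt_{ab}+\tfrac{2d}{(w-3)(d+w-2)}\nabla_{(a}\nabla\!\cdot t_{b)\circ}-4P_{(a}\!\cdot t_{b)\circ}\Big),\end{aligned}$$ of weight $w-1$, and along $\Sigma$, with unit conormal $\hat n$, mean curvature $H$, tangential projection $\top$ and its trace-free version $\mathring\top$, and Levi-Civita connection $\bar\nabla$ of the induced metric, $$\delta_R t_{ab}=\mathring\top\big[(\nabla_{\hat n}-(w-2)H)t_{ab}+\tfrac2{w-3}\bar\nabla_{(a}t^\top_{\hat nb)}\big].$$ For $2\le n<\frac{d+3}2$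 the canonical $n$th fundamental form is $\mathring\top E$ if $n=2$ and $\delta_R\circ\mathbf{ID}^{\,n-3}E$ if $n\ge3$. *Canonical conditional fundamental forms.* In the scale $g$ a standard tractor is a triple $T^A=(t^+,t^a,t^-)$; the tractor connection is $\nabla_aT=(\nabla_at^+-t_a,\ \nabla_at^b+\delta_a^bt^-+P_a^bt^+,\ \nabla_at^--P_{ab}t^b)$, $\Delta=g^{ab}\nabla_a\nabla_b$, and $I^A=(s,n^a,\rho)$. Let $P^{AB}$ be the rank two tractor of weight $-1$ whose first-index components are $P^{+B}=0$, $P^{aB}=\nabla^aI^B$, $P^{-B}=-\frac1{d-2}\Delta I^B$. Let $\underline w$ be the weight operator, a derivation equal to $w$ on weight $w$ tractors and with $\underline w\log\tau=1$ for a true scale $\tau=[g;t]$, $0<t\in C^\infty M$ (so $\log \tau$ is represented by $\log t$ in the scale $g$), and let $I\!\cdot\!D=(d+2\underline w-2)(\nabla_n+\rho\,\underline w)-s(\Delta+J\underline w)$, where $\nabla$ acts by the Leibniz rule and $\nabla \log\tau=d\log t$. For a symmetric tractor $T^{AB}$ of weight $w$ along $\Sigma$, with components $T^{++}$, $T^{+}_b$,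 $T_{ab}$ (indices lowered with $g$), put $$\mathcal E(T)_{ab}=\mathring\top\Big[T_{ab}-\tfrac2w\bar\nabla_{(a}T^{+\top}_{b)}+\tfrac1{w(w+1)}\bar\nabla_a\bar\nabla_bT^{++}-\tfrac1{w+1}\bar P_{ab}T^{++}\Big],$$ $\bar P$ being the Schouten tensor of the induced metric. For $\frac{d+3}2\le n\le d-1$ the canonical conditional $n$th fundamental form is $\mathcal E\big((I\!\cdot\! D)^{n-2}(P\log\tau)-\log\tau\,(I\!\cdot\! D)^{n-2}P\big)$. The embedding is *überumbilic* if the canonical $n$th fundamental forms vanish on $\Sigma$ for all $2\le n\le\lceil\frac{d+1}2\rceil$ (it is *hyperumbilic*) and the canonical conditional $n$th fundamental forms vanish on $\Sigma$ for all $\lceil\frac{d+3}2\rceil\le n\le d-1$. **Theorem.** For every $g\in\boldsymbol c$ there is an asymptotic unit defining density $[g;s]$ for $\Sigma$. For every choice of $g\in\boldsymbol c$, of such a density $\sigma=[g;s]$ and of a true scale $\tau$, the conformal class $\boldsymbol c$ contains an asymptotically Poincaré–Einstein metric if and only if the embedding $\Sigma\hookrightarrow(M,\boldsymbol c)$ is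 überumbilic (with the canonical forms built from $\sigma$ and $\tau$). -/

import Mathlib

open scoped Manifold ContDiff

noncomputable section

namespace ConfHyp

/-! ## Riemannian geometry in coordinates

All tensor fields below are given by their components in a coordinate chart: functions of the
coordinates `x : Coord d` with values in arrays indexed by `Fin d`. A metric is the array `G` of its
components `g_{ij}`. Only the germ of the arrays at a point matters for the value of the operators
at this point. -/

/-- The coordinate space `ℝ^d`. -/
abbrev Coord (d : ℕ) : Type := EuclideanSpace ℝ (Fin d)

/-- Component functions of covariant tensor fields of rank one, two and three. -/
abbrev Cov1 (d : ℕ) : Type := Coord d → Fin d → ℝ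
abbrev Cov2 (d : ℕ) : Type := Coord d → Fin d → Fin d → ℝ
abbrev Cov3 (d : ℕ) : Type := Coord d → Fin d → Fin d → Fin d → ℝ

variable {d : ℕ}

/-- The partial derivative `∂_i f`. -/
def pd (i : Fin d) (f : Coord d → ℝ) (x : Coord d) : ℝ :=
  fderiv ℝ f x (EuclideanSpace.single i 1)

/-- The inverse metric `g^{ij}`. -/
def ginv (G : Cov2 d) (x : Coord d) (i j : Fin d) : ℝ := (Matrix.of (G x))⁻¹ i j

/-- The Christoffel symbols `Γ^k_{ij}` of the Levi-Civita connection. -/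
def christ (G : Cov2 d) (k i j : Fin d) (x : Coord d) : ℝ :=
  (1 / 2) * ∑ l, ginv G x k l *
    (pd i (fun y => G y l j) x + pd j (fun y => G y l i) x - pd l (fun y => G y i j) x)

/-- The Riemann tensor `R_{ij}{}^l{}_k`, that is
`∇_i ∇_j ∂_k - ∇_j ∇_i ∂_k = R_{ij}{}^l{}_k ∂_l`. -/
def riem (G : Cov2 d) (i j l k : Fin d) (x : Coord d) : ℝ :=
  pd i (christ G l j k) x - pd j (christ G l i k) x
    + ∑ m, (christ G l i m x * christ G m j k x - christ G l j m x * christ G m i k x)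

/-- The Ricci tensor `Ric_{bc} = R_{ab}{}^a{}_c`. -/
def ricci (G : Cov2 d) : Cov2 d := fun x b c => ∑ a, riem G a b a c x

/-- The trace `g^{ab} t_{ab}`. -/
def trace (G : Cov2 d) (t : Cov2 d) (x : Coord d) : ℝ := ∑ a, ∑ b, ginv G x a b * t x a b

/-- `J = Sc / (2 (d - 1))`, the trace of the Schouten tensor. -/
def schoutenJ (G : Cov2 d) (x : Coord d) : ℝ := trace G (ricci G) x / (2 * ((d : ℝ) - 1))

/-- The Schouten tensor, determined by `Ric = (d - 2) P + J g`. -/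
def schouten (G : Cov2 d) : Cov2 d := fun x a b =>
  (ricci G x a b - schoutenJ G x * G x a b) / ((d : ℝ) - 2)

/-- The symmetric trace-free part `t_{(ab)∘}` of a rank two tensor. -/
def symTf (G : Cov2 d) (t : Cov2 d) : Cov2 d := fun x a b =>
  (t x a b + t x b a) / 2 - trace G t x / (d : ℝ) * G x a b

/-- Levi-Civita derivatives `∇_c v_a`, `∇_c t_{ab}` and `∇_e t_{cab}`
(the index of the derivative comes first). -/
def nabla1 (G : Cov2 d) (v : Cov1 d) : Cov2 d := fun x c a =>
  pd c (fun y => v y a) x - ∑ e, christ G e c a x * v x e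

def nabla2 (G : Cov2 d) (t : Cov2 d) : Cov3 d := fun x c a b =>
  pd c (fun y => t y a b) x
    - ∑ e, (christ G e c a x * t x e b + christ G e c b x * t x a e)

def nabla3 (G : Cov2 d) (t : Cov3 d) (x : Coord d) (f c a b : Fin d) : ℝ :=
  pd f (fun y => t y c a b) x
    - ∑ e, (christ G e f c x * t x e a b + christ G e f a x * t x c e b
        + christ G e f b x * t x c a e)

/-- The gradient one-form `∇_a f`. -/
def grad (f : Coord d → ℝ) : Cov1 d := fun x a => pd a f x

/-- Raising an index: `v^a = g^{ab} v_b`. -/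
def raise (G : Cov2 d) (v : Cov1 d) : Cov1 d := fun x a => ∑ b, ginv G x a b * v x b

/-- The divergence `∇^a t_{ab}`. -/
def div2 (G : Cov2 d) (t : Cov2 d) : Cov1 d := fun x b =>
  ∑ a, ∑ c, ginv G x a c * nabla2 G t x a c b

/-- The Laplacian `g^{ef} ∇_e ∇_f t_{ab}` of a rank two tensor. -/
def lap2 (G : Cov2 d) (t : Cov2 d) : Cov2 d := fun x a b =>
  ∑ e, ∑ f, ginv G x e f * nabla3 G (nabla2 G t) x e f a b

/-- The contraction `u_a{}^c t_{cb}`. -/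
def contract (G : Cov2 d) (u t : Cov2 d) : Cov2 d := fun x a b =>
  ∑ c, ∑ e, ginv G x c e * u x a c * t x e b

/-! ## Weight one densities `σ = [g; s]` -/

/-- `ρ = - (Δ s + J s) / d`. -/
def rho (G : Cov2 d) (s : Coord d → ℝ) (x : Coord d) : ℝ :=
  -(trace G (nabla1 G (grad s)) x + schoutenJ G x * s x) / (d : ℝ)

/-- `I_σ^2 = h(I_σ, I_σ) = |ds|^2 + 2 s ρ`, the squared length of the scale tractor
`I_σ = (s, ds, ρ)`. -/
def scaleTractorSq (G : Cov2 d) (s : Coord d → ℝ) (x : Coord d) : ℝ :=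
  ∑ a, grad s x a * raise G (grad s) x a + 2 * s x * rho G s x

/-- The canonical extension `∇_a ∇_b s + s P_{ab} + ρ g_{ab}` of the trace-free second fundamental
form. -/
def secondFFExt (G : Cov2 d) (s : Coord d → ℝ) : Cov2 d := fun x a b =>
  nabla1 G (grad s) x a b + s x * schouten G x a b + rho G s x * G x a b

/-- The operator `𝐈𝐃_σ`, from trace-free symmetric tensors `t_{ab}` of weight `w` to such tensors of
weight `w - 1`, in the scale `g`. -/
def opID (G : Cov2 d) (s : Coord d → ℝ) (w : ℝ) (t : Cov2 d) : Cov2 d :=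
  let n : Cov1 d := grad s
  let nablaN : Cov2 d := fun x a b => ∑ c, raise G n x c * nabla2 G t x c a b
  let nDiv : Cov2 d := symTf G fun x a b => n x a * div2 G t x b
  let nNabla : Cov2 d := symTf G fun x a b => ∑ c, raise G n x c * nabla2 G t x a c b
  let hessT : Cov2 d := symTf G (contract G (nabla1 G n) t)
  let nablaDiv : Cov2 d := symTf G (nabla1 G (div2 G t))
  let schoutenT : Cov2 d := symTf G (contract G (schouten G) t)
  fun x a b =>
    ((d : ℝ) + 2 * w - 6) *
        (nablaN x a b + (w - 2) * rho G s x * t x a b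
          - 2 * (w - 2) / ((w - 3) * ((d : ℝ) + w - 2)) * nDiv x a b
          + 2 / (w - 3) * (nNabla x a b + hessT x a b))
      - s x * (lap2 G t x a b + (w - 2) * schoutenJ G x * t x a b
          + 2 * (d : ℝ) / ((w - 3) * ((d : ℝ) + w - 2)) * nablaDiv x a b
          - 4 * schoutenT x a b)

/-- The power `𝐈𝐃_σ^k` acting on tensors of weight `w`. -/
def opIDPow (G : Cov2 d) (s : Coord d → ℝ) (w : ℝ) : ℕ → Cov2 d → Cov2 d
  | 0, t => t
  | k + 1, t => opID G s (w - k) (opIDPow G s w k t)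

/-! ## The hypersurface `s = 0`

Tensors on the hypersurface are identified with the tangential ambient tensors along it. The
formulas below are stated with the unit conormal `ds / |ds|` in a neighbourhood of the hypersurface;
they are used at its points only. -/

/-- The unit conormal `ν_a = ∇_a s / |ds|`. -/
def conormal (G : Cov2 d) (s : Coord d → ℝ) : Cov1 d := fun x a =>
  grad s x a / Real.sqrt (∑ b, grad s x b * raise G (grad s) x b)

/-- The tangential projection `⊤_a{}^b = δ_a^b - ν_a ν^b`. -/
def tanProj (G : Cov2 d) (s : Coord d → ℝ) (x : Coord d) (a b : Fin d) : ℝ :=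
  (if a = b then 1 else 0) - conormal G s x a * raise G (conormal G s) x b

def top1 (G : Cov2 d) (s : Coord d → ℝ) (v : Cov1 d) : Cov1 d := fun x a =>
  ∑ b, tanProj G s x a b * v x b

def top2 (G : Cov2 d) (s : Coord d → ℝ) (t : Cov2 d) : Cov2 d := fun x a b =>
  ∑ c, ∑ e, tanProj G s x a c * tanProj G s x b e * t x c e

/-- The induced metric `g_{ab} - ν_a ν_b` and its inverse `g^{ab} - ν^a ν^b`. -/
def indMetric (G : Cov2 d) (s : Coord d → ℝ) : Cov2 d := fun x a b =>
  G x a b - conormal G s x a * conormal G s x b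

def indInv (G : Cov2 d) (s : Coord d → ℝ) (x : Coord d) (a b : Fin d) : ℝ :=
  ginv G x a b - raise G (conormal G s) x a * raise G (conormal G s) x b

/-- The trace of a rank two tensor with respect to the induced metric. -/
def indTrace (G : Cov2 d) (s : Coord d → ℝ) (t : Cov2 d) (x : Coord d) : ℝ :=
  ∑ a, ∑ b, indInv G s x a b * t x a b

/-- The projection to the symmetric, tangential part which is trace-free with respect to the induced
metric. -/
def topTf (G : Cov2 d) (s : Coord d → ℝ) (t : Cov2 d) : Cov2 d := fun x a b =>
  (top2 G s t x a b + top2 G s t x b a) / 2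
    - indTrace G s t x / ((d : ℝ) - 1) * indMetric G s x a b

/-- The Levi-Civita derivative of the induced metric on tangential one-forms, by the Gauss formula
`∇̄_a v_b = ⊤_a{}^c ⊤_b{}^e ∇_c v_e`. -/
def indNabla (G : Cov2 d) (s : Coord d → ℝ) (v : Cov1 d) : Cov2 d := top2 G s (nabla1 G v)

/-- The second fundamental form `⊤ ∇_a ν_b`. -/
def secondFF (G : Cov2 d) (s : Coord d → ℝ) : Cov2 d := top2 G s (nabla1 G (conormal G s))

/-- The mean curvature `H`. -/
def meanCurv (G : Cov2 d) (s : Coord d → ℝ) (x : Coord d) : ℝ :=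
  indTrace G s (secondFF G s) x / ((d : ℝ) - 1)

/-- The Ricci tensor of the induced metric, from the Gauss equation
`R̄_{abcd} = ⊤ R_{abcd} + II_{ac} II_{bd} - II_{ad} II_{bc}`. -/
def indRicci (G : Cov2 d) (s : Coord d → ℝ) : Cov2 d :=
  let nu : Cov1 d := conormal G s
  let ambient : Cov2 d := fun x b c =>
    ricci G x b c - ∑ a, ∑ l, raise G nu x a * nu x l * riem G a b l c x
  fun x b c => top2 G s ambient x b c
    + indTrace G s (secondFF G s) x * secondFF G s x b c
    - ∑ a, ∑ e, indInv G s x a e * secondFF G s x b a * secondFF G s x e c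

/-- The Schouten tensor of the induced metric, in hypersurface dimension `d - 1`. -/
def indSchouten (G : Cov2 d) (s : Coord d → ℝ) : Cov2 d := fun x a b =>
  (indRicci G s x a b
      - indTrace G s (indRicci G s) x / (2 * ((d : ℝ) - 2)) * indMetric G s x a b)
    / ((d : ℝ) - 3)

/-- The Robin operator on trace-free symmetric tensors of weight `w`,
`⊤° [ (∇_ν - (w - 2) H) t_{ab} + (2 / (w - 3)) ∇̄_{(a} t_{ν b)}^⊤ ]`. -/
def robin (G : Cov2 d) (s : Coord d → ℝ) (w : ℝ) (t : Cov2 d) : Cov2 d :=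
  let nuUp : Cov1 d := raise G (conormal G s)
  let tNu : Cov1 d := top1 G s fun x b => ∑ a, nuUp x a * t x a b
  topTf G s fun x a b =>
    (∑ c, nuUp x c * nabla2 G t x c a b) - (w - 2) * meanCurv G s x * t x a b
      + 2 / (w - 3) * indNabla G s tNu x a b

/-- The operators `δ^{(k)}` on trace-free symmetric tensors of weight `w`: the projection `⊤°` for
`k = 0`, and the Robin operator after `𝐈𝐃_σ^{k-1}` for `k ≥ 1`. -/
def deltaOp (G : Cov2 d) (s : Coord d → ℝ) (w : ℝ) : ℕ → Cov2 d → Cov2 d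
  | 0, t => topTf G s t
  | k + 1, t => robin G s (w - k) (opIDPow G s w k t)

/-- The canonical `n`th fundamental form, `δ^{(n-2)}` applied to the canonical extension of the
trace-free second fundamental form, which has weight one (`2 ≤ n < (d + 3) / 2`). -/
def canonicalFF (G : Cov2 d) (s : Coord d → ℝ) (n : ℕ) : Cov2 d :=
  deltaOp G s 1 (n - 2) (secondFFExt G s)

/-! ## Tractors

In the scale `g` a standard tractor `t⁺ Y + t^i Z_i + t⁻ X` is the column of its components `t⁺`
(index `inl ()`), `t^i` (index `inr (inl i)`) and `t⁻` (index `inr (inr ())`). -/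

abbrev TrIdx (d : ℕ) : Type := Unit ⊕ (Fin d ⊕ Unit)
abbrev Trac1 (d : ℕ) : Type := Coord d → TrIdx d → ℝ
abbrev Trac2 (d : ℕ) : Type := Coord d → Matrix (TrIdx d) (TrIdx d) ℝ

/-- The connection matrices of the tractor connection
`∇_i (t⁺, t^k, t⁻) = (∇_i t⁺ - t_i, ∇_i t^k + δ_i^k t⁻ + P_i^k t⁺, ∇_i t⁻ - P_{ij} t^j)`. -/
def tracConn (G : Cov2 d) (i : Fin d) (x : Coord d) : Matrix (TrIdx d) (TrIdx d) ℝ :=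
  Matrix.of fun A B => match A, B with
    | .inl _, .inr (.inl j) => -G x i j
    | .inr (.inl k), .inl _ => ∑ l, ginv G x k l * schouten G x l i
    | .inr (.inl k), .inr (.inl j) => christ G k i j x
    | .inr (.inl k), .inr (.inr _) => if k = i then 1 else 0
    | .inr (.inr _), .inr (.inl j) => -schouten G x i j
    | _, _ => 0

/-- The tractor connection, and the tractor Laplacian `g^{ij} ∇_i ∇_j`, on standard tractors and on
rank two tractors `T^{AB}`. -/
def tracNabla1 (G : Cov2 d) (i : Fin d) (V : Trac1 d) : Trac1 d := fun x A =>
  pd i (fun y => V y A) x + ∑ B, tracConn G i x A B * V x B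

def tracLap1 (G : Cov2 d) (V : Trac1 d) : Trac1 d := fun x A =>
  ∑ i, ∑ j, ginv G x i j *
    (tracNabla1 G i (tracNabla1 G j V) x A - ∑ k, christ G k i j x * tracNabla1 G k V x A)

def tracNabla2 (G : Cov2 d) (i : Fin d) (T : Trac2 d) : Trac2 d := fun x =>
  Matrix.of (fun A B => pd i (fun y => T y A B) x)
    + tracConn G i x * T x + T x * (tracConn G i x).transpose

def tracLap2 (G : Cov2 d) (T : Trac2 d) : Trac2 d := fun x =>
  ∑ i, ∑ j, ginv G x i j •
    (tracNabla2 G i (tracNabla2 G j T) x - ∑ k, christ G k i j x • tracNabla2 G k T x)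

/-- The scale tractor `I_σ = D̂ σ = (s, ∇^i s, ρ)`. -/
def scaleTractor (G : Cov2 d) (s : Coord d → ℝ) : Trac1 d := fun x A => match A with
  | .inl _ => s x
  | .inr (.inl i) => raise G (grad s) x i
  | .inr (.inr _) => rho G s x

/-- The weight `-1` tractor `P^{AB} = D̂^A I_σ^B`, where on tractors of weight zero
`D̂^A = g^{ij} Z_i^A ∇_j - (1 / (d - 2)) X^A Δ`. -/
def tractorP (G : Cov2 d) (s : Coord d → ℝ) : Trac2 d := fun x =>
  Matrix.of fun A B => match A with
    | .inl _ => 0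
    | .inr (.inl i) => ∑ j, ginv G x i j * tracNabla1 G j (scaleTractor G s) x B
    | .inr (.inr _) => -tracLap1 G (scaleTractor G s) x B / ((d : ℝ) - 2)

/-- Tractors with logarithms. For tractors `U, V` of weight `w` and a true scale `τ = [g; t]`, the
section `U + V log τ` is the pair of its value `U + V log t` in the scale `g` and of its logarithmic
coefficient `V`. Covariant differentiation in the scale `g` acts on both entries. -/
abbrev LogTrac2 (d : ℕ) : Type := Trac2 d × Trac2 d

/-- The weight operator, a derivation with `w̲ T = w T` on tractors `T` of weight `w` and
`w̲ log τ = 1`. -/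
def weightOp (w : ℝ) (F : LogTrac2 d) : LogTrac2 d := (w • F.1 + F.2, w • F.2)

/-- `I·D = (d + 2 w̲ - 2) (∇_n + ρ w̲) - s (Δ + J w̲)`, the contraction of the scale tractor with the
Thomas operator `D`, on rank two tractors of weight `w` with logarithms. -/
def opIdotD (G : Cov2 d) (s : Coord d → ℝ) (w : ℝ) (F : LogTrac2 d) : LogTrac2 d :=
  let nablaN : Trac2 d → Trac2 d := fun T x => ∑ i, raise G (grad s) x i • tracNabla2 G i T x
  let wF : LogTrac2 d := weightOp w F
  let K : LogTrac2 d :=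
    (fun x => nablaN F.1 x + rho G s x • wF.1 x, fun x => nablaN F.2 x + rho G s x • wF.2 x)
  let L : LogTrac2 d :=
    (fun x => tracLap2 G F.1 x + schoutenJ G x • wF.1 x,
      fun x => tracLap2 G F.2 x + schoutenJ G x • wF.2 x)
  ((d : ℝ) - 2) • K + (2 : ℝ) • weightOp w K - (fun x => s x • L.1 x, fun x => s x • L.2 x)

/-- The power `(I·D)^k` acting on weight `w`. -/
def opIdotDPow (G : Cov2 d) (s : Coord d → ℝ) (w : ℝ) : ℕ → LogTrac2 d → LogTrac2 d
  | 0, F => F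
  | k + 1, F => opIdotD G s (w - k) (opIdotDPow G s w k F)

/-- The tractor `(I·D)^k (P log τ) - log τ (I·D)^k P`, of weight `-1 - k`, for `τ = [g; t]`. -/
def logCommutator (G : Cov2 d) (s t : Coord d → ℝ) (k : ℕ) : Trac2 d :=
  let P : Trac2 d := tractorP G s
  fun x => (opIdotDPow G s (-1) k (fun y => Real.log (t y) • P y, P)).1 x
    - Real.log (t x) • (opIdotDPow G s (-1) k (P, 0)).1 x

/-- The composition `q̄* ∘ r̄ ∘ ⊤°` from symmetric rank two tractors of weight `w` along the
hypersurface to trace-free symmetric hypersurface tensors of weight `w + 2`,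
`⊤° [ T_{ab} - (2/w) ∇̄_{(a} T⁺_{b)} + (1/(w(w+1))) ∇̄_a ∇̄_b T⁺⁺ - (1/(w+1)) P̄_{ab} T⁺⁺ ]`,
where `T⁺⁺ = X_A X_B T^{AB}`, `T⁺_b = X_A Z_{B b} T^{AB}` and `T_{ab} = Z_{A a} Z_{B b} T^{AB}`. -/
def extractHyp (G : Cov2 d) (s : Coord d → ℝ) (w : ℝ) (T : Trac2 d) : Cov2 d :=
  let T0 : Coord d → ℝ := fun x => T x (.inl ()) (.inl ())
  let T1 : Cov1 d := fun x b => ∑ c, G x b c * T x (.inl ()) (.inr (.inl c))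
  let T2 : Cov2 d := fun x a b =>
    ∑ c, ∑ e, G x a c * G x b e * T x (.inr (.inl c)) (.inr (.inl e))
  topTf G s fun x a b =>
    T2 x a b - 2 / w * indNabla G s (top1 G s T1) x a b
      + 1 / (w * (w + 1)) * indNabla G s (top1 G s (grad T0)) x a b
      - 1 / (w + 1) * indSchouten G s x a b * T0 x

/-- The canonical conditional `n`th fundamental form
`q̄* ∘ r̄ ∘ ⊤° ( (I·D)^{n-2} (P log τ) - log τ (I·D)^{n-2} P )`, `(d + 3) / 2 ≤ n ≤ d - 1`. -/
def conditionalFF (G : Cov2 d) (s t : Coord d → ℝ) (n : ℕ) : Cov2 d :=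
  extractHyp G s (1 - (n : ℝ)) (logCommutator G s t (n - 2))

/-! ## Conformal hypersurface embeddings -/

section Manifold

variable (d) (M : Type*) [TopologicalSpace M] [ChartedSpace (Coord d) M]
  [IsManifold (𝓡 d) ∞ M]

/-- Smooth Riemannian metrics on the `d`-manifold `M`. -/
abbrev RMetric : Type _ :=
  Bundle.ContMDiffRiemannianMetric (𝓡 d) ∞ (Coord d) (fun p : M => TangentSpace (𝓡 d) p)

variable {d M}

/-- The components of a metric in a chart, `g(∂_i, ∂_j)`. -/
def RMetric.comp (g : RMetric d M) (φ : OpenPartialHomeomorph M (Coord d)) : Cov2 d :=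
  fun x i j => g.inner (φ.symm x)
    (mfderiv 𝓘(ℝ, Coord d) (𝓡 d) φ.symm x (EuclideanSpace.single i (1 : ℝ)))
    (mfderiv 𝓘(ℝ, Coord d) (𝓡 d) φ.symm x (EuclideanSpace.single j (1 : ℝ)))

/-- `g' = Ω² g` for a smooth positive function `Ω`. -/
def ConformallyRelated (g g' : RMetric d M) : Prop :=
  ∃ Ω : M → ℝ, ContMDiff (𝓡 d) 𝓘(ℝ, ℝ) ∞ Ω ∧ (∀ p, 0 < Ω p) ∧
    ∀ (p : M) (v w : TangentSpace (𝓡 d) p), g'.inner p v w = Ω p ^ 2 * g.inner p v w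

/-- A conformal class of metrics. -/
def IsConformalClass (c : Set (RMetric d M)) : Prop :=
  c.Nonempty ∧ ∀ g ∈ c, ∀ g' : RMetric d M, g' ∈ c ↔ ConformallyRelated g g'

/-- `s` is a defining function for the hypersurface `S`: a smooth function whose zero locus is `S`,
with `ds` nowhere zero along `S`. -/
def IsDefiningFunction (S : Set M) (s : M → ℝ) : Prop :=
  ContMDiff (𝓡 d) 𝓘(ℝ, ℝ) ∞ s ∧ (∀ p, p ∈ S ↔ s p = 0) ∧
    ∀ p ∈ S, mfderiv (𝓡 d) 𝓘(ℝ, ℝ) s p ≠ 0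

variable (d) in
/-- `S` is a smoothly embedded, separating hypersurface of `M`: it has a defining function. -/
def IsSeparatingHypersurface (S : Set M) : Prop :=
  ∃ s : M → ℝ, IsDefiningFunction (d := d) S s

/-- The components in a chart of the metric `s⁻² g` on the complement of the zero locus of `s`. -/
def singularMetric (g : RMetric d M) (s : M → ℝ) (φ : OpenPartialHomeomorph M (Coord d)) :
    Cov2 d :=
  fun x i j => (s (φ.symm x) ^ 2)⁻¹ * g.comp φ x i j

/-- The conformal class `c` contains an asymptotically Poincaré-Einstein metric: for some `g ∈ c`
and some defining function `s`, the trace-free Schouten tensor of `s⁻² g` is `s^(d-3)` times a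
tensor `T` that is smooth up to and across `S`. (The complement of `S` is dense, so that `T` is
unique, and the components of `T` in different charts fit together.) -/
def AdmitsAsymptoticallyPoincareEinstein (c : Set (RMetric d M)) (S : Set M) : Prop :=
  ∃ g ∈ c, ∃ s : M → ℝ, IsDefiningFunction (d := d) S s ∧
    ∀ φ ∈ IsManifold.maximalAtlas (𝓡 d) ∞ M, ∃ T : Cov2 d,
      (∀ i j, ContDiffOn ℝ ∞ (fun x => T x i j) φ.target) ∧
      ∀ x ∈ φ.target, φ.symm x ∉ S → ∀ i j,
        symTf (singularMetric g s φ) (schouten (singularMetric g s φ)) x i j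
          = s (φ.symm x) ^ (d - 3) * T x i j

/-- `σ = [g; s]` is an asymptotic unit defining density for `S`: `s` is a defining function and
`I_σ² = 1 + σ^d B` with `B` smooth. -/
def IsAsymptoticUnitDefining (g : RMetric d M) (S : Set M) (s : M → ℝ) : Prop :=
  IsDefiningFunction (d := d) S s ∧
    ∀ φ ∈ IsManifold.maximalAtlas (𝓡 d) ∞ M, ∃ B : Coord d → ℝ,
      ContDiffOn ℝ ∞ B φ.target ∧
      ∀ x ∈ φ.target, scaleTractorSq (g.comp φ) (s ∘ φ.symm) x = 1 + s (φ.symm x) ^ d * B x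

/-- `τ = [g; t]` is a true scale: `t` is smooth and positive. -/
def IsTrueScale (t : M → ℝ) : Prop :=
  ContMDiff (𝓡 d) 𝓘(ℝ, ℝ) ∞ t ∧ ∀ p, 0 < t p

/-- All canonical `n`th fundamental forms with `2 ≤ n ≤ ⌈(d+1)/2⌉`, built from the asymptotic unit
defining density `[g; s]`, vanish along `S`. -/
def IsHyperumbilic (g : RMetric d M) (S : Set M) (s : M → ℝ) : Prop :=
  ∀ n : ℕ, 2 ≤ n → n ≤ ⌈((d : ℚ) + 1) / 2⌉₊ →
    ∀ φ ∈ IsManifold.maximalAtlas (𝓡 d) ∞ M, ∀ x ∈ φ.target, φ.symm x ∈ S →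
      ∀ a b, canonicalFF (g.comp φ) (s ∘ φ.symm) n x a b = 0

/-- The embedding is hyperumbilic and all canonical conditional `n`th fundamental forms with
`⌈(d+3)/2⌉ ≤ n ≤ d - 1`, built from the asymptotic unit defining density `[g; s]` and the true scale
`[g; t]`, vanish along `S`. -/
def IsUberumbilic (g : RMetric d M) (S : Set M) (s t : M → ℝ) : Prop :=
  IsHyperumbilic g S s ∧
    ∀ n : ℕ, ⌈((d : ℚ) + 3) / 2⌉₊ ≤ n → n ≤ d - 1 →
      ∀ φ ∈ IsManifold.maximalAtlas (𝓡 d) ∞ M, ∀ x ∈ φ.target, φ.symm x ∈ S →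
        ∀ a b, conditionalFF (g.comp φ) (s ∘ φ.symm) (t ∘ φ.symm) n x a b = 0

end Manifold

end ConfHyp

end

open ConfHyp

/-! Write `E` for the canonical extension `∇∇s + sP + ρg`, which is trace-free and symmetric. Two
facts reduce the theorem to a statement about the order of vanishing of `E` along the hypersurface.
The trace-free Schouten tensor of `s⁻²g` is `s⁻¹E` (`symTf_schouten_singular`), so the pair `(g, s)`
is asymptotically Poincaré–Einstein exactly when `E = O(s^(d-2))`. If some other representative and
defining function work, they amount to a second defining function `us` for the same `g`, and `E(us)
= O(s^(d-2))` together with the unit condition on `s` forces `E(s) = O(s^(d-2))`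
(`lead_of_rescaled`).

It remains to see that `E = O(s^(d-2))` if and only if all the forms vanish (`lead_iff`). Suppose `E
= s^k F` with `k ≤ d - 3`. Differentiating `I² = 1 + s^d B` gives `E n + s (∇ρ - P n) = O(s^(d-1))`,
while the contracted Bianchi identity gives `(d - 1)(∇ρ - P n) = -div E`. At leading order `(1 -
k/(d-1)) F n = 0`, so `F` is tangential along the hypersurface, and also trace-free. On such leading
terms the operators act by scalars. Each application of `𝐈𝐃` lowers the order by one and multiplies
`F` by `(k-l)(d-3-k-l)` at step `l`, and the Robin operator performs the last derivative. Hence the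
canonical form with index `n = k + 2` is a nonzero multiple of `F` as long as `2k + 1 < d`
(`canonicalFF_eq`).

For larger `k` one of these factors is zero. The tractor `P^{AB}` has middle block `E` and remaining
entries built from `∇ρ - P n`; it vanishes to the same order, and `I·D` acts on it with the same
scalars. The logarithm differentiates the scalar with respect to the weight and so replaces exactly
one vanishing factor by a nonzero one, which makes the conditional form a nonzero multiple of `F`
(`conditionalFF_eq`). In both ranges the form with index `k + 2` vanishes if and only if `F` does,
and Hadamard's lemma then raises the order of `E` by one.

Existence of an asymptotic unit defining density is an order by order correction. Adding `s^(m+2) f`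
to `s` changes the coefficient of `s^(m+1)` in `I²` by `2(m+2)(d-m-1)f/d`, which can be prescribed
while `m + 1 < d` (`lead_improve`).

The curvature identities are proved for matrices over a ring with commuting derivations and then
evaluated on smooth functions. The predicate `Lead` keeps track of orders and leading coefficients.
-/

namespace ConfHyp

open Filter Topology Set MeasureTheory

/-! ### Hadamard's lemma: division by a defining function -/

section Analysis

variable {E : Type*} [NormedAddCommGroup E] [NormedSpace ℝ E]

/-- Smooth dependence of an integral over `[0, 1]` on a parameter. -/
theorem contDiff_intervalIntegral_param {g : E → ℝ → ℝ}
    (hg : ContDiff ℝ ∞ (fun q : E × ℝ => g q.1 q.2)) :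
    ContDiff ℝ ∞ (fun y => ∫ t in (0 : ℝ)..1, g y t) := by
  -- The integral is the value at `0` of the convolution of the indicator of `(0, 1]` with `u ↦ g y
  -- (-u)`. The bump equals one on `[-1, 1]`, so it leaves this value unchanged while giving the
  -- second factor the compact support that the parametric smoothness of convolutions asks for.
  let χ : ContDiffBump (0 : ℝ) := ⟨1, 2, one_pos, one_lt_two⟩
  let g' : E → ℝ → ℝ := fun y u => χ u * g y (-u)
  have hg' : ContDiffOn ℝ ∞ (fun q : E × ℝ => g' q.1 q.2) (univ ×ˢ univ) := by
    apply ContDiff.contDiffOn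
    have h1 : ContDiff ℝ ∞ (fun q : E × ℝ => χ q.2) := χ.contDiff.comp contDiff_snd
    have h2 : ContDiff ℝ ∞ (fun q : E × ℝ => g q.1 (-q.2)) :=
      hg.comp (contDiff_fst.prodMk contDiff_snd.neg)
    exact h1.mul h2
  have hf : LocallyIntegrable (indicator (Ioc (0 : ℝ) 1) fun _ => (1 : ℝ)) volume := by
    apply (locallyIntegrable_const (1 : ℝ)).indicator measurableSet_Ioc
  have key := contDiffOn_convolution_right_with_param (n := ⊤) (μ := volume)
    (ContinuousLinearMap.mul ℝ ℝ) (g := g') (s := univ) (k := Metric.closedBall (0 : ℝ) 2)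
    isOpen_univ (isCompact_closedBall 0 2) (by
      intro p x _ hx
      have : χ x = 0 := by
        apply χ.zero_of_le_dist
        simp only [Metric.mem_closedBall, not_le] at hx
        exact hx.le
      simp [g', this]) hf (by exact_mod_cast hg')
  have key2 := (key.comp (t := univ ×ˢ univ) (s := (univ : Set E))
    (f := fun y : E => (y, (0 : ℝ))) (by fun_prop) (by intro x _; simp))
  rw [contDiffOn_univ] at key2
  convert key2 using 2 with y
  simp only [Function.comp, convolution, zero_sub, ContinuousLinearMap.mul_apply']
  rw [intervalIntegral.integral_of_le zero_le_one, ← integral_indicator measurableSet_Ioc]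
  congr 1
  ext t
  by_cases ht : t ∈ Ioc (0 : ℝ) 1
  · have : χ (-t) = 1 := by
      apply χ.one_of_mem_closedBall
      simp only [Metric.mem_closedBall, dist_zero_right, norm_neg, Real.norm_eq_abs]
      rw [abs_of_pos ht.1]; exact ht.2
    simp [ht, g', this]
  · simp [ht]

/-- Hadamard's lemma for a hyperplane. -/
theorem hadamard_hyperplane {f : E → ℝ} (hf : ContDiff ℝ ∞ f) (l : E →L[ℝ] ℝ) (v : E)
    (hlv : l v = 1) (h0 : ∀ y, l y = 0 → f y = 0) :
    ∃ h : E → ℝ, ContDiff ℝ ∞ h ∧ ∀ y, f y = l y * h y := by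
  -- The segment `t ↦ y - (1 - t) l(y) v` runs from the hyperplane `l = 0` to `y` with velocity
  -- `l(y) v`; the fundamental theorem of calculus along it produces the factor `l(y)`.
  refine ⟨fun y => ∫ t in (0 : ℝ)..1, fderiv ℝ f (y - (1 - t) • l y • v) v,
    contDiff_intervalIntegral_param ?_, ?_⟩
  · have h1 : ContDiff ℝ ∞ (fun z => fderiv ℝ f z v) :=
      (hf.fderiv_right (m := ∞) (by simp)).clm_apply contDiff_const
    exact h1.comp (by fun_prop)
  · intro y
    have hd : ∀ t : ℝ, HasDerivAt (fun t : ℝ => f (y - (1 - t) • l y • v))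
        (l y * fderiv ℝ f (y - (1 - t) • l y • v) v) t := by
      intro t
      have h1 : HasFDerivAt f (fderiv ℝ f (y - (1 - t) • l y • v)) (y - (1 - t) • l y • v) :=
        (hf.differentiable (by simp)).differentiableAt.hasFDerivAt
      have h2 : HasDerivAt (fun t : ℝ => y - (1 - t) • l y • v) (l y • v) t := by
        have := (((hasDerivAt_id t).const_sub 1).smul_const (l y • v)).const_sub y
        simpa using this
      exact (h1.comp_hasDerivAt t h2).congr_deriv (by simp)
    have hc : Continuous fun t : ℝ => l y * fderiv ℝ f (y - (1 - t) • l y • v) v := by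
      have h1 : Continuous (fun z => fderiv ℝ f z v) :=
        ((hf.fderiv_right (m := ∞) (by simp)).clm_apply contDiff_const).continuous
      exact continuous_const.mul (h1.comp (by fun_prop))
    have := intervalIntegral.integral_eq_sub_of_hasDerivAt (a := 0) (b := 1)
      (fun t _ => hd t) (hc.intervalIntegrable 0 1)
    rw [intervalIntegral.integral_const_mul] at this
    rw [this]
    have hz : f (y - l y • v) = 0 := h0 _ (by simp [hlv])
    simp [hz]

/-- A smooth function cut off to a neighbourhood of a point. -/
theorem exists_contDiff_eventuallyEq [FiniteDimensional ℝ E] {f : E → ℝ} {y : E} {W : Set E}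
    (hW : W ∈ 𝓝 y) (hf : ∀ z ∈ W, ContDiffAt ℝ ∞ f z) :
    ∃ F χ : E → ℝ, ContDiff ℝ ∞ F ∧ (∀ z, F z = χ z * f z) ∧ (∀ z ∉ W, χ z = 0) ∧
      F =ᶠ[𝓝 y] f := by
  obtain ⟨r, hr, hrW⟩ := Metric.mem_nhds_iff.1 hW
  let χ : ContDiffBump y := ⟨r / 4, r / 2, by positivity, by linarith⟩
  refine ⟨fun z => χ z * f z, χ, ?_, fun z => rfl, ?_, ?_⟩
  · rw [contDiff_iff_contDiffAt]
    intro z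
    by_cases hz : z ∈ tsupport χ
    · have : z ∈ W := by
        apply hrW
        rw [χ.tsupport_eq] at hz
        exact Metric.closedBall_subset_ball (by change r / 2 < r; linarith) hz
      exact χ.contDiff.contDiffAt.mul (hf z this)
    · have h0 : (fun z => χ z * f z) =ᶠ[𝓝 z] fun _ => 0 := by
        have := notMem_tsupport_iff_eventuallyEq.1 hz
        filter_upwards [this] with w hw
        simp [hw]
      exact contDiffAt_const.congr_of_eventuallyEq h0
  · intro z hz
    apply χ.zero_of_le_dist
    by_contra hlt
    exact hz (hrW (by
      rw [Metric.mem_ball]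
      have : χ.rOut = r / 2 := rfl
      linarith [not_le.1 hlt]))
  · filter_upwards [χ.eventuallyEq_one] with z hz
    simp [hz]

/-- Hadamard's lemma near a regular zero. -/
theorem hadamard_local [FiniteDimensional ℝ E] {f s : E → ℝ} {U : Set E} (hU : IsOpen U)
    (hf : ContDiffOn ℝ ∞ f U) (hs : ContDiffOn ℝ ∞ s U) {x : E} (hx : x ∈ U)
    (hds : fderiv ℝ s x ≠ 0) (h0 : ∀ y ∈ U, s y = 0 → f y = 0) :
    ∃ h : E → ℝ, ContDiffAt ℝ ∞ h x ∧ ∀ᶠ y in 𝓝 x, f y = s y * h y := by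
  have : CompleteSpace E := FiniteDimensional.complete ℝ E
  obtain ⟨v0, hv0⟩ : ∃ v, fderiv ℝ s x v ≠ 0 := by
    by_contra! h
    exact hds (ContinuousLinearMap.ext h)
  set l := fderiv ℝ s x with hl
  let v := (l v0)⁻¹ • v0
  have hlv : l v = 1 := by simp [v, hv0]
  -- A straightening of the zero locus: since `l v = 1`, one has `l ∘ Φ = s`, and the derivative of
  -- `Φ` at `x` is the identity.
  let Φ : E → E := fun y => y + (s y - l y) • v
  have hsat : ∀ y ∈ U, ContDiffAt ℝ ∞ s y := fun y hy => hs.contDiffAt (hU.mem_nhds hy)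
  have hfat : ∀ y ∈ U, ContDiffAt ℝ ∞ f y := fun y hy => hf.contDiffAt (hU.mem_nhds hy)
  have hΦ : ∀ y ∈ U, ContDiffAt ℝ ∞ Φ y := fun y hy =>
    contDiffAt_id.add (((hsat y hy).sub l.contDiff.contDiffAt).smul contDiffAt_const)
  have hlΦ : ∀ y, l (Φ y) = s y := by intro y; simp [Φ, hlv]
  have hder : ∀ y ∈ U, HasFDerivAt Φ
      (ContinuousLinearMap.id ℝ E + (fderiv ℝ s y - l).smulRight v) y := by
    intro y hy
    exact (hasFDerivAt_id y).add
      ((((hsat y hy).differentiableAt (by simp)).hasFDerivAt.sub l.hasFDerivAt).smul_const v)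
  have hderx : HasFDerivAt Φ ((ContinuousLinearEquiv.refl ℝ E : E ≃L[ℝ] E) : E →L[ℝ] E) x := by
    have := hder x hx
    rw [← hl] at this
    simpa using this
  let e := (hΦ x hx).toOpenPartialHomeomorph Φ hderx (by simp)
  have he : ∀ y, e y = Φ y := fun y => rfl
  have hxs : x ∈ e.source := (hΦ x hx).mem_toOpenPartialHomeomorph_source hderx (by simp)
  have hcont : ContinuousAt (fun y => ContinuousLinearMap.id ℝ E +
      (fderiv ℝ s y - l).smulRight v) x := by
    have h1 : ContinuousAt (fderiv ℝ s) x :=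
      ((hsat x hx).fderiv_right (m := 0) (by simp)).continuousAt
    have h2 : Continuous fun L : E →L[ℝ] ℝ => L.smulRight v := by
      exact ((ContinuousLinearMap.smulRightL ℝ E E).flip v).continuous
    exact continuousAt_const.add (h2.continuousAt.comp (h1.sub continuousAt_const))
  -- The derivative of `Φ` has to be invertible at all points near `x`, not only at `x`, for the
  -- local inverse to be smooth on a whole neighbourhood.
  have hequiv : ∀ᶠ y in 𝓝 x, (ContinuousLinearMap.id ℝ E + (fderiv ℝ s y - l).smulRight v) ∈
      range ((↑) : (E ≃L[ℝ] E) → E →L[ℝ] E) := by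
    apply hcont.eventually_mem
    have := ContinuousLinearEquiv.nhds (ContinuousLinearEquiv.refl ℝ E)
    convert this using 2
    ext w
    simp [← hl]
  have hW0 : ∀ᶠ y in 𝓝 x, y ∈ U ∧ y ∈ e.source ∧
      (ContinuousLinearMap.id ℝ E + (fderiv ℝ s y - l).smulRight v) ∈
      range ((↑) : (E ≃L[ℝ] E) → E →L[ℝ] E) :=
    (hU.eventually_mem hx).and ((e.open_source.eventually_mem hxs).and hequiv)
  have hxt : Φ x ∈ e.target := e.map_source hxs
  have hsymx : e.symm (Φ x) = x := e.left_inv hxs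
  have hWt : ∀ᶠ z in 𝓝 (Φ x), z ∈ e.target ∧ (e.symm z ∈ U ∧ e.symm z ∈ e.source ∧
      (ContinuousLinearMap.id ℝ E + (fderiv ℝ s (e.symm z) - l).smulRight v) ∈
      range ((↑) : (E ≃L[ℝ] E) → E →L[ℝ] E)) := by
    refine (e.open_target.eventually_mem hxt).and ?_
    have hc : Tendsto e.symm (𝓝 (Φ x)) (𝓝 x) := by
      have := e.continuousAt_symm hxt
      rwa [ContinuousAt, hsymx] at this
    exact hc.eventually hW0
  have hsm : ∀ z ∈ {z | z ∈ e.target ∧ (e.symm z ∈ U ∧ e.symm z ∈ e.source ∧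
      (ContinuousLinearMap.id ℝ E + (fderiv ℝ s (e.symm z) - l).smulRight v) ∈
      range ((↑) : (E ≃L[ℝ] E) → E →L[ℝ] E))}, ContDiffAt ℝ ∞ (fun z => f (e.symm z)) z := by
    rintro z ⟨hz1, hz2, hz3, ⟨A, hA⟩⟩
    have h1 : ContDiffAt ℝ ∞ e.symm z :=
      e.contDiffAt_symm hz1 (f₀' := A) (by rw [hA]; exact hder _ hz2) (hΦ _ hz2)
    exact (hfat _ hz2).comp z h1
  -- The hyperplane version needs a function on the whole space, so `f ∘ Φ⁻¹` is cut off. The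
  -- cut-off does not destroy the vanishing on `l = 0`.
  obtain ⟨F, χ, hF, hFχ, hχ, hFf⟩ := exists_contDiff_eventuallyEq hWt hsm
  obtain ⟨h, hh, hFh⟩ := hadamard_hyperplane hF l v hlv (by
    intro z hz
    rw [hFχ]
    by_cases hzW : z ∈ {z | z ∈ e.target ∧ (e.symm z ∈ U ∧ e.symm z ∈ e.source ∧
      (ContinuousLinearMap.id ℝ E + (fderiv ℝ s (e.symm z) - l).smulRight v) ∈
      range ((↑) : (E ≃L[ℝ] E) → E →L[ℝ] E))}
    · rw [h0 (e.symm z) hzW.2.1, mul_zero]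
      rw [← hlΦ, ← he, e.right_inv hzW.1, hz]
    · rw [hχ z hzW, zero_mul])
  refine ⟨fun y => h (Φ y), hh.contDiffAt.comp x (hΦ x hx), ?_⟩
  have hΦc : Tendsto Φ (𝓝 x) (𝓝 (Φ x)) := (hΦ x hx).continuousAt
  filter_upwards [hΦc.eventually hFf, e.open_source.mem_nhds hxs] with y hy hys
  have : f y = F (Φ y) := by
    rw [hy, ← he, e.left_inv hys]
  rw [this, hFh, hlΦ]

/-- If `s` were zero on a whole neighbourhood, its derivative at `x` would be zero. This is the
density on which every uniqueness argument for quotients by `s` relies. -/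
theorem frequently_ne_zero {s : E → ℝ} {x : E} (hds : fderiv ℝ s x ≠ 0) :
    ∃ᶠ y in 𝓝 x, s y ≠ 0 := by
  intro h
  apply hds
  have : s =ᶠ[𝓝 x] fun _ => (0 : ℝ) := by
    filter_upwards [h] with y hy
    simpa using hy
  rw [this.fderiv_eq]
  simp

/-- Near a regular zero of `s`, a continuous function is determined by its values at the points with
`s ≠ 0`. -/
theorem eq_of_eventually_ne_zero {s f g : E → ℝ} {x : E} (hs : s x = 0 → fderiv ℝ s x ≠ 0)
    (hf : ContinuousAt f x) (hg : ContinuousAt g x) (h : ∀ᶠ y in 𝓝 x, s y ≠ 0 → f y = g y) :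
    f x = g x := by
  by_cases hx : s x = 0
  · by_contra hne
    have h1 : ∀ᶠ y in 𝓝 x, f y ≠ g y := (hf.ne_iff_eventually_ne hg).1 hne
    obtain ⟨y, hy, h2, h3⟩ := ((frequently_ne_zero (hs hx)).and_eventually (h.and h1)).exists
    exact h3 (h2 hy)
  · exact h.self_of_nhds hx

/-- Hadamard's lemma: division by a defining function. -/
theorem hadamard [FiniteDimensional ℝ E] {f s : E → ℝ} {U : Set E} (hU : IsOpen U)
    (hf : ContDiffOn ℝ ∞ f U) (hs : ContDiffOn ℝ ∞ s U)
    (hds : ∀ x ∈ U, s x = 0 → fderiv ℝ s x ≠ 0) (h0 : ∀ y ∈ U, s y = 0 → f y = 0) :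
    ∃ h : E → ℝ, ContDiffOn ℝ ∞ h U ∧ ∀ y ∈ U, f y = s y * h y := by
  have loc : ∀ x, ∃ h : E → ℝ, x ∈ U → s x = 0 →
      (ContDiffAt ℝ ∞ h x ∧ ∀ᶠ y in 𝓝 x, f y = s y * h y) := by
    intro x
    by_cases hx : x ∈ U ∧ s x = 0
    · obtain ⟨h, hh⟩ := hadamard_local hU hf hs hx.1 (hds x hx.1 hx.2) h0
      exact ⟨h, fun _ _ => hh⟩
    · exact ⟨0, fun h1 h2 => absurd ⟨h1, h2⟩ hx⟩
  choose k hk using loc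
  -- At a zero of `s` the value is that of the local quotient built at the same point. Local
  -- quotients agree at nearby zeros because they agree at the points with `s ≠ 0`, which accumulate
  -- there; no partition of unity is needed.
  refine ⟨fun x => if s x = 0 then k x x else f x / s x, ?_, ?_⟩
  · intro x hx
    apply ContDiffAt.contDiffWithinAt
    have hsx : ContDiffAt ℝ ∞ s x := hs.contDiffAt (hU.mem_nhds hx)
    by_cases hx0 : s x = 0
    · obtain ⟨h1, h2⟩ := hk x hx hx0
      refine h1.congr_of_eventuallyEq ?_
      have h1' : ∀ᶠ y in 𝓝 x, ContDiffAt ℝ 0 (k x) y :=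
        (h1.of_le (m := 0) (by simp)).eventually (by simp)
      filter_upwards [h1', h2.eventually_nhds, hU.mem_nhds hx] with y hy1 hy2 hyU
      by_cases hy0 : s y = 0
      · simp only [hy0, if_true]
        obtain ⟨h3, h4⟩ := hk y hyU hy0
        refine eq_of_eventually_ne_zero (s := s) (fun _ => hds y hyU hy0) h3.continuousAt
          hy1.continuousAt ?_
        filter_upwards [hy2, h4] with z hz1 hz2 hz
        exact mul_left_cancel₀ hz (hz2.symm.trans hz1)
      · simp only [hy0, if_false]
        rw [hy2.self_of_nhds]
        field_simp
    · have : (fun x => if s x = 0 then k x x else f x / s x) =ᶠ[𝓝 x] fun y => f y / s y := by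
        filter_upwards [hsx.continuousAt.eventually_ne hx0] with y hy
        simp [hy]
      exact ((hf.contDiffAt (hU.mem_nhds hx)).div hsx hx0).congr_of_eventuallyEq this
  · intro y hy
    by_cases hy0 : s y = 0
    · simp [hy0, h0 y hy hy0]
    · simp only [hy0, if_false]
      field_simp

end Analysis

end ConfHyp

namespace ConfHyp

/-! ## Levi-Civita connections over a ring with commuting derivations -/

section Algebra

variable {A : Type*} [CommRing A] [Algebra ℝ A] {ι m n p : Type*}

/-- Entrywise application of a derivation to a matrix. -/
def dmat (D : Derivation ℝ A A) (X : Matrix m n A) : Matrix m n A := X.map D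

section dmat

variable (D : Derivation ℝ A A)

@[simp] theorem dmat_apply (X : Matrix m n A) (i : m) (j : n) : dmat D X i j = D (X i j) := rfl

theorem dmat_add (X Y : Matrix m n A) : dmat D (X + Y) = dmat D X + dmat D Y := by
  ext; simp

theorem dmat_sub (X Y : Matrix m n A) : dmat D (X - Y) = dmat D X - dmat D Y := by
  ext; simp

theorem dmat_smul (a : A) (X : Matrix m n A) : dmat D (a • X) = D a • X + a • dmat D X := by
  ext; simp; ring

theorem dmat_transpose (X : Matrix m n A) : dmat D X.transpose = (dmat D X).transpose := by
  ext; simp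

theorem dmat_mul [Fintype n] (X : Matrix m n A) (Y : Matrix n p A) :
    dmat D (X * Y) = dmat D X * Y + X * dmat D Y := by
  ext i j
  simp only [dmat_apply, Matrix.mul_apply, map_sum, Derivation.leibniz, smul_eq_mul,
    Matrix.add_apply, ← Finset.sum_add_distrib]
  refine Finset.sum_congr rfl fun k _ => ?_
  ring

theorem dmat_one [DecidableEq m] : dmat D (1 : Matrix m m A) = 0 := by
  ext i j
  by_cases h : i = j
  · subst h; simp
  · simp [Matrix.one_apply_ne h]

theorem dmat_sum {κ : Type*} (s : Finset κ) (X : κ → Matrix m n A) :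
    dmat D (∑ k ∈ s, X k) = ∑ k ∈ s, dmat D (X k) := by
  ext i j; simp [Matrix.sum_apply]

theorem trace_dmat [Fintype m] (X : Matrix m m A) : (dmat D X).trace = D X.trace := by
  simp [Matrix.trace]

theorem dmat_comm {D D' : Derivation ℝ A A} (h : ∀ f, D (D' f) = D' (D f)) (X : Matrix m n A) :
    dmat D (dmat D' X) = dmat D' (dmat D X) := by
  ext; simp [h]

end dmat

theorem eq_zero_of_add_self {a : A} (h : a + a = 0) : a = 0 := by
  have h2 : (2 : ℝ) • a = 0 := by rw [two_smul, h]
  have := congrArg (fun b => (1 / 2 : ℝ) • b) h2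
  simpa [smul_smul] using this

variable [Fintype ι] [DecidableEq ι]

/-- A metric `G` with inverse `gi` and its Levi-Civita connection, `(Γ i) k j = Γ^k_{ij}`, with
respect to commuting derivations. -/
structure LeviCivita (D : ι → Derivation ℝ A A) where
  G : Matrix ι ι A
  gi : Matrix ι ι A
  Γ : ι → Matrix ι ι A
  comm : ∀ i j f, D i (D j f) = D j (D i f)
  symm : G.transpose = G
  gi_mul : gi * G = 1
  compat : ∀ i, dmat (D i) G = (Γ i).transpose * G + G * Γ i
  torsion : ∀ i j k, Γ i k j = Γ j k i

namespace LeviCivita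

variable {D : ι → Derivation ℝ A A} (L : LeviCivita D)

/-- The curvature matrices. -/
def R (i j : ι) : Matrix ι ι A :=
  dmat (D i) (L.Γ j) - dmat (D j) (L.Γ i) + L.Γ i * L.Γ j - L.Γ j * L.Γ i

/-- The Ricci tensor. -/
def Ric : Matrix ι ι A := Matrix.of fun j k => ∑ a, L.R a j a k

/-- The scalar curvature. -/
def Sc : A := (L.gi * L.Ric).trace

/-- The covariant derivative of a covariant tensor of rank two. -/
def cd2 (i : ι) (T : Matrix ι ι A) : Matrix ι ι A :=
  dmat (D i) T - (L.Γ i).transpose * T - T * L.Γ i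

/-- The covariant derivative of a one-form. -/
def cd1 (v : ι → A) : Matrix ι ι A := Matrix.of fun i j => D i (v j) - ∑ e, L.Γ i e j * v e

/-- The divergence of a covariant tensor of rank two. -/
def div (T : Matrix ι ι A) (b : ι) : A := ∑ a, (L.gi * L.cd2 a T) a b

/-- The divergence of a one-form. -/
def div1 (v : ι → A) : A := (L.gi * L.cd1 v).trace

theorem mul_gi : L.G * L.gi = 1 := mul_eq_one_comm.1 L.gi_mul

theorem gi_symm : L.gi.transpose = L.gi := by
  have h : L.gi.transpose * L.G = 1 := by
    rw [← L.symm, ← Matrix.transpose_mul, L.mul_gi, Matrix.transpose_one]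
  calc L.gi.transpose = L.gi.transpose * (L.G * L.gi) := by rw [L.mul_gi, mul_one]
    _ = L.gi := by rw [← mul_assoc, h, one_mul]

theorem gi_symm_apply (i j : ι) : L.gi i j = L.gi j i := by
  conv_lhs => rw [← L.gi_symm]
  rfl

theorem G_symm_apply (i j : ι) : L.G i j = L.G j i := by
  conv_lhs => rw [← L.symm]
  rfl

/-- Differentiate `gi * G = 1`, insert the compatibility of `G`, and cancel `G` on the right. -/
theorem dmat_gi (i : ι) :
    dmat (D i) L.gi = -(L.Γ i * L.gi + L.gi * (L.Γ i).transpose) := by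
  have h : dmat (D i) (L.gi * L.G) = 0 := by rw [L.gi_mul, dmat_one]
  rw [dmat_mul, L.compat] at h
  have h2 : dmat (D i) L.gi * (L.G * L.gi) + L.gi * (L.Γ i).transpose * (L.G * L.gi)
      + (L.gi * L.G) * L.Γ i * L.gi = 0 := by
    calc _ = (dmat (D i) L.gi * L.G
          + L.gi * ((L.Γ i).transpose * L.G + L.G * L.Γ i)) * L.gi := by noncomm_ring
      _ = 0 := by rw [h, zero_mul]
  rw [L.mul_gi, L.gi_mul] at h2
  simp only [mul_one, one_mul] at h2
  rw [← sub_eq_zero, ← h2]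
  noncomm_ring

theorem cd2_G (i : ι) : L.cd2 i L.G = 0 := by
  rw [cd2, L.compat]; noncomm_ring

theorem cd2_smul (i : ι) (a : A) (T : Matrix ι ι A) :
    L.cd2 i (a • T) = D i a • T + a • L.cd2 i T := by
  simp only [cd2, dmat_smul, smul_sub, Matrix.mul_smul, Matrix.smul_mul]
  abel

theorem cd2_add (i : ι) (S T : Matrix ι ι A) : L.cd2 i (S + T) = L.cd2 i S + L.cd2 i T := by
  simp only [cd2, dmat_add]; noncomm_ring

theorem cd2_sub (i : ι) (S T : Matrix ι ι A) : L.cd2 i (S - T) = L.cd2 i S - L.cd2 i T := by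
  simp only [cd2, dmat_sub]; noncomm_ring

/-- Raising an index commutes with the covariant derivative. -/
theorem dmat_gi_mul (i : ι) (T : Matrix ι ι A) :
    dmat (D i) (L.gi * T) + L.Γ i * (L.gi * T) - L.gi * T * L.Γ i = L.gi * L.cd2 i T := by
  rw [dmat_mul, L.dmat_gi, cd2]; noncomm_ring

theorem trace_gi_cd2 (i : ι) (T : Matrix ι ι A) :
    (L.gi * L.cd2 i T).trace = D i (L.gi * T).trace := by
  rw [← L.dmat_gi_mul, Matrix.trace_sub, Matrix.trace_add, trace_dmat,
    Matrix.trace_mul_comm (L.Γ i)]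
  ring

/-- The divergence with the differentiated index already raised. It is the form in which the traced
second Bianchi identity delivers its terms. -/
theorem div_eq (T : Matrix ι ι A) (b : ι) :
    L.div T b = ∑ a, D a ((L.gi * T) a b) + ∑ a, ∑ e, L.Γ a a e * (L.gi * T) e b
      - ∑ a, ∑ e, (L.gi * T) a e * L.Γ a e b := by
  simp only [div, ← L.dmat_gi_mul, Matrix.sub_apply, Matrix.add_apply, dmat_apply,
    Finset.sum_sub_distrib, Finset.sum_add_distrib]
  simp only [Matrix.mul_apply (M := L.Γ _), Matrix.mul_apply (N := L.Γ _)]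

theorem div_add (S T : Matrix ι ι A) (b : ι) : L.div (S + T) b = L.div S b + L.div T b := by
  simp [div, cd2_add, mul_add, Finset.sum_add_distrib]

theorem div_sub (S T : Matrix ι ι A) (b : ι) : L.div (S - T) b = L.div S b - L.div T b := by
  simp [div, cd2_sub, mul_sub, Finset.sum_sub_distrib]

theorem div_smul (a : A) (T : Matrix ι ι A) (b : ι) :
    L.div (a • T) b = ∑ i, D i a * (L.gi * T) i b + a * L.div T b := by
  simp [div, cd2_smul, mul_add, Finset.sum_add_distrib, Finset.mul_sum]

theorem div_smul_G (a : A) (b : ι) : L.div (a • L.G) b = D b a := by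
  rw [div_smul, L.gi_mul]
  simp [div, cd2_G, Matrix.one_apply]

theorem R_antisymm (i j : ι) : L.R j i = -L.R i j := by
  simp only [R]; abel

/-- The derivations commute on the entries of `G`; expanding both orders of differentiation by
metric compatibility leaves only the curvature terms. -/
theorem G_mul_R (i j : ι) : L.G * L.R i j + (L.R i j).transpose * L.G = 0 := by
  have h := dmat_comm (L.comm i j) L.G
  simp only [L.compat, dmat_add, dmat_mul, dmat_transpose] at h
  rw [← sub_eq_zero] at h
  rw [← h]
  simp only [R, Matrix.transpose_sub, Matrix.transpose_add, Matrix.transpose_mul]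
  noncomm_ring

theorem R_mul_gi (i j : ι) : (L.R i j * L.gi).transpose = -(L.R i j * L.gi) := by
  rw [Matrix.transpose_mul, L.gi_symm, eq_neg_iff_add_eq_zero]
  calc L.gi * (L.R i j).transpose + L.R i j * L.gi
      = L.gi * (L.R i j).transpose * (L.G * L.gi) + (L.gi * L.G) * L.R i j * L.gi := by
        rw [L.mul_gi, L.gi_mul, mul_one, one_mul]
    _ = L.gi * (L.G * L.R i j + (L.R i j).transpose * L.G) * L.gi := by noncomm_ring
    _ = 0 := by rw [L.G_mul_R]; simp

theorem R_mul_gi_apply (i j k l : ι) : (L.R i j * L.gi) k l = -(L.R i j * L.gi) l k := by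
  have := congrFun (congrFun (L.R_mul_gi i j) l) k
  simpa using this

theorem trace_R (i j : ι) : (L.R i j).trace = 0 := by
  apply eq_zero_of_add_self
  have h : (L.R i j).trace = (L.gi * (L.G * L.R i j)).trace := by
    rw [← mul_assoc, L.gi_mul, one_mul]
  have h' : (L.R i j).trace = (L.gi * ((L.R i j).transpose * L.G)).trace := by
    rw [Matrix.trace_mul_comm, mul_assoc, L.mul_gi, mul_one, Matrix.trace_transpose]
  nth_rw 1 [h]
  rw [h', ← Matrix.trace_add, ← mul_add, L.G_mul_R]
  simp

/-- The first Bianchi identity. -/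
theorem bianchi_first (i j k l : ι) : L.R i j l k + L.R j k l i + L.R k i l j = 0 := by
  simp only [R, Matrix.sub_apply, Matrix.add_apply, dmat_apply, Matrix.mul_apply]
  simp only [L.torsion k i, L.torsion j i, L.torsion k j]
  ring

/-- The first Bianchi identity is traced. One of its three terms is the trace of a curvature matrix,
which is zero because that matrix is skew for the metric. -/
theorem Ric_symm_apply (j k : ι) : L.Ric j k = L.Ric k j := by
  have h : ∑ a, (L.R a j a k + L.R j k a a + L.R k a a j) = 0 :=
    Finset.sum_eq_zero fun a _ => L.bianchi_first a j k a
  have h2 : ∑ a, L.R j k a a = 0 := L.trace_R j k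
  have h3 : ∀ a, L.R k a a j = -L.R a k a j := fun a => by rw [L.R_antisymm]; rfl
  simp only [Finset.sum_add_distrib, h2, h3, Finset.sum_neg_distrib] at h
  simp only [Ric, Matrix.of_apply]
  linear_combination h

theorem Ric_symm : L.Ric.transpose = L.Ric := by
  ext i j; exact L.Ric_symm_apply j i

/-- The second Bianchi identity. -/
theorem bianchi_second (i j k : ι) :
    (dmat (D k) (L.R i j) + L.Γ k * L.R i j - L.R i j * L.Γ k)
      + (dmat (D i) (L.R j k) + L.Γ i * L.R j k - L.R j k * L.Γ i)
      + (dmat (D j) (L.R k i) + L.Γ j * L.R k i - L.R k i * L.Γ j) = 0 := by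
  simp only [R, dmat_sub, dmat_add, dmat_mul]
  rw [dmat_comm (L.comm k i) (L.Γ j), dmat_comm (L.comm k j) (L.Γ i),
    dmat_comm (L.comm j i) (L.Γ k)]
  noncomm_ring

theorem dmat_mul_gi (k : ι) (X : Matrix ι ι A) :
    dmat (D k) (X * L.gi) + L.Γ k * (X * L.gi) + X * L.gi * (L.Γ k).transpose
      = (dmat (D k) X + L.Γ k * X - X * L.Γ k) * L.gi := by
  rw [dmat_mul, L.dmat_gi]; noncomm_ring

/-- The curvature with both matrix indices raised. -/
def Rup (i j : ι) : Matrix ι ι A := L.R i j * L.gi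

theorem Rup_antisymm (i j : ι) : L.Rup j i = -L.Rup i j := by
  rw [Rup, Rup, L.R_antisymm, neg_mul]

theorem Rup_antisymm' (i j k l : ι) : L.Rup i j k l = -L.Rup i j l k := L.R_mul_gi_apply i j k l

/-- Raising an index commutes with covariant differentiation. In the raised form the matrix indices
are skew, so that the contractions needed below are plain sums without the metric. -/
theorem bianchi_second_up (i j k : ι) :
    (dmat (D k) (L.Rup i j) + L.Γ k * L.Rup i j + L.Rup i j * (L.Γ k).transpose)
      + (dmat (D i) (L.Rup j k) + L.Γ i * L.Rup j k + L.Rup j k * (L.Γ i).transpose)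
      + (dmat (D j) (L.Rup k i) + L.Γ j * L.Rup k i + L.Rup k i * (L.Γ j).transpose) = 0 := by
  simp only [Rup, L.dmat_mul_gi]
  rw [← add_mul, ← add_mul, L.bianchi_second, zero_mul]

/-- The Ricci tensor with an index raised, `Ric_i{}^k`. -/
theorem sum_Rup (i k : ι) : ∑ j, L.Rup j i j k = (L.gi * L.Ric) k i := by
  simp only [Rup, Matrix.mul_apply, Ric, Matrix.of_apply]
  rw [Finset.sum_comm]
  refine Finset.sum_congr rfl fun l _ => ?_
  rw [L.gi_symm_apply l k]
  have : ∑ j, L.R j i j l = L.Ric i l := rfl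
  rw [← Finset.sum_mul, this, L.Ric_symm_apply, mul_comm]
  rfl

theorem sum_Rup' (i k : ι) : ∑ j, L.Rup i j k j = (L.gi * L.Ric) k i := by
  rw [← L.sum_Rup]
  refine Finset.sum_congr rfl fun j _ => ?_
  rw [L.Rup_antisymm', L.Rup_antisymm]; simp

end LeviCivita

end Algebra

end ConfHyp

namespace ConfHyp

/-! ### The contracted Bianchi identity and the divergence of the second fundamental form -/

section Algebra

variable {A : Type*} [CommRing A] [Algebra ℝ A] {ι : Type*} [Fintype ι]

theorem sum_antisymm_mul_symm {X Y : ι → ι → A} (hX : ∀ k l, X k l = -X l k)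
    (hY : ∀ k l, Y k l = Y l k) : ∑ k, ∑ l, X k l * Y k l = 0 := by
  apply eq_zero_of_add_self
  nth_rw 2 [Finset.sum_comm]
  rw [← Finset.sum_add_distrib]
  refine Finset.sum_eq_zero fun k _ => ?_
  rw [← Finset.sum_add_distrib]
  refine Finset.sum_eq_zero fun l _ => ?_
  rw [hX k l, hY k l]; ring

variable [DecidableEq ι]

namespace LeviCivita

variable {D : ι → Derivation ℝ A A} (L : LeviCivita D)

/-- The contracted second Bianchi identity. -/
theorem two_mul_div_Ric (i : ι) : 2 * L.div L.Ric i = D i L.Sc := by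
  have h : ∑ k, ∑ j, ((dmat (D k) (L.Rup i j) + L.Γ k * L.Rup i j
        + L.Rup i j * (L.Γ k).transpose)
      + (dmat (D i) (L.Rup j k) + L.Γ i * L.Rup j k + L.Rup j k * (L.Γ i).transpose)
      + (dmat (D j) (L.Rup k i) + L.Γ j * L.Rup k i + L.Rup k i * (L.Γ j).transpose)) k j = 0 :=
    Finset.sum_eq_zero fun k _ => Finset.sum_eq_zero fun j _ => by
      rw [L.bianchi_second_up]; rfl
  simp only [Matrix.add_apply, Finset.sum_add_distrib, dmat_apply, Matrix.mul_apply (M := L.Γ _),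
    Matrix.mul_apply (N := (L.Γ _).transpose), Matrix.transpose_apply] at h
  -- The contraction splits into nine sums. The outer two groups each contribute the derivative and
  -- the `Γ^k_{kl}` part of `div Ric`, the middle one contributes the derivative of `-Sc` and twice
  -- the remaining connection term. The sums `e3` and `e8` vanish because the torsion-free symbols
  -- are symmetric where the curvature is skew.
  set Q := L.gi * L.Ric with hQ
  have e1 : ∑ k, ∑ j, D k (L.Rup i j k j) = ∑ k, D k (Q k i) := by
    simp only [← map_sum, L.sum_Rup', hQ]
  have e2 : ∑ k, ∑ j, ∑ l, L.Γ k k l * L.Rup i j l j = ∑ k, ∑ l, L.Γ k k l * Q l i := by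
    refine Finset.sum_congr rfl fun k _ => ?_
    rw [Finset.sum_comm]
    simp only [← Finset.mul_sum, L.sum_Rup', hQ]
  have e3 : ∑ k, ∑ j, ∑ l, L.Rup i j k l * L.Γ k j l = 0 := by
    rw [Finset.sum_comm]
    refine Finset.sum_eq_zero fun j _ => ?_
    exact sum_antisymm_mul_symm (fun k l => L.Rup_antisymm' i j k l) fun k l => L.torsion k l j
  have e4 : ∑ k, ∑ j, D i (L.Rup j k k j) = -D i L.Sc := by
    have : ∀ k j, L.Rup j k k j = -L.Rup j k j k := fun k j => L.Rup_antisymm' j k k j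
    simp only [this, map_neg, Finset.sum_neg_distrib]
    simp only [← map_sum, L.sum_Rup]
    rfl
  have e5 : ∑ k, ∑ j, ∑ l, L.Γ i k l * L.Rup j k l j = -∑ k, ∑ l, L.Γ i k l * Q l k := by
    rw [← Finset.sum_neg_distrib]
    refine Finset.sum_congr rfl fun k _ => ?_
    rw [Finset.sum_comm, ← Finset.sum_neg_distrib]
    refine Finset.sum_congr rfl fun l _ => ?_
    rw [hQ, ← L.sum_Rup, Finset.mul_sum, ← Finset.sum_neg_distrib]
    refine Finset.sum_congr rfl fun j _ => ?_
    rw [L.Rup_antisymm']; ring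
  have e6 : ∑ k, ∑ j, ∑ l, L.Rup j k k l * L.Γ i j l = -∑ k, ∑ l, L.Γ i k l * Q l k := by
    rw [Finset.sum_comm, ← Finset.sum_neg_distrib]
    refine Finset.sum_congr rfl fun j _ => ?_
    rw [Finset.sum_comm, ← Finset.sum_neg_distrib]
    refine Finset.sum_congr rfl fun l _ => ?_
    rw [hQ, ← L.sum_Rup, Finset.mul_sum, ← Finset.sum_neg_distrib]
    refine Finset.sum_congr rfl fun k _ => ?_
    rw [L.Rup_antisymm]; simp [mul_comm]
  have e7 : ∑ k, ∑ j, D j (L.Rup k i k j) = ∑ k, D k (Q k i) := by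
    rw [Finset.sum_comm]
    simp only [← map_sum, L.sum_Rup, hQ]
  have e8 : ∑ k, ∑ j, ∑ l, L.Γ j k l * L.Rup k i l j = 0 := by
    refine Finset.sum_eq_zero fun k _ => ?_
    have := sum_antisymm_mul_symm (fun l j => L.Rup_antisymm' k i l j) fun l j => L.torsion l j k
    rw [Finset.sum_comm, ← this]
    refine Finset.sum_congr rfl fun l _ => Finset.sum_congr rfl fun j _ => ?_
    rw [mul_comm, L.torsion]
  have e9 : ∑ k, ∑ j, ∑ l, L.Rup k i k l * L.Γ j j l = ∑ k, ∑ l, L.Γ k k l * Q l i := by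
    rw [Finset.sum_comm]
    refine Finset.sum_congr rfl fun j _ => ?_
    rw [Finset.sum_comm]
    refine Finset.sum_congr rfl fun l _ => ?_
    rw [← Finset.sum_mul, L.sum_Rup, mul_comm]
  rw [e1, e2, e3, e4, e5, e6, e7, e8, e9] at h
  have e10 : ∑ a, ∑ e, Q a e * L.Γ a e i = ∑ k, ∑ l, L.Γ i k l * Q l k := by
    rw [Finset.sum_comm]
    refine Finset.sum_congr rfl fun k _ => Finset.sum_congr rfl fun l _ => ?_
    rw [mul_comm, L.torsion]
  rw [L.div_eq, ← hQ, e10]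
  linear_combination h

theorem cd1_row (v : ι → A) (j k : ι) :
    L.cd1 v j k = (dmat (D j) (Matrix.of fun _ : Unit => v)
      - (Matrix.of fun _ : Unit => v) * L.Γ j) () k := by
  simp [cd1, Matrix.mul_apply, mul_comm]

/-- The Ricci identity on one-forms. -/
theorem cd2_cd1_comm (v : ι → A) (i j k : ι) :
    L.cd2 i (L.cd1 v) j k - L.cd2 j (L.cd1 v) i k = -∑ l, v l * L.R i j l k := by
  -- Viewed as a row matrix, the one-form is acted on by right multiplication with the connection
  -- matrices, and the commutator of two such derivatives is right multiplication by the curvature.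
  -- The correction for the first index of `cd1 v` is symmetric in the two derivatives by
  -- torsion-freeness and cancels.
  let w : Matrix Unit ι A := Matrix.of fun _ => v
  have h : (dmat (D i) (dmat (D j) w - w * L.Γ j) - (dmat (D j) w - w * L.Γ j) * L.Γ i)
      - (dmat (D j) (dmat (D i) w - w * L.Γ i) - (dmat (D i) w - w * L.Γ i) * L.Γ j)
      = -(w * L.R i j) := by
    simp only [R, dmat_sub, dmat_mul, Matrix.sub_mul, Matrix.mul_sub, Matrix.mul_add,
      Matrix.mul_assoc]
    rw [dmat_comm (L.comm i j) w]
    abel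
  have h2 := congrFun (congrFun h ()) k
  simp only [Matrix.sub_apply (m := Unit), Matrix.neg_apply, Matrix.mul_apply (M := w)] at h2
  have e : ∀ i j, L.cd2 i (L.cd1 v) j k
      = D i ((dmat (D j) w - w * L.Γ j) () k) - ((dmat (D j) w - w * L.Γ j) * L.Γ i) () k
        - ∑ e, L.Γ i e j * L.cd1 v e k := by
    intro i j
    simp only [cd2, Matrix.sub_apply, dmat_apply, cd1_row, Matrix.mul_apply,
      Matrix.transpose_apply, w]
    ring
  rw [e i j, e j i]
  simp only [L.torsion i j]
  rw [show ∑ l, v l * L.R i j l k = ∑ l, w () l * L.R i j l k from rfl, ← h2]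
  simp only [dmat_apply, Matrix.sub_apply, map_sub, Matrix.mul_apply (M := w)]
  ring

theorem cd1_symm {v : ι → A} (hv : ∀ i j, D i (v j) = D j (v i)) (i j : ι) :
    L.cd1 v i j = L.cd1 v j i := by
  simp only [cd1, Matrix.of_apply, hv i j, L.torsion i j]

theorem cd2_symm {T : Matrix ι ι A} (hT : T.transpose = T) (i : ι) :
    (L.cd2 i T).transpose = L.cd2 i T := by
  simp only [cd2, Matrix.transpose_sub, Matrix.transpose_mul, ← dmat_transpose, hT,
    Matrix.transpose_transpose]
  abel

/-- The divergence of the Hessian. -/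
theorem div_hessian {v : ι → A} (hv : ∀ i j, D i (v j) = D j (v i)) (b : ι) :
    L.div (L.cd1 v) b = D b (L.gi * L.cd1 v).trace + ∑ l, v l * (L.gi * L.Ric) l b := by
  have hs : (L.cd1 v).transpose = L.cd1 v := by ext i j; exact L.cd1_symm hv j i
  -- The Hessian is symmetric, so the Ricci identity may move the free index `b` into the outermost
  -- derivative. Tracing `a` with `c` then gives the derivative of the Laplacian and one Ricci
  -- contraction.
  have e : ∀ a c, L.cd2 a (L.cd1 v) c b = L.cd2 b (L.cd1 v) c a - ∑ l, v l * L.R a b l c := by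
    intro a c
    have h1 := congrFun (congrFun (L.cd2_symm hs a) c) b
    have h2 := congrFun (congrFun (L.cd2_symm hs b) c) a
    simp only [Matrix.transpose_apply] at h1 h2
    rw [← h1, ← h2]
    linear_combination L.cd2_cd1_comm v a b c
  simp only [div, Matrix.mul_apply, e, mul_sub, Finset.sum_sub_distrib]
  rw [← L.trace_gi_cd2, sub_eq_add_neg]
  congr 1
  simp only [Finset.mul_sum]
  have : ∀ a, ∑ c, ∑ l, L.gi a c * (v l * L.R a b l c) = ∑ l, v l * L.Rup a b l a := by
    intro a
    rw [Finset.sum_comm]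
    refine Finset.sum_congr rfl fun l _ => ?_
    simp only [Rup, Matrix.mul_apply, Finset.mul_sum]
    refine Finset.sum_congr rfl fun c _ => ?_
    rw [L.gi_symm_apply]; ring
  simp only [this]
  rw [Finset.sum_comm, ← Finset.sum_neg_distrib]
  refine Finset.sum_congr rfl fun l _ => ?_
  have h2 := L.sum_Rup b l
  rw [Matrix.mul_apply] at h2
  rw [← Finset.mul_sum, ← Finset.mul_sum, ← h2, ← mul_neg, ← Finset.sum_neg_distrib]
  congr 1
  refine Finset.sum_congr rfl fun a _ => ?_
  rw [L.Rup_antisymm']; simp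

/-- The data of a scale: the Schouten tensor, its trace and the scale tractor of `s`. -/
structure IsScale (d : ℝ) (s J ρ : A) (P E : Matrix ι ι A) : Prop where
  card : d = Fintype.card ι
  ne_two : d - 2 ≠ 0
  schouten : (d - 2) • P = L.Ric - J • L.G
  trace : (2 * (d - 1)) • J = L.Sc
  rho : d • ρ = -((L.gi * L.cd1 fun i => D i s).trace + J * s)
  E_eq : E = (L.cd1 fun i => D i s) + s • P + ρ • L.G

/-- The one-form `∇_a ρ - P_{ab} n^b`. -/
def slotP (s ρ : A) (P : Matrix ι ι A) (b : ι) : A :=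
  D b ρ - ∑ a, D a s * (L.gi * P) a b

variable {L} {d : ℝ} {s J ρ : A} {P E : Matrix ι ι A}

theorem smul_cancel {V : Type*} [AddCommGroup V] [Module ℝ V] {c : ℝ} (hc : c ≠ 0) {x y : V}
    (h : c • x = c • y) : x = y := smul_right_injective V hc h

theorem IsScale.P_symm (h : L.IsScale d s J ρ P E) : P.transpose = P := by
  apply smul_cancel h.ne_two
  rw [← Matrix.transpose_smul, h.schouten, Matrix.transpose_sub, L.Ric_symm,
    Matrix.transpose_smul, L.symm]

theorem IsScale.E_symm (h : L.IsScale d s J ρ P E) : E.transpose = E := by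
  have hs : (L.cd1 fun i => D i s).transpose = L.cd1 fun i => D i s := by
    ext i j; exact L.cd1_symm (fun i j => L.comm i j s) j i
  rw [h.E_eq, Matrix.transpose_add, Matrix.transpose_add, hs, Matrix.transpose_smul, h.P_symm,
    Matrix.transpose_smul, L.symm]

theorem trace_gi_G : (L.gi * L.G).trace = (Fintype.card ι : A) := by
  rw [L.gi_mul, Matrix.trace_one]

theorem smul_eq_algebraMap_mul (c : ℝ) (a : A) : c • a = algebraMap ℝ A c * a :=
  Algebra.smul_def c a

theorem IsScale.trace_P (h : L.IsScale d s J ρ P E) : (L.gi * P).trace = J := by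
  apply smul_cancel h.ne_two
  rw [← Matrix.trace_smul, ← Matrix.mul_smul, h.schouten, Matrix.mul_sub, Matrix.mul_smul,
    Matrix.trace_sub, Matrix.trace_smul, trace_gi_G]
  have h1 : (L.gi * L.Ric).trace = L.Sc := rfl
  rw [h1, ← h.trace]
  have h2 : ((Fintype.card ι : ℕ) : A) = algebraMap ℝ A d := by rw [h.card]; simp
  rw [h2]
  simp only [smul_eq_algebraMap_mul, map_mul, map_sub, map_ofNat, map_one, smul_eq_mul]
  ring

/-- The traces of the Hessian and of `s P` are `Δs` and `J s`; the function `ρ` is defined to cancel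
their sum. -/
theorem IsScale.trace_E (h : L.IsScale d s J ρ P E) : (L.gi * E).trace = 0 := by
  rw [h.E_eq, Matrix.mul_add, Matrix.mul_add, Matrix.trace_add, Matrix.trace_add,
    Matrix.mul_smul, Matrix.mul_smul, Matrix.trace_smul, Matrix.trace_smul, h.trace_P, trace_gi_G]
  have h1 := h.rho
  have h2 : ((Fintype.card ι : ℕ) : A) = algebraMap ℝ A d := by rw [h.card]; simp
  rw [h2]
  rw [smul_eq_algebraMap_mul] at h1
  simp only [smul_eq_mul]
  linear_combination h1

/-- This is the contracted Bianchi identity: `2 div Ric = dSc = 2(d-1) dJ`, and subtracting the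
divergence `dJ` of `J G` leaves `(d-2) dJ`. -/
theorem IsScale.div_P (h : L.IsScale d s J ρ P E) (b : ι) : L.div P b = D b J := by
  apply smul_cancel h.ne_two
  have h1 : ∀ c : ℝ, c • L.div P b = L.div (c • P) b := by
    intro c
    have := L.div_smul (algebraMap ℝ A c) P b
    simp only [Derivation.map_algebraMap, zero_mul, Finset.sum_const_zero, zero_add] at this
    rw [smul_eq_algebraMap_mul, ← this]
    congr 1
    ext i j; simp [Algebra.smul_def]
  rw [h1, h.schouten, L.div_sub, L.div_smul_G]
  have h2 := L.two_mul_div_Ric b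
  rw [← h.trace, Derivation.map_smul] at h2
  apply smul_cancel (two_ne_zero (α := ℝ))
  simp only [smul_eq_algebraMap_mul, map_mul, map_sub, map_ofNat, map_one] at h2 ⊢
  linear_combination h2

/-- The divergence of the canonical extension of the second fundamental form. -/
theorem IsScale.div_E (h : L.IsScale d s J ρ P E) (b : ι) :
    (d - 1) • L.slotP s ρ P b = -L.div E b := by
  have h1 : L.div E b = L.div (L.cd1 fun i => D i s) b
      + (∑ i, D i s * (L.gi * P) i b + s * D b J) + D b ρ := by
    rw [h.E_eq, L.div_add, L.div_add, L.div_smul_G, L.div_smul, h.div_P]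
  rw [h1, L.div_hessian (fun i j => L.comm i j s)]
  -- The Laplacian is eliminated in favour of `ρ` and the Ricci tensor in favour of `P`. All terms
  -- with `J` or its derivative cancel, leaving `(d-1)` times `P n - dρ` for the divergence of `E`.
  have h2 : (L.gi * L.cd1 fun i => D i s).trace = -(d • ρ) - J * s := by
    rw [h.rho]; ring
  have h3 : L.gi * L.Ric = (d - 2) • (L.gi * P) + J • 1 := by
    rw [← Matrix.mul_smul, h.schouten, Matrix.mul_sub, Matrix.mul_smul, L.gi_mul]
    abel
  have h4 : ∑ l, D l s * (L.gi * L.Ric) l b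
      = (d - 2) • ∑ i, D i s * (L.gi * P) i b + J * D b s := by
    rw [h3]
    simp only [Matrix.add_apply, Matrix.smul_apply, mul_add, Finset.sum_add_distrib,
      Finset.smul_sum, mul_smul_comm, Matrix.one_apply, smul_eq_mul, mul_ite, mul_one, mul_zero,
      Finset.sum_ite_eq', Finset.mem_univ, if_true]
    ring
  rw [h2, h4, slotP]
  simp only [map_sub, map_neg, Derivation.map_smul, Derivation.leibniz, smul_eq_mul]
  simp only [smul_eq_algebraMap_mul, map_sub, map_one, map_ofNat]
  ring

/-- The derivative of the squared length of the scale tractor. -/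
theorem IsScale.deriv_sq (h : L.IsScale d s J ρ P E) (a : ι) :
    D a (∑ b, D b s * ∑ c, L.gi b c * D c s + 2 * s * ρ)
      = 2 * ∑ b, E a b * ∑ c, L.gi b c * D c s + 2 * s * L.slotP s ρ P a := by
  let w : Matrix Unit ι A := Matrix.of fun _ j => D j s
  have e1 : ∑ b, D b s * ∑ c, L.gi b c * D c s = (w * L.gi * w.transpose) () () := by
    rw [Matrix.mul_assoc]
    simp [Matrix.mul_apply, w]
  have e2 : D a ((w * L.gi * w.transpose) () ()) =
      2 * ∑ b, L.cd1 (fun i => D i s) a b * ∑ c, L.gi b c * D c s := by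
    have h3 : dmat (D a) (w * L.gi * w.transpose)
        = (dmat (D a) w - w * L.Γ a) * L.gi * w.transpose
          + ((dmat (D a) w - w * L.Γ a) * L.gi * w.transpose).transpose := by
      simp only [dmat_mul, L.dmat_gi, dmat_transpose, Matrix.transpose_mul, L.gi_symm,
        Matrix.transpose_sub, Matrix.sub_mul, Matrix.mul_add, Matrix.add_mul,
        Matrix.mul_neg, Matrix.neg_mul, Matrix.transpose_transpose, Matrix.mul_assoc]
      abel
    have h4 := congrFun (congrFun h3 ()) ()
    simp only [dmat_apply, Matrix.add_apply, Matrix.transpose_apply] at h4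
    rw [h4, ← two_mul]
    congr 1
    rw [Matrix.mul_assoc, Matrix.mul_apply]
    refine Finset.sum_congr rfl fun b _ => ?_
    rw [L.cd1_row]
    simp [Matrix.mul_apply, w]
  -- When the Hessian is replaced by `E`, the term `ρ ds` cancels against the one from the
  -- derivative of `2sρ`. What is left over is `2s(dρ - P n)`.
  have e3 : ∑ b, E a b * ∑ c, L.gi b c * D c s
      = ∑ b, L.cd1 (fun i => D i s) a b * ∑ c, L.gi b c * D c s
        + s * ∑ i, D i s * (L.gi * P) i a + ρ * D a s := by
    have h5 : ∑ b, P a b * ∑ c, L.gi b c * D c s = ∑ i, D i s * (L.gi * P) i a := by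
      simp only [Finset.mul_sum, Matrix.mul_apply]
      rw [Finset.sum_comm]
      refine Finset.sum_congr rfl fun c _ => Finset.sum_congr rfl fun b _ => ?_
      rw [L.gi_symm_apply, ← congrFun (congrFun h.P_symm a) b, Matrix.transpose_apply]; ring
    have h6 : ∑ b, L.G a b * ∑ c, L.gi b c * D c s = D a s := by
      have : ∀ c, ∑ b, L.G a b * L.gi b c = (1 : Matrix ι ι A) a c := by
        intro c; rw [← L.mul_gi, Matrix.mul_apply]
      simp only [Finset.mul_sum]
      rw [Finset.sum_comm]
      simp only [← mul_assoc, ← Finset.sum_mul, this, Matrix.one_apply, ite_mul, one_mul, zero_mul,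
        Finset.sum_ite_eq, Finset.mem_univ, if_true]
    rw [← h5]
    rw [show ρ * D a s = ρ * ∑ b, L.G a b * ∑ c, L.gi b c * D c s by rw [h6]]
    rw [h.E_eq]
    simp only [Matrix.add_apply, Matrix.smul_apply, smul_eq_mul, add_mul, Finset.sum_add_distrib]
    rw [Finset.mul_sum, Finset.mul_sum]
    simp only [mul_assoc]
  rw [map_add, e1, e2, e3, slotP]
  simp only [Derivation.leibniz, smul_eq_mul]
  have h2 : D a (2 : A) = 0 := by exact_mod_cast (D a).map_natCast 2
  rw [h2]
  ring

end LeviCivita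

end Algebra

end ConfHyp

namespace ConfHyp

/-! ### The divergence of a tensor contracted with a gradient -/

section Algebra

variable {A : Type*} [CommRing A] [Algebra ℝ A] {ι : Type*} [Fintype ι] [DecidableEq ι]

namespace LeviCivita

variable {D : ι → Derivation ℝ A A} (L : LeviCivita D)

/-- The divergence of the contraction of a tensor with the gradient. -/
theorem div1_contract (s : A) (E : Matrix ι ι A) :
    L.div1 (fun a => ∑ b, E a b * ∑ c, L.gi b c * D c s)
      = ∑ b, (∑ c, L.gi b c * D c s) * L.div E b
        + (L.gi * (L.cd1 fun i => D i s) * L.gi * E.transpose).trace := by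
  let w : Matrix ι Unit A := Matrix.of fun j _ => D j s
  have hw : ∀ i b, (dmat (D i) (L.gi * w) + L.Γ i * (L.gi * w)) b ()
      = ∑ c, L.gi b c * L.cd1 (fun i => D i s) i c := by
    intro i b
    have h1 : dmat (D i) (L.gi * w) + L.Γ i * (L.gi * w)
        = L.gi * (dmat (D i) w - (L.Γ i).transpose * w) := by
      simp only [dmat_mul, L.dmat_gi, Matrix.mul_sub, Matrix.add_mul,
        Matrix.neg_mul, Matrix.mul_assoc]
      abel
    rw [h1, Matrix.mul_apply]
    refine Finset.sum_congr rfl fun c _ => ?_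
    simp [cd1, Matrix.mul_apply, w]
  have hY : ∀ i a, L.cd1 (fun a => ∑ b, E a b * ∑ c, L.gi b c * D c s) i a
      = ∑ b, L.cd2 i E a b * (∑ c, L.gi b c * D c s)
        + ∑ b, E a b * ∑ c, L.gi b c * L.cd1 (fun i => D i s) i c := by
    intro i a
    have h1 : dmat (D i) (E * (L.gi * w)) - (L.Γ i).transpose * (E * (L.gi * w))
        = L.cd2 i E * (L.gi * w) + E * (dmat (D i) (L.gi * w) + L.Γ i * (L.gi * w)) := by
      rw [dmat_mul, cd2]
      simp only [Matrix.mul_add, Matrix.sub_mul, Matrix.mul_assoc]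
      abel
    have h2 := congrFun (congrFun h1 a) ()
    rw [Matrix.add_apply, Matrix.mul_apply (N := dmat (D i) (L.gi * w) + L.Γ i * (L.gi * w))] at h2
    simp only [hw] at h2
    rw [Matrix.mul_apply (M := L.cd2 i E)] at h2
    simp only [Matrix.sub_apply, dmat_apply, Matrix.mul_apply, Matrix.transpose_apply, w,
      Matrix.of_apply] at h2
    rw [← h2]
    rfl
  simp only [div1, Matrix.trace, Matrix.diag_apply, Matrix.mul_apply (M := L.gi), hY, mul_add,
    Finset.sum_add_distrib]
  congr 1
  · simp only [div, Matrix.mul_apply, Finset.mul_sum]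
    rw [Finset.sum_comm]
    conv_rhs => rw [Finset.sum_comm]
    refine Finset.sum_congr rfl fun i _ => ?_
    rw [Finset.sum_comm]
    refine Finset.sum_congr rfl fun b _ => ?_
    refine Finset.sum_congr rfl fun a _ => ?_
    simp only [Finset.sum_mul]
    refine Finset.sum_congr rfl fun c _ => ?_
    rw [L.gi_symm_apply a i]; ring
  · simp only [Matrix.mul_apply, Matrix.transpose_apply, Finset.mul_sum, Finset.sum_mul]
    refine Finset.sum_congr rfl fun a _ => ?_
    rw [Finset.sum_comm]
    refine Finset.sum_congr rfl fun b _ => ?_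
    rw [Finset.sum_comm]
    refine Finset.sum_congr rfl fun c _ => Finset.sum_congr rfl fun i _ => ?_
    rw [L.gi_symm_apply b c]; ring

/-! ### Conformal change -/

variable (s r : A)

/-- The change of the connection matrices for the metric `r² G` with `r s = 1`. -/
def confDiff (i : ι) : Matrix ι ι A := Matrix.of fun k j =>
  -(r * D i s) * (if k = j then 1 else 0) - (if k = i then 1 else 0) * (r * D j s)
    + (∑ l, L.gi k l * (r * D l s)) * L.G i j

theorem deriv_inv {s r : A} (hr : r * s = 1) (δ : Derivation ℝ A A) : δ r = -(r * r * δ s) := by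
  have h : δ (r * s) = 0 := by rw [hr]; simp
  simp only [Derivation.leibniz, smul_eq_mul] at h
  linear_combination r * h - δ r * hr

theorem G_mul_gi_mul (k : ι) (v : ι → A) : ∑ m, L.G k m * ∑ l, L.gi m l * v l = v k := by
  simp only [Finset.mul_sum]
  rw [Finset.sum_comm]
  have : ∀ l, ∑ m, L.G k m * L.gi m l = (1 : Matrix ι ι A) k l := by
    intro l; rw [← L.mul_gi, Matrix.mul_apply]
  simp only [← mul_assoc, ← Finset.sum_mul, this, Matrix.one_apply, ite_mul, one_mul, zero_mul,
    Finset.sum_ite_eq, Finset.mem_univ, if_true]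

/-- After lowering the upper index, the last two terms are skew in `k` and `j`. The symmetrization
is therefore `-2 r (∂_i s) G`, which is what compatibility with `r² G` asks for. -/
theorem G_mul_confDiff (i k j : ι) : (L.G * L.confDiff s r i) k j
    = -(r * D i s) * L.G k j - L.G k i * (r * D j s) + (r * D k s) * L.G i j := by
  simp only [Matrix.mul_apply, confDiff, Matrix.of_apply, mul_add, mul_sub, Finset.sum_add_distrib,
    Finset.sum_sub_distrib]
  rw [← L.G_mul_gi_mul k fun l => r * D l s]
  congr 1
  · congr 1
    · simp [mul_comm]
    · simp
  · rw [Finset.sum_mul]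
    exact Finset.sum_congr rfl fun m _ => by ring

/-- The Levi-Civita connection of the metric `r² G`, `r s = 1`. -/
def conformal (hr : r * s = 1) : LeviCivita D where
  G := (r * r) • L.G
  gi := (s * s) • L.gi
  Γ i := L.Γ i + L.confDiff s r i
  comm := L.comm
  symm := by rw [Matrix.transpose_smul, L.symm]
  gi_mul := by
    rw [Matrix.smul_mul, Matrix.mul_smul, L.gi_mul, smul_smul,
      show s * s * (r * r) = (r * s) * (r * s) by ring, hr]
    simp
  compat i := by
    have h : (L.confDiff s r i).transpose * L.G + L.G * L.confDiff s r i
        = (-2 * r * D i s) • L.G := by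
      have h1 : (L.confDiff s r i).transpose * L.G = (L.G * L.confDiff s r i).transpose := by
        rw [Matrix.transpose_mul, L.symm]
      rw [h1]
      ext k j
      simp only [Matrix.add_apply, Matrix.transpose_apply, G_mul_confDiff, Matrix.smul_apply,
        smul_eq_mul, L.G_symm_apply j k, L.G_symm_apply k i, L.G_symm_apply j i]
      ring
    have h2 : D i (r * r) = r * r * (-2 * r * D i s) := by
      simp only [Derivation.leibniz, smul_eq_mul, deriv_inv hr]; ring
    rw [dmat_smul, L.compat, h2, mul_smul, ← h]
    simp only [Matrix.transpose_add, smul_add, add_mul, mul_add, Matrix.smul_mul,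
      Matrix.mul_smul]
    abel
  torsion i j k := by
    simp only [Matrix.add_apply, L.torsion i j k, confDiff, Matrix.of_apply, L.G_symm_apply i j]
    ring

theorem R_add (C : ι → Matrix ι ι A) (L' : LeviCivita D) (h : ∀ i, L'.Γ i = L.Γ i + C i)
    (i j : ι) : L'.R i j = L.R i j
      + ((dmat (D i) (C j) + L.Γ i * C j - C j * L.Γ i)
        - (dmat (D j) (C i) + L.Γ j * C i - C i * L.Γ j))
      + (C i * C j - C j * C i) := by
  simp only [R, h, dmat_add]; noncomm_ring

/-- The expression is covariant in the matrix indices `l`, `k` only; the form index `j` is left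
uncorrected. The resulting terms with `Γ^m_{ij}` are symmetric in `i` and `j`, so they disappear
from the antisymmetrized curvature formula `R_add`. -/
theorem confDiff_deriv (i j l k : ι) :
    (dmat (D i) (L.confDiff s r j) + L.Γ i * L.confDiff s r j
        - L.confDiff s r j * L.Γ i) l k
      = -D i (r * D j s) * (if l = k then 1 else 0)
        - (if l = j then 1 else 0) * L.cd1 (fun k => r * D k s) i k
        + (∑ m, L.gi l m * L.cd1 (fun k => r * D k s) i m) * L.G j k
        + (∑ m, L.gi l m * (r * D m s)) * (∑ m, L.Γ i m j * L.G m k)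
        - L.Γ i l j * (r * D k s) := by
  have hU : D i (∑ m, L.gi l m * (r * D m s)) = ∑ m, L.gi l m * L.cd1 (fun k => r * D k s) i m
      - ∑ e, L.Γ i l e * ∑ m, L.gi e m * (r * D m s) := by
    let w : Matrix ι Unit A := Matrix.of fun j _ => r * D j s
    have h1 : dmat (D i) (L.gi * w)
        = L.gi * (dmat (D i) w - (L.Γ i).transpose * w) - L.Γ i * (L.gi * w) := by
      simp only [dmat_mul, L.dmat_gi, Matrix.mul_sub, Matrix.add_mul,
        Matrix.neg_mul, Matrix.mul_assoc]
      abel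
    have h2 := congrFun (congrFun h1 l) ()
    rw [Matrix.sub_apply, Matrix.mul_apply, Matrix.mul_apply (M := L.Γ i)] at h2
    simp only [dmat_apply, Matrix.mul_apply, w, Matrix.of_apply, Matrix.sub_apply,
      Matrix.transpose_apply] at h2
    rw [h2]
    rfl
  have hG : D i (L.G j k) = ∑ m, L.Γ i m j * L.G m k + ∑ m, L.G j m * L.Γ i m k := by
    have := congrFun (congrFun (L.compat i) j) k
    simpa [Matrix.mul_apply] using this
  have e1 : D i (L.confDiff s r j l k) = -D i (r * D j s) * (if l = k then 1 else 0)
      - (if l = j then 1 else 0) * D i (r * D k s)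
      + (D i (∑ m, L.gi l m * (r * D m s)) * L.G j k
        + (∑ m, L.gi l m * (r * D m s)) * D i (L.G j k)) := by
    have hite : ∀ p : Prop, ∀ [Decidable p], D i (if p then (1 : A) else 0) = 0 := by
      intro p _; split_ifs <;> simp
    simp only [confDiff, Matrix.of_apply, map_add, map_sub, map_neg,
      Derivation.leibniz _ (-(r * D j s)), Derivation.leibniz _ (if l = j then (1 : A) else 0),
      Derivation.leibniz _ (∑ m, L.gi l m * (r * D m s)), hite, smul_eq_mul]
    ring
  have e2 : (L.Γ i * L.confDiff s r j) l k = -(r * D j s) * L.Γ i l k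
      - L.Γ i l j * (r * D k s)
      + (∑ e, L.Γ i l e * ∑ m, L.gi e m * (r * D m s)) * L.G j k := by
    simp only [Matrix.mul_apply, confDiff, Matrix.of_apply, mul_add, mul_sub,
      Finset.sum_add_distrib, Finset.sum_sub_distrib]
    congr 1
    · congr 1
      · simp [mul_comm]
      · simp
    · rw [Finset.sum_mul]
      exact Finset.sum_congr rfl fun m _ => by ring
  have e3 : (L.confDiff s r j * L.Γ i) l k = -(r * D j s) * L.Γ i l k
      - (if l = j then 1 else 0) * ∑ m, L.Γ i m k * (r * D m s)
      + (∑ m, L.gi l m * (r * D m s)) * ∑ m, L.G j m * L.Γ i m k := by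
    simp only [Matrix.mul_apply, confDiff, Matrix.of_apply, add_mul, sub_mul,
      Finset.sum_add_distrib, Finset.sum_sub_distrib]
    congr 1
    · congr 1
      · simp
      · rw [Finset.mul_sum]
        exact Finset.sum_congr rfl fun m _ => by ring
    · rw [Finset.mul_sum]
      exact Finset.sum_congr rfl fun m _ => by ring
  have e4 : L.cd1 (fun k => r * D k s) i k = D i (r * D k s) - ∑ m, L.Γ i m k * (r * D m s) := rfl
  simp only [Matrix.sub_apply, Matrix.add_apply, dmat_apply]
  rw [e1, e2, e3, hU, hG, e4]
  ring

theorem confDiff_mul (i j l k : ι) :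
    (L.confDiff s r i * L.confDiff s r j) l k
      = (r * D i s) * (r * D j s) * (if l = k then 1 else 0)
        + (if l = j then 1 else 0) * ((r * D i s) * (r * D k s))
        + (if l = i then 1 else 0) * (2 * (r * D j s) * (r * D k s)
          - (∑ m, (r * D m s) * ∑ e, L.gi m e * (r * D e s)) * L.G j k)
        - (r * D j s) * (∑ m, L.gi l m * (r * D m s)) * L.G i k
        - (∑ m, L.gi l m * (r * D m s)) * L.G i j * (r * D k s) := by
  set u : ι → A := fun j => r * D j s with hu
  set U : ι → A := fun l => ∑ m, L.gi l m * (r * D m s) with hU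
  have hGU : ∑ m, L.G i m * U m = u i := L.G_mul_gi_mul i u
  have hC : ∀ i l k, L.confDiff s r i l k = -u i * (if l = k then 1 else 0)
      - (if l = i then 1 else 0) * u k + U l * L.G i k := fun _ _ _ => rfl
  have e1 : ∑ m, L.confDiff s r i l m * L.confDiff s r j m k
      = -u j * L.confDiff s r i l k - L.confDiff s r i l j * u k
        + (∑ m, L.confDiff s r i l m * U m) * L.G j k := by
    simp only [hC j, mul_add, mul_sub, Finset.sum_add_distrib, Finset.sum_sub_distrib]
    congr 1
    · congr 1
      · simp [mul_comm]
      · simp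
    · rw [Finset.sum_mul]
      exact Finset.sum_congr rfl fun m _ => by ring
  have e2 : ∑ m, L.confDiff s r i l m * U m
      = -u i * U l - (if l = i then 1 else 0) * (∑ m, u m * U m) + U l * u i := by
    simp only [hC i, add_mul, sub_mul, Finset.sum_add_distrib, Finset.sum_sub_distrib]
    congr 1
    · congr 1
      · simp
      · rw [Finset.mul_sum]
        exact Finset.sum_congr rfl fun m _ => by ring
    · rw [← hGU, Finset.mul_sum]
      exact Finset.sum_congr rfl fun m _ => by ring
  rw [Matrix.mul_apply, e1, e2]
  simp only [hC]
  change _ = u i * u j * (if l = k then 1 else 0)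
        + (if l = j then 1 else 0) * (u i * u k)
        + (if l = i then 1 else 0) * (2 * u j * u k - (∑ m, u m * U m) * L.G j k)
        - u j * U l * L.G i k - U l * L.G i j * u k
  ring

/-- The Ricci tensor of `s⁻² G`, up to a multiple of the metric. -/
theorem conformal_Ric (hr : r * s = 1) : ∃ f : A,
    (L.conformal s r hr).Ric = L.Ric
      + ((Fintype.card ι : A) - 2) • r • (L.cd1 fun i => D i s) + f • L.G := by
  set u : ι → A := fun j => r * D j s with hu
  set U : ι → A := fun l => ∑ m, L.gi l m * u m with hU
  set H := L.cd1 u with hH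
  set W : ι → ι → A := fun i l => ∑ m, L.gi l m * H i m with hW
  set N : A := ∑ m, u m * U m with hN
  have hHs : ∀ i j, H i j = r * L.cd1 (fun i => D i s) i j - u i * u j := by
    intro i j
    simp only [hH, cd1, Matrix.of_apply, hu, Derivation.leibniz, smul_eq_mul, deriv_inv hr,
      mul_sub, Finset.mul_sum]
    have : ∀ e, L.Γ i e j * (r * D e s) = r * (L.Γ i e j * D e s) := fun e => by ring
    simp only [this]
    ring
  have hus : ∀ i j, D i (u j) = D j (u i) := by
    intro i j
    simp only [hu, Derivation.leibniz, smul_eq_mul, deriv_inv hr, L.comm i j]; ring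
  have hHsymm : ∀ i j, H i j = H j i := L.cd1_symm hus
  have hWG : ∀ j k, ∑ i, W j i * L.G i k = H j k := by
    intro j k
    rw [← L.G_mul_gi_mul k (H j)]
    exact Finset.sum_congr rfl fun m _ => by rw [L.G_symm_apply k m, mul_comm]
  have hUG : ∀ k, ∑ i, U i * L.G i k = u k := by
    intro k
    rw [← L.G_mul_gi_mul k u]
    exact Finset.sum_congr rfl fun m _ => by rw [L.G_symm_apply k m, mul_comm]
  have hterm : ∀ a j k, (L.conformal s r hr).R a j a k = L.R a j a k
      + ((if a = k then 1 else 0) * (D j (u a) - D a (u j)) - (if a = j then 1 else 0) * H a k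
        + H j k + W a a * L.G j k - W j a * L.G a k
        - (if a = j then 1 else 0) * (u a * u k) + u j * u k
        + (if a = j then 1 else 0) * (N * L.G a k) - N * L.G j k + U a * u a * L.G j k
        - u j * (U a * L.G a k)) := by
    intro a j k
    rw [L.R_add (L.confDiff s r) (L.conformal s r hr) (fun _ => rfl)]
    simp only [Matrix.add_apply, Matrix.sub_apply (A := dmat (D a) (L.confDiff s r j)
      + L.Γ a * L.confDiff s r j - L.confDiff s r j * L.Γ a), confDiff_deriv]
    rw [Matrix.sub_apply, confDiff_mul, confDiff_mul]
    have ht : L.Γ a a j = L.Γ j a a := L.torsion a j a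
    have ht2 : ∀ m, L.Γ a m j = L.Γ j m a := fun m => L.torsion a j m
    simp only [if_true, ht2]
    rw [L.G_symm_apply j a]
    change L.R a j a k
      + (-D a (u j) * (if a = k then 1 else 0)
        - (if a = j then 1 else 0) * H a k + W a a * L.G j k
        + U a * (∑ m, L.Γ j m a * L.G m k) - L.Γ j a a * u k
        - (-D j (u a) * (if a = k then 1 else 0)
        - 1 * H j k + W j a * L.G a k
        + U a * (∑ m, L.Γ j m a * L.G m k) - L.Γ j a a * u k))
      + (u a * u j * (if a = k then 1 else 0) + (if a = j then 1 else 0) * (u a * u k)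
        + 1 * (2 * u j * u k - N * L.G j k) - u j * U a * L.G a k - U a * L.G a j * u k
        - (u j * u a * (if a = k then 1 else 0) + 1 * (u j * u k)
        + (if a = j then 1 else 0) * (2 * u a * u k - N * L.G a k) - u a * U a * L.G j k
        - U a * L.G a j * u k)) = _
    ring
  -- With `u = r ds`, the contraction yields `(n-2)(∇u + u ⊗ u)` plus multiples of the metric, where
  -- `n` is the number of indices. Since `∇u = r ∇∇s - u ⊗ u`, the quadratic terms drop out.
  refine ⟨∑ a, W a a - ((Fintype.card ι : A) - 2) * N, ?_⟩
  ext j k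
  have hNU : ∑ a, U a * u a = N := Finset.sum_congr rfl fun a _ => mul_comm _ _
  simp only [Ric, Matrix.of_apply, hterm, Finset.sum_add_distrib, Finset.sum_sub_distrib, hWG,
    ite_mul, one_mul, zero_mul, Finset.sum_ite_eq', Finset.mem_univ, if_true, hus j k,
    Matrix.add_apply, Matrix.smul_apply, smul_eq_mul, Finset.sum_const, Finset.card_univ,
    nsmul_eq_mul, ← Finset.sum_mul, ← Finset.mul_sum, hUG, hNU]
  rw [hHs j k]
  ring

end LeviCivita

end Algebra

end ConfHyp

namespace ConfHyp

section Algebra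

variable {A A' : Type*} [CommRing A] [Algebra ℝ A] [CommRing A'] [Algebra ℝ A']
  {ι : Type*} [Fintype ι] [DecidableEq ι]

/-! ### Change of coordinates -/

/-- A change of coordinates with Jacobian matrix `j`: a ring homomorphism `f` that intertwines two
families of derivations by the chain rule. -/
structure CoordChange (D : ι → Derivation ℝ A A) (D' : ι → Derivation ℝ A' A') where
  f : A →+* A'
  j : Matrix ι ι A'
  k : Matrix ι ι A'
  mul_k : j * k = 1
  chain : ∀ i a, D' i (f a) = ∑ c, j c i * f (D c a)
  closed : ∀ i l c, D' i (j c l) = D' l (j c i)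

namespace CoordChange

variable {D : ι → Derivation ℝ A A} {D' : ι → Derivation ℝ A' A'} (Φ : CoordChange D D')
  (L : LeviCivita D)

theorem k_mul : Φ.k * Φ.j = 1 := mul_eq_one_comm.1 Φ.mul_k

/-- The pull-back of a family of matrices, seen as a matrix valued one-form. -/
def pull (X : ι → Matrix ι ι A) (i : ι) : Matrix ι ι A' := ∑ c, Φ.j c i • (X c).map Φ.f

theorem dmat_map (i : ι) (X : Matrix ι ι A) :
    dmat (D' i) (X.map Φ.f) = Φ.pull (fun c => dmat (D c) X) i := by
  ext a b
  simp [pull, Matrix.sum_apply, Φ.chain]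

theorem dmat_j (i : ι) : ∀ c l, dmat (D' i) Φ.j c l = dmat (D' l) Φ.j c i :=
  fun c l => Φ.closed i l c

/-- The transformed connection matrices. -/
def gam (i : ι) : Matrix ι ι A' := Φ.k * (dmat (D' i) Φ.j + Φ.pull L.Γ i * Φ.j)

theorem j_mul_gam (i : ι) : Φ.j * Φ.gam L i = dmat (D' i) Φ.j + Φ.pull L.Γ i * Φ.j := by
  rw [gam, ← mul_assoc, Φ.mul_k, one_mul]

theorem map_transpose_mul (X Y : Matrix ι ι A) :
    (X.transpose * Y).map Φ.f = (X.map Φ.f).transpose * Y.map Φ.f := by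
  rw [Matrix.map_mul, Matrix.transpose_map]

theorem dmat_map_G (i : ι) : dmat (D' i) (L.G.map Φ.f)
    = (Φ.pull L.Γ i).transpose * L.G.map Φ.f + L.G.map Φ.f * Φ.pull L.Γ i := by
  rw [dmat_map]
  simp only [pull, L.compat, Matrix.transpose_sum, Matrix.sum_mul, Matrix.mul_sum,
    ← Finset.sum_add_distrib]
  refine Finset.sum_congr rfl fun c _ => ?_
  rw [Matrix.map_add _ (map_add Φ.f), map_transpose_mul, Matrix.map_mul, smul_add,
    Matrix.transpose_smul, Matrix.smul_mul, Matrix.mul_smul]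

theorem pull_mul_apply (X : ι → Matrix ι ι A) (i c l : ι) :
    (Φ.pull X i * Φ.j) c l = ∑ b, ∑ a, Φ.j a i * Φ.j b l * Φ.f (X a c b) := by
  simp only [Matrix.mul_apply, pull, Matrix.sum_apply, Matrix.smul_apply, Matrix.map_apply,
    smul_eq_mul, Finset.sum_mul]
  exact Finset.sum_congr rfl fun b _ => Finset.sum_congr rfl fun a _ => by ring

/-- The Levi-Civita connection in the new coordinates. -/
def leviCivita (hcomm : ∀ i l a, D' i (D' l a) = D' l (D' i a)) : LeviCivita D' where
  G := Φ.j.transpose * L.G.map Φ.f * Φ.j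
  gi := Φ.k * L.gi.map Φ.f * Φ.k.transpose
  Γ := Φ.gam L
  comm := hcomm
  symm := by
    rw [Matrix.transpose_mul, Matrix.transpose_mul, Matrix.transpose_transpose,
      ← Matrix.transpose_map, L.symm, mul_assoc]
  gi_mul := by
    have h1 : Φ.k.transpose * Φ.j.transpose = 1 := by
      rw [← Matrix.transpose_mul, Φ.mul_k, Matrix.transpose_one]
    have h2 : L.gi.map Φ.f * L.G.map Φ.f = 1 := by
      rw [← Matrix.map_mul, L.gi_mul, Matrix.map_one _ (map_zero _) (map_one _)]
    calc Φ.k * L.gi.map Φ.f * Φ.k.transpose * (Φ.j.transpose * L.G.map Φ.f * Φ.j)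
        = Φ.k * (L.gi.map Φ.f * (Φ.k.transpose * Φ.j.transpose) * L.G.map Φ.f) * Φ.j := by
          noncomm_ring
      _ = 1 := by rw [h1, mul_one, h2, mul_one, Φ.k_mul]
  compat i := by
    have h := Φ.j_mul_gam L i
    have e1 : (Φ.gam L i).transpose * (Φ.j.transpose * L.G.map Φ.f * Φ.j)
        = (dmat (D' i) Φ.j + Φ.pull L.Γ i * Φ.j).transpose * L.G.map Φ.f * Φ.j := by
      rw [← h, Matrix.transpose_mul]; noncomm_ring
    have e2 : (Φ.j.transpose * L.G.map Φ.f * Φ.j) * Φ.gam L i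
        = Φ.j.transpose * L.G.map Φ.f * (dmat (D' i) Φ.j + Φ.pull L.Γ i * Φ.j) := by
      rw [← h]; noncomm_ring
    rw [e1, e2]
    simp only [dmat_mul, dmat_transpose, Φ.dmat_map_G, Matrix.transpose_add,
      Matrix.transpose_mul]
    noncomm_ring
  torsion i l k := by
    have h : (dmat (D' i) Φ.j + Φ.pull L.Γ i * Φ.j).col l
        = (dmat (D' l) Φ.j + Φ.pull L.Γ l * Φ.j).col i := by
      ext c
      simp only [Matrix.col_apply, Matrix.add_apply, pull_mul_apply]
      rw [Φ.dmat_j, Finset.sum_comm]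
      congr 1
      refine Finset.sum_congr rfl fun a _ => Finset.sum_congr rfl fun b _ => ?_
      rw [L.torsion a b c]; ring
    simp only [gam, Matrix.mul_apply (M := Φ.k)]
    refine Finset.sum_congr rfl fun c _ => ?_
    rw [show (dmat (D' i) Φ.j + Φ.pull L.Γ i * Φ.j) c l
      = (dmat (D' l) Φ.j + Φ.pull L.Γ l * Φ.j) c i from congrFun h c]

variable (hcomm : ∀ i l a, D' i (D' l a) = D' l (D' i a))

theorem dmat_pull (X : ι → Matrix ι ι A) (i l : ι) : dmat (D' i) (Φ.pull X l)
    = ∑ c, D' i (Φ.j c l) • (X c).map Φ.f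
      + ∑ c, ∑ a, (Φ.j a i * Φ.j c l) • (dmat (D a) (X c)).map Φ.f := by
  simp only [pull, dmat_sum, dmat_smul, Finset.sum_add_distrib]
  congr 1
  refine Finset.sum_congr rfl fun c _ => ?_
  rw [dmat_map, pull, Finset.smul_sum]
  exact Finset.sum_congr rfl fun a _ => by rw [smul_smul, mul_comm]

theorem pull_mul_pull (X Y : ι → Matrix ι ι A) (i l : ι) : Φ.pull X i * Φ.pull Y l
    = ∑ c, ∑ a, (Φ.j a i * Φ.j c l) • (X a * Y c).map Φ.f := by
  simp only [pull, Matrix.sum_mul, Matrix.mul_sum, Matrix.smul_mul, Matrix.mul_smul,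
    Matrix.map_mul, Finset.smul_sum, smul_smul, mul_comm (Φ.j _ l)]

/-- The derivatives of the Jacobian entries are symmetric in `i` and `l` by `closed`, so
antisymmetrization removes them and only pulled back curvature is left. -/
theorem pull_R (i l : ι) : dmat (D' i) (Φ.pull L.Γ l) - dmat (D' l) (Φ.pull L.Γ i)
      + Φ.pull L.Γ i * Φ.pull L.Γ l - Φ.pull L.Γ l * Φ.pull L.Γ i
    = ∑ c, ∑ a, (Φ.j a i * Φ.j c l) • (L.R a c).map Φ.f := by
  have e : ∀ X : ι → ι → Matrix ι ι A, ∑ c, ∑ a, (Φ.j a l * Φ.j c i) • (X a c).map Φ.f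
      = ∑ c, ∑ a, (Φ.j a i * Φ.j c l) • (X c a).map Φ.f := by
    intro X
    rw [Finset.sum_comm]
    exact Finset.sum_congr rfl fun a _ => Finset.sum_congr rfl fun b _ => by rw [mul_comm]
  rw [dmat_pull, dmat_pull, pull_mul_pull, pull_mul_pull, e fun a c => dmat (D a) (L.Γ c),
    e fun a c => L.Γ a * L.Γ c]
  simp only [Φ.closed i l]
  simp only [LeviCivita.R, Matrix.map_sub _ (map_sub Φ.f), Matrix.map_add _ (map_add Φ.f),
    smul_add, smul_sub, Finset.sum_add_distrib, Finset.sum_sub_distrib]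
  abel

/-- The new connection is a gauge transform of the pulled back one by the Jacobian, hence its
curvature is conjugated. Keeping `j` on the left avoids differentiating its inverse. -/
theorem j_mul_R (i l : ι) : Φ.j * (Φ.leviCivita L hcomm).R i l
    = (∑ c, ∑ a, (Φ.j a i * Φ.j c l) • (L.R a c).map Φ.f) * Φ.j := by
  rw [← Φ.pull_R]
  have d1 : ∀ i l, dmat (D' i) Φ.j * Φ.gam L l + Φ.j * dmat (D' i) (Φ.gam L l)
      = dmat (D' i) (dmat (D' l) Φ.j)
        + (dmat (D' i) (Φ.pull L.Γ l) * Φ.j + Φ.pull L.Γ l * dmat (D' i) Φ.j) := by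
    intro i l
    rw [← dmat_mul, Φ.j_mul_gam, dmat_add, dmat_mul]
  have d2 : ∀ i l, Φ.j * dmat (D' i) (Φ.gam L l) = dmat (D' i) (dmat (D' l) Φ.j)
        + (dmat (D' i) (Φ.pull L.Γ l) * Φ.j + Φ.pull L.Γ l * dmat (D' i) Φ.j)
        - dmat (D' i) Φ.j * Φ.gam L l := fun i l => by rw [← d1]; abel
  have d3 : ∀ i l, Φ.j * (Φ.gam L i * Φ.gam L l) = dmat (D' i) Φ.j * Φ.gam L l
      + Φ.pull L.Γ i * (dmat (D' l) Φ.j + Φ.pull L.Γ l * Φ.j) := by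
    intro i l
    rw [← mul_assoc, Φ.j_mul_gam, add_mul, mul_assoc, Φ.j_mul_gam]
  change Φ.j * (dmat (D' i) (Φ.gam L l) - dmat (D' l) (Φ.gam L i) + Φ.gam L i * Φ.gam L l
    - Φ.gam L l * Φ.gam L i) = _
  rw [mul_sub, mul_add, mul_sub, d2, d2, d3, d3, dmat_comm (hcomm i l) Φ.j]
  noncomm_ring

/-- The upper index transforms with `k` and the contracted lower index with `j`; in the trace these
two cancel. -/
theorem Ric_eq : (Φ.leviCivita L hcomm).Ric = Φ.j.transpose * L.Ric.map Φ.f * Φ.j := by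
  have h : ∀ i l, (Φ.leviCivita L hcomm).R i l
      = Φ.k * ((∑ c, ∑ a, (Φ.j a i * Φ.j c l) • (L.R a c).map Φ.f) * Φ.j) := by
    intro i l
    rw [← Φ.j_mul_R L hcomm, ← mul_assoc, Φ.k_mul, one_mul]
  ext l m
  have e : ∀ i, (Φ.leviCivita L hcomm).R i l i m = ∑ e, ∑ c, ∑ a, Φ.j a i * Φ.k i e
      * (Φ.j c l * ((L.R a c).map Φ.f * Φ.j) e m) := by
    intro i
    rw [h, Matrix.mul_apply]
    refine Finset.sum_congr rfl fun e _ => ?_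
    simp only [Matrix.sum_mul, Matrix.smul_mul, Matrix.sum_apply, Matrix.smul_apply, smul_eq_mul,
      Finset.mul_sum]
    exact Finset.sum_congr rfl fun c _ => Finset.sum_congr rfl fun a _ => by ring
  simp only [LeviCivita.Ric, Matrix.of_apply, e]
  have hd : ∀ a e, ∑ i, Φ.j a i * Φ.k i e = if a = e then 1 else 0 := by
    intro a e; rw [← Matrix.mul_apply, Φ.mul_k, Matrix.one_apply]
  calc ∑ i, ∑ e, ∑ c, ∑ a, Φ.j a i * Φ.k i e * (Φ.j c l * ((L.R a c).map Φ.f * Φ.j) e m)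
      = ∑ e, ∑ c, ∑ a, (∑ i, Φ.j a i * Φ.k i e) * (Φ.j c l * ((L.R a c).map Φ.f * Φ.j) e m) := by
        rw [Finset.sum_comm]
        refine Finset.sum_congr rfl fun e _ => ?_
        rw [Finset.sum_comm]
        refine Finset.sum_congr rfl fun c _ => ?_
        rw [Finset.sum_comm]
        exact Finset.sum_congr rfl fun a _ => by rw [Finset.sum_mul]
    _ = ∑ e, ∑ c, Φ.j c l * ((L.R e c).map Φ.f * Φ.j) e m := by
        simp only [hd, ite_mul, one_mul, zero_mul, Finset.sum_ite_eq', Finset.mem_univ, if_true]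
    _ = (Φ.j.transpose * L.Ric.map Φ.f * Φ.j) l m := by
        rw [Finset.sum_comm, mul_assoc, Matrix.mul_apply]
        refine Finset.sum_congr rfl fun c _ => ?_
        rw [← Finset.mul_sum]
        congr 1
        simp only [Matrix.mul_apply, Matrix.map_apply, LeviCivita.Ric, Matrix.of_apply, map_sum,
          Finset.sum_mul]
        rw [Finset.sum_comm]

theorem trace_gi_mul (X : Matrix ι ι A) :
    ((Φ.leviCivita L hcomm).gi * (Φ.j.transpose * X.map Φ.f * Φ.j)).trace
      = Φ.f (L.gi * X).trace := by
  have h1 : Φ.k.transpose * Φ.j.transpose = 1 := by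
    rw [← Matrix.transpose_mul, Φ.mul_k, Matrix.transpose_one]
  calc (Φ.k * L.gi.map Φ.f * Φ.k.transpose * (Φ.j.transpose * X.map Φ.f * Φ.j)).trace
      = (Φ.k * (L.gi.map Φ.f * (Φ.k.transpose * Φ.j.transpose) * X.map Φ.f * Φ.j)).trace := by
        congr 1; noncomm_ring
    _ = ((L.gi * X).map Φ.f).trace := by
        rw [h1, mul_one, Matrix.trace_mul_comm, mul_assoc, Φ.mul_k, mul_one, Matrix.map_mul]
    _ = Φ.f (L.gi * X).trace := by
        simp only [Matrix.trace, Matrix.diag_apply, Matrix.map_apply, map_sum]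

theorem Sc_eq : (Φ.leviCivita L hcomm).Sc = Φ.f L.Sc := by
  rw [LeviCivita.Sc, Φ.Ric_eq, Φ.trace_gi_mul]; rfl

/-- The second derivatives of the coordinate change produced by the chain rule are cancelled by the
inhomogeneous term of the transformed connection. -/
theorem hessian_eq (s : A) : (Φ.leviCivita L hcomm).cd1 (fun i => D' i (Φ.f s))
    = Φ.j.transpose * (L.cd1 fun i => D i s).map Φ.f * Φ.j := by
  let w : Matrix Unit ι A' := Matrix.of fun _ c => Φ.f (D c s)
  have hw : (Matrix.of fun _ : Unit => fun i => D' i (Φ.f s)) = w * Φ.j := by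
    ext _ i
    simp [Matrix.mul_apply, w, Φ.chain, mul_comm]
  ext i l
  rw [LeviCivita.cd1_row, hw]
  have h1 : dmat (D' i) (w * Φ.j) - w * Φ.j * (Φ.leviCivita L hcomm).Γ i
      = (dmat (D' i) w - w * Φ.pull L.Γ i) * Φ.j := by
    change dmat (D' i) (w * Φ.j) - w * Φ.j * Φ.gam L i = _
    rw [Matrix.mul_assoc, Φ.j_mul_gam, dmat_mul, Matrix.mul_add, Matrix.sub_mul,
      ← Matrix.mul_assoc w (Φ.pull L.Γ i)]
    abel
  rw [h1, Matrix.mul_apply, Matrix.mul_apply]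
  refine Finset.sum_congr rfl fun b _ => ?_
  congr 1
  rw [Matrix.mul_apply]
  simp only [Matrix.sub_apply, dmat_apply, w, Matrix.of_apply, Φ.chain, Matrix.mul_apply, pull,
    Matrix.sum_apply, Matrix.smul_apply, Matrix.map_apply, Matrix.transpose_apply,
    LeviCivita.cd1, map_sub, map_sum, map_mul, mul_sub, Finset.sum_sub_distrib, smul_eq_mul,
    Finset.mul_sum]
  congr 1
  rw [Finset.sum_comm]
  exact Finset.sum_congr rfl fun c _ => Finset.sum_congr rfl fun e _ => by ring

theorem grad_sq_eq (s : A) :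
    ∑ a, D' a (Φ.f s) * ∑ b, (Φ.leviCivita L hcomm).gi a b * D' b (Φ.f s)
      = Φ.f (∑ a, D a s * ∑ b, L.gi a b * D b s) := by
  let w : Matrix Unit ι A' := Matrix.of fun _ c => Φ.f (D c s)
  have hw : (Matrix.of fun _ : Unit => fun i => D' i (Φ.f s)) = w * Φ.j := by
    ext _ i
    simp [Matrix.mul_apply, w, Φ.chain, mul_comm]
  have h1 : Φ.k.transpose * Φ.j.transpose = 1 := by
    rw [← Matrix.transpose_mul, Φ.mul_k, Matrix.transpose_one]
  have e1 : ∑ a, D' a (Φ.f s) * ∑ b, (Φ.leviCivita L hcomm).gi a b * D' b (Φ.f s)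
      = (w * Φ.j * ((Φ.leviCivita L hcomm).gi * (w * Φ.j).transpose)) () () := by
    rw [← hw]
    simp [Matrix.mul_apply]
  have e2 : w * Φ.j * ((Φ.leviCivita L hcomm).gi * (w * Φ.j).transpose)
      = w * (L.gi.map Φ.f * w.transpose) := by
    change w * Φ.j * ((Φ.k * L.gi.map Φ.f * Φ.k.transpose) * (w * Φ.j).transpose) = _
    rw [Matrix.transpose_mul]
    calc w * Φ.j * (Φ.k * L.gi.map Φ.f * Φ.k.transpose * (Φ.j.transpose * w.transpose))
        = w * ((Φ.j * Φ.k) * (L.gi.map Φ.f * ((Φ.k.transpose * Φ.j.transpose)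
          * w.transpose))) := by simp only [Matrix.mul_assoc]
      _ = _ := by rw [h1, Φ.mul_k, Matrix.one_mul, Matrix.one_mul]
  rw [e1, e2]
  simp [Matrix.mul_apply, w, map_sum, map_mul]

end CoordChange

end Algebra

end ConfHyp

noncomputable section

namespace ConfHyp

/-! ### The algebra of smooth functions on an open set and its partial derivatives -/

section Smooth

variable {d : ℕ} {U : Set (Coord d)}

theorem contDiffOn_pd (hU : IsOpen U) {f : Coord d → ℝ} (hf : ContDiffOn ℝ ∞ f U) (i : Fin d) :
    ContDiffOn ℝ ∞ (pd i f) U :=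
  (hf.fderiv_of_isOpen hU (m := ∞) (by simp)).clm_apply contDiffOn_const

theorem pd_congr (hU : IsOpen U) {f g : Coord d → ℝ} (h : ∀ x ∈ U, f x = g x) (i : Fin d)
    {x : Coord d} (hx : x ∈ U) : pd i f x = pd i g x := by
  have : f =ᶠ[nhds x] g := Filter.eventually_of_mem (hU.mem_nhds hx) h
  rw [pd, pd, this.fderiv_eq]

theorem differentiableAt_of_smooth (hU : IsOpen U) {f : Coord d → ℝ} (hf : ContDiffOn ℝ ∞ f U)
    {x : Coord d} (hx : x ∈ U) : DifferentiableAt ℝ f x :=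
  (hf.contDiffAt (hU.mem_nhds hx)).differentiableAt (by simp)

theorem pd_add (i : Fin d) {f g : Coord d → ℝ} {x : Coord d} (hf : DifferentiableAt ℝ f x)
    (hg : DifferentiableAt ℝ g x) : pd i (fun y => f y + g y) x = pd i f x + pd i g x := by
  simp only [pd]
  rw [fderiv_fun_add hf hg]; rfl

theorem pd_mul (i : Fin d) {f g : Coord d → ℝ} {x : Coord d} (hf : DifferentiableAt ℝ f x)
    (hg : DifferentiableAt ℝ g x) :
    pd i (fun y => f y * g y) x = f x * pd i g x + g x * pd i f x := by
  simp only [pd]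
  rw [fderiv_fun_mul hf hg]; rfl

theorem pd_const_mul (i : Fin d) (c : ℝ) {f : Coord d → ℝ} {x : Coord d}
    (hf : DifferentiableAt ℝ f x) : pd i (fun y => c * f y) x = c * pd i f x := by
  simp only [pd]
  rw [fderiv_const_mul hf]; rfl

theorem pd_comm (hU : IsOpen U) {f : Coord d → ℝ} (hf : ContDiffOn ℝ ∞ f U) (i j : Fin d)
    {x : Coord d} (hx : x ∈ U) : pd i (pd j f) x = pd j (pd i f) x := by
  have hfx := hf.contDiffAt (hU.mem_nhds hx)
  have hd : DifferentiableAt ℝ (fderiv ℝ f) x :=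
    (hfx.fderiv_right (m := ∞) (by simp)).differentiableAt (by simp)
  have h : ∀ v w : Coord d, fderiv ℝ (fun y => fderiv ℝ f y v) x w = fderiv ℝ (fderiv ℝ f) x w v := by
    intro v w
    rw [fderiv_clm_apply hd (differentiableAt_const v)]
    simp
  have hsymm : IsSymmSndFDerivAt ℝ f x :=
    hfx.isSymmSndFDerivAt (by simpa using ENat.LEInfty.out)
  change fderiv ℝ (fun y => fderiv ℝ f y _) x _ = fderiv ℝ (fun y => fderiv ℝ f y _) x _
  rw [h, h, hsymm.eq]

/-- The algebra of smooth functions on an open set. -/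
def smoothAlg (U : Set (Coord d)) : Subalgebra ℝ (U → ℝ) where
  carrier := {f | ∃ F : Coord d → ℝ, ContDiffOn ℝ ∞ F U ∧ ∀ x : U, F x = f x}
  mul_mem' := by
    rintro f g ⟨F, hF, hf⟩ ⟨K, hK, hg⟩
    exact ⟨fun x => F x * K x, hF.mul hK, fun x => by simp [hf, hg]⟩
  add_mem' := by
    rintro f g ⟨F, hF, hf⟩ ⟨K, hK, hg⟩
    exact ⟨fun x => F x + K x, hF.add hK, fun x => by simp [hf, hg]⟩
  algebraMap_mem' r := ⟨fun _ => r, contDiffOn_const, fun _ => rfl⟩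

namespace smoothAlg

/-- Evaluation at a point. -/
def ev (x : U) : smoothAlg U →ₐ[ℝ] ℝ := (Pi.evalAlgHom ℝ (fun _ : U => ℝ) x).comp (smoothAlg U).val

theorem ext_ev {a b : smoothAlg U} (h : ∀ x, ev x a = ev x b) : a = b :=
  Subtype.ext (funext h)

/-- Restriction of a smooth function. -/
def res (f : Coord d → ℝ) (hf : ContDiffOn ℝ ∞ f U) : smoothAlg U :=
  ⟨fun x => f x, f, hf, fun _ => rfl⟩

@[simp] theorem ev_res (f : Coord d → ℝ) (hf : ContDiffOn ℝ ∞ f U) (x : U) :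
    ev x (res f hf) = f x := rfl

/-- An extension of an element to a function on the coordinate space. -/
def rep (a : smoothAlg U) : Coord d → ℝ := a.2.choose

theorem rep_smooth (a : smoothAlg U) : ContDiffOn ℝ ∞ (rep a) U := a.2.choose_spec.1

theorem rep_apply (a : smoothAlg U) (x : U) : rep a x = ev x a := a.2.choose_spec.2 x

/-- This gives smoothness without further work: any coordinate expression that is the evaluation of
an element of the algebra is smooth. -/
theorem smooth_of_ev {a : smoothAlg U} {f : Coord d → ℝ} (h : ∀ x : U, ev x a = f x) :
    ContDiffOn ℝ ∞ f U :=
  (rep_smooth a).congr fun x hx => by rw [rep_apply a ⟨x, hx⟩, h]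

variable (hU : IsOpen U)

/-- The partial derivatives. -/
def D (i : Fin d) : Derivation ℝ (smoothAlg U) (smoothAlg U) :=
  Derivation.mk'
    -- An arbitrary extension is differentiated. As `U` is open, the derivative at its points
    -- depends only on the values on `U`, and the derivation rules follow from those of the
    -- extensions.
    { toFun := fun a => res (pd i (rep a)) (contDiffOn_pd hU (rep_smooth a) i)
      map_add' := fun a b => ext_ev fun x => by
        rw [map_add]
        simp only [ev_res]
        rw [← pd_add i (differentiableAt_of_smooth hU (rep_smooth a) x.2)
          (differentiableAt_of_smooth hU (rep_smooth b) x.2)]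
        refine pd_congr hU (fun y hy => ?_) i x.2
        rw [rep_apply _ ⟨y, hy⟩, rep_apply _ ⟨y, hy⟩, rep_apply _ ⟨y, hy⟩, map_add]
      map_smul' := fun c a => ext_ev fun x => by
        rw [map_smul]
        simp only [ev_res, RingHom.id_apply, smul_eq_mul]
        rw [← pd_const_mul i c (differentiableAt_of_smooth hU (rep_smooth a) x.2)]
        refine pd_congr hU (fun y hy => ?_) i x.2
        rw [rep_apply _ ⟨y, hy⟩, rep_apply _ ⟨y, hy⟩, map_smul, smul_eq_mul] }
    (fun a b => ext_ev fun x => by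
      simp only [LinearMap.coe_mk, AddHom.coe_mk, ev_res, smul_eq_mul, map_add, map_mul (ev x)]
      rw [← rep_apply a x, ← rep_apply b x,
        ← pd_mul i (differentiableAt_of_smooth hU (rep_smooth a) x.2)
          (differentiableAt_of_smooth hU (rep_smooth b) x.2)]
      refine pd_congr hU (fun y hy => ?_) i x.2
      rw [rep_apply _ ⟨y, hy⟩, rep_apply _ ⟨y, hy⟩, rep_apply _ ⟨y, hy⟩, map_mul])

theorem ev_D (i : Fin d) (a : smoothAlg U) (x : U) : ev x (D hU i a) = pd i (rep a) x := rfl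

/-- The derivative of an element represented by `f`. -/
theorem ev_D_of {a : smoothAlg U} {f : Coord d → ℝ} (h : ∀ x : U, ev x a = f x) (i : Fin d)
    (x : U) : ev x (D hU i a) = pd i f x := by
  rw [ev_D]
  exact pd_congr hU (fun y hy => by rw [rep_apply a ⟨y, hy⟩, h]) i x.2

@[simp] theorem ev_D_res (i : Fin d) (f : Coord d → ℝ) (hf : ContDiffOn ℝ ∞ f U) (x : U) :
    ev x (D hU i (res f hf)) = pd i f x := ev_D_of hU (fun _ => rfl) i x

theorem D_comm (i j : Fin d) (a : smoothAlg U) : D hU i (D hU j a) = D hU j (D hU i a) := by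
  apply ext_ev
  intro x
  rw [ev_D_of hU (f := pd j (rep a)) (fun _ => rfl), ev_D_of hU (f := pd i (rep a)) (fun _ => rfl)]
  exact pd_comm hU (rep_smooth a) i j x.2

end smoothAlg

end Smooth

/-! ## Metrics on open sets of the coordinate space -/

section Metric

variable {d : ℕ}

/-- `G` is a smooth non-degenerate metric on the open set `U`. -/
structure IsMetricOn (U : Set (Coord d)) (G : Cov2 d) : Prop where
  isOpen : IsOpen U
  smooth : ∀ i j, ContDiffOn ℝ ∞ (fun x => G x i j) U
  symm : ∀ x ∈ U, ∀ i j, G x i j = G x j i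
  det : ∀ x ∈ U, IsUnit (Matrix.of (G x)).det

theorem contDiffOn_det {m : ℕ} {U : Set (Coord d)} {X : Coord d → Matrix (Fin m) (Fin m) ℝ}
    (hX : ∀ i j, ContDiffOn ℝ ∞ (fun x => X x i j) U) :
    ContDiffOn ℝ ∞ (fun x => (X x).det) U := by
  simp only [Matrix.det_apply']
  refine ContDiffOn.sum fun σ _ => contDiffOn_const.mul ?_
  exact contDiffOn_prod fun i _ => hX _ _

namespace IsMetricOn

variable {U : Set (Coord d)} {G : Cov2 d} (h : IsMetricOn U G)
include h

theorem ginv_smooth (i j : Fin d) : ContDiffOn ℝ ∞ (fun x => ginv G x i j) U := by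
  have h1 : ContDiffOn ℝ ∞ (fun x => ((Matrix.of (G x)).det)⁻¹ * (Matrix.of (G x)).adjugate i j)
      U := by
    refine ContDiffOn.mul (ContDiffOn.inv (contDiffOn_det fun i j => h.smooth i j)
      fun x hx => (h.det x hx).ne_zero) ?_
    simp only [Matrix.adjugate_apply]
    refine contDiffOn_det fun k l => ?_
    by_cases hk : k = j
    · subst hk
      simp only [Matrix.updateRow_self]
      exact contDiffOn_const
    · simp only [Matrix.updateRow_ne hk]
      exact h.smooth k l
  refine h1.congr fun x hx => ?_
  simp [ginv, Matrix.inv_def, Ring.inverse_eq_inv']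

theorem ginv_mul {x : Coord d} (hx : x ∈ U) (i j : Fin d) :
    ∑ l, ginv G x i l * G x l j = if i = j then 1 else 0 := by
  have := congrFun (congrFun (Matrix.nonsing_inv_mul _ (h.det x hx)) i) j
  rw [Matrix.mul_apply, Matrix.one_apply] at this
  exact this

theorem mul_ginv {x : Coord d} (hx : x ∈ U) (i j : Fin d) :
    ∑ l, G x i l * ginv G x l j = if i = j then 1 else 0 := by
  have := congrFun (congrFun (Matrix.mul_nonsing_inv _ (h.det x hx)) i) j
  rw [Matrix.mul_apply, Matrix.one_apply] at this
  exact this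

theorem christ_smooth (k i j : Fin d) : ContDiffOn ℝ ∞ (christ G k i j) U := by
  refine contDiffOn_const.mul (ContDiffOn.sum fun l _ => (h.ginv_smooth k l).mul ?_)
  exact ((contDiffOn_pd h.isOpen (h.smooth l j) i).add
    (contDiffOn_pd h.isOpen (h.smooth l i) j)).sub (contDiffOn_pd h.isOpen (h.smooth i j) l)

theorem pd_symm {x : Coord d} (hx : x ∈ U) (k i j : Fin d) :
    pd k (fun y => G y i j) x = pd k (fun y => G y j i) x :=
  pd_congr h.isOpen (fun y hy => h.symm y hy i j) k hx

theorem christ_symm {x : Coord d} (hx : x ∈ U) (k i j : Fin d) :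
    christ G k i j x = christ G k j i x := by
  simp only [christ]
  congr 1
  refine Finset.sum_congr rfl fun l _ => ?_
  rw [h.pd_symm hx l i j]; ring

theorem G_mul_christ {x : Coord d} (hx : x ∈ U) (k i j : Fin d) :
    ∑ l, G x k l * christ G l i j x = (1 / 2) *
      (pd i (fun y => G y k j) x + pd j (fun y => G y k i) x - pd k (fun y => G y i j) x) := by
  set v : Fin d → ℝ := fun m =>
    pd i (fun y => G y m j) x + pd j (fun y => G y m i) x - pd m (fun y => G y i j) x
  have h1 : ∀ l, christ G l i j x = (1 / 2) * ∑ m, ginv G x l m * v m := fun l => rfl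
  calc ∑ l, G x k l * christ G l i j x = (1 / 2) * ∑ m, (∑ l, G x k l * ginv G x l m) * v m := by
        simp only [h1, Finset.mul_sum, Finset.sum_mul]
        rw [Finset.sum_comm]
        exact Finset.sum_congr rfl fun m _ => Finset.sum_congr rfl fun l _ => by ring
    _ = (1 / 2) * v k := by simp [h.mul_ginv hx]

theorem compat {x : Coord d} (hx : x ∈ U) (i j k : Fin d) :
    pd i (fun y => G y j k) x
      = ∑ l, christ G l i j x * G x l k + ∑ l, G x j l * christ G l i k x := by
  have e : ∑ l, christ G l i j x * G x l k = ∑ l, G x k l * christ G l i j x :=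
    Finset.sum_congr rfl fun l _ => by rw [h.symm x hx l k, mul_comm]
  rw [e, h.G_mul_christ hx, h.G_mul_christ hx, h.pd_symm hx i k j, h.pd_symm hx j i k,
    h.pd_symm hx k j i]
  ring

omit h in
/-- The Levi-Civita connection is the only torsion-free metric connection. -/
theorem christ_unique (h : IsMetricOn U G) {x : Coord d} (hx : x ∈ U)
    {Γ : Fin d → Fin d → Fin d → ℝ}
    (hΓ : ∀ k i j, Γ k i j = Γ k j i)
    (hG : ∀ i j k, pd i (fun y => G y j k) x = ∑ l, Γ l i j * G x l k + ∑ l, G x j l * Γ l i k)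
    (k i j : Fin d) : christ G k i j x = Γ k i j := by
  have e : ∀ i j k, ∑ l, Γ l i j * G x l k = ∑ l, G x k l * Γ l i j := fun i j k =>
    Finset.sum_congr rfl fun l _ => by rw [h.symm x hx l k, mul_comm]
  have e1 : ∀ m, pd i (fun y => G y m j) x + pd j (fun y => G y m i) x - pd m (fun y => G y i j) x
      = 2 * ∑ l, G x m l * Γ l i j := by
    intro m
    rw [hG, hG, hG, e, e, e]
    simp only [hΓ _ j i, hΓ _ j m, hΓ _ i m]
    ring
  simp only [christ, e1]
  calc 1 / 2 * ∑ l, ginv G x k l * (2 * ∑ m, G x l m * Γ m i j)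
      = ∑ m, (∑ l, ginv G x k l * G x l m) * Γ m i j := by
        simp only [Finset.mul_sum, Finset.sum_mul]
        rw [Finset.sum_comm]
        exact Finset.sum_congr rfl fun m _ => Finset.sum_congr rfl fun l _ => by ring
    _ = Γ k i j := by simp [h.ginv_mul hx]

open smoothAlg

/-- The Levi-Civita connection of `G` over the algebra of smooth functions. -/
def lc : LeviCivita (smoothAlg.D h.isOpen) where
  G := Matrix.of fun i j => res _ (h.smooth i j)
  gi := Matrix.of fun i j => res _ (h.ginv_smooth i j)
  Γ i := Matrix.of fun k j => res _ (h.christ_smooth k i j)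
  comm := smoothAlg.D_comm h.isOpen
  symm := by
    refine Matrix.ext fun i j => ext_ev fun x => ?_
    exact h.symm x x.2 j i
  gi_mul := by
    refine Matrix.ext fun i j => ext_ev fun x => ?_
    rw [Matrix.mul_apply, map_sum, Matrix.one_apply]
    simp only [map_mul, Matrix.of_apply, ev_res, h.ginv_mul x.2]
    split_ifs <;> simp
  compat i := by
    refine Matrix.ext fun j k => ext_ev fun x => ?_
    simp only [dmat_apply, Matrix.add_apply, Matrix.mul_apply, Matrix.transpose_apply,
      Matrix.of_apply, map_add, map_sum, map_mul, ev_res, ev_D_res]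
    exact h.compat x.2 i j k
  torsion i j k := ext_ev fun x => h.christ_symm x.2 k i j

variable (x : U)

@[simp] theorem ev_G (i j : Fin d) : ev x (h.lc.G i j) = G x i j := rfl
@[simp] theorem ev_gi (i j : Fin d) : ev x (h.lc.gi i j) = ginv G x i j := rfl
@[simp] theorem ev_Γ (i k j : Fin d) : ev x (h.lc.Γ i k j) = christ G k i j x := rfl

theorem ev_D_Γ (l i k j : Fin d) :
    ev x (smoothAlg.D h.isOpen l (h.lc.Γ i k j)) = pd l (christ G k i j) x :=
  ev_D_of h.isOpen (fun _ => rfl) l x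

theorem ev_R (i j l k : Fin d) : ev x (h.lc.R i j l k) = riem G i j l k x := by
  simp only [LeviCivita.R, Matrix.sub_apply, Matrix.add_apply, dmat_apply, Matrix.mul_apply,
    map_sub, map_add, map_sum, map_mul, ev_D_Γ, ev_Γ, riem, Finset.sum_sub_distrib]
  ring

theorem ev_Ric (i j : Fin d) : ev x (h.lc.Ric i j) = ricci G x i j := by
  simp only [LeviCivita.Ric, Matrix.of_apply, map_sum, h.ev_R, ricci]

theorem ev_trace (X : Matrix (Fin d) (Fin d) (smoothAlg U)) (t : Cov2 d)
    (hX : ∀ i j, ev x (X i j) = t x i j) : ev x (h.lc.gi * X).trace = trace G t x := by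
  simp only [Matrix.trace, Matrix.diag_apply, Matrix.mul_apply, map_sum, map_mul, hX, ev_gi, trace]
  rw [Finset.sum_comm]
  refine Finset.sum_congr rfl fun a _ => Finset.sum_congr rfl fun b _ => ?_
  rw [← h.ev_gi x b a, h.lc.gi_symm_apply, h.ev_gi]

theorem ev_Sc : ev x h.lc.Sc = trace G (ricci G) x := h.ev_trace x _ _ (h.ev_Ric x)

theorem ev_cd1 (v : Fin d → smoothAlg U) (w : Cov1 d) (hv : ∀ (x : U) i, ev x (v i) = w x i)
    (i j : Fin d) : ev x (h.lc.cd1 v i j) = nabla1 G w x i j := by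
  simp only [LeviCivita.cd1, Matrix.of_apply, map_sub, map_sum, map_mul, ev_Γ, hv, nabla1]
  rw [ev_D_of h.isOpen (f := fun y => w y j) (fun x => hv x j)]

theorem ev_cd2 (X : Matrix (Fin d) (Fin d) (smoothAlg U)) (t : Cov2 d)
    (hX : ∀ (x : U) i j, ev x (X i j) = t x i j) (i j k : Fin d) :
    ev x (h.lc.cd2 i X j k) = nabla2 G t x i j k := by
  simp only [LeviCivita.cd2, Matrix.sub_apply, dmat_apply, Matrix.mul_apply,
    Matrix.transpose_apply, map_sub, map_sum, map_mul, ev_Γ, hX, nabla2, Finset.sum_add_distrib]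
  rw [ev_D_of h.isOpen (f := fun y => t y j k) (fun x => hX x j k)]
  simp only [mul_comm (t x j _)]
  ring

theorem ev_div (X : Matrix (Fin d) (Fin d) (smoothAlg U)) (t : Cov2 d)
    (hX : ∀ (x : U) i j, ev x (X i j) = t x i j) (b : Fin d) :
    ev x (h.lc.div X b) = div2 G t x b := by
  simp only [LeviCivita.div, Matrix.mul_apply, map_sum, map_mul, ev_gi, h.ev_cd2 x X t hX, div2]

end IsMetricOn

end Metric

end ConfHyp

end

noncomputable section

namespace ConfHyp

/-! ## Leading coefficients along the zero locus -/

/-- `f = s^m k` on `U` with a smooth function `k` that agrees with `h` along the zero locus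
of `s`. -/
def Lead {d : ℕ} (U : Set (Coord d)) (s : Coord d → ℝ) (m : ℕ) (f h : Coord d → ℝ) : Prop :=
  ∃ k : Coord d → ℝ, ContDiffOn ℝ ∞ k U ∧ ∀ x ∈ U, f x = s x ^ m * k x ∧ (s x = 0 → k x = h x)

/-- `s` is a smooth function on the open set `U` with regular zero locus. -/
structure IsDefiningOn {d : ℕ} (U : Set (Coord d)) (s : Coord d → ℝ) : Prop where
  isOpen : IsOpen U
  smooth : ContDiffOn ℝ ∞ s U
  regular : ∀ x ∈ U, s x = 0 → fderiv ℝ s x ≠ 0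

section Lead

variable {d : ℕ} {U : Set (Coord d)} {s f g h h' : Coord d → ℝ} {m : ℕ}

theorem Lead.congr (hf : Lead U s m f h) (h1 : ∀ x ∈ U, f x = g x)
    (h2 : ∀ x ∈ U, s x = 0 → h x = h' x) : Lead U s m g h' := by
  obtain ⟨k, hk, hk'⟩ := hf
  exact ⟨k, hk, fun x hx => ⟨h1 x hx ▸ (hk' x hx).1, fun h0 => ((hk' x hx).2 h0).trans (h2 x hx h0)⟩⟩

theorem Lead.congr_left (hf : Lead U s m f h) (h1 : ∀ x ∈ U, f x = g x) : Lead U s m g h :=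
  hf.congr h1 fun _ _ _ => rfl

theorem Lead.congr_right (hf : Lead U s m f h) (h2 : ∀ x ∈ U, s x = 0 → h x = h' x) :
    Lead U s m f h' :=
  hf.congr (fun _ _ => rfl) h2

theorem Lead.of_smooth (hf : ContDiffOn ℝ ∞ f U) : Lead U s 0 f f :=
  ⟨f, hf, fun x _ => ⟨by simp, fun _ => rfl⟩⟩

theorem Lead.zero (m : ℕ) : Lead U s m (fun _ => 0) (fun _ => 0) :=
  ⟨fun _ => 0, contDiffOn_const, fun x _ => ⟨by simp, fun _ => rfl⟩⟩

theorem Lead.add {f' h' : Coord d → ℝ} (hf : Lead U s m f h) (hg : Lead U s m f' h') :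
    Lead U s m (fun x => f x + f' x) (fun x => h x + h' x) := by
  obtain ⟨k, hk, hk'⟩ := hf
  obtain ⟨l, hl, hl'⟩ := hg
  refine ⟨fun x => k x + l x, hk.add hl, fun x hx => ⟨?_, fun h0 => ?_⟩⟩
  · dsimp only; rw [(hk' x hx).1, (hl' x hx).1]; ring
  · change k x + l x = _
    rw [(hk' x hx).2 h0, (hl' x hx).2 h0]

theorem Lead.smooth_mul {c : Coord d → ℝ} (hc : ContDiffOn ℝ ∞ c U) (hf : Lead U s m f h) :
    Lead U s m (fun x => c x * f x) (fun x => c x * h x) := by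
  obtain ⟨k, hk, hk'⟩ := hf
  refine ⟨fun x => c x * k x, hc.mul hk, fun x hx => ⟨?_, fun h0 => ?_⟩⟩
  · dsimp only; rw [(hk' x hx).1]; ring
  · change c x * k x = _
    rw [(hk' x hx).2 h0]

theorem Lead.mul_smooth {c : Coord d → ℝ} (hf : Lead U s m f h) (hc : ContDiffOn ℝ ∞ c U) :
    Lead U s m (fun x => f x * c x) (fun x => h x * c x) := by
  simpa only [mul_comm] using hf.smooth_mul hc

theorem Lead.const_mul (c : ℝ) (hf : Lead U s m f h) :
    Lead U s m (fun x => c * f x) (fun x => c * h x) := hf.smooth_mul contDiffOn_const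

theorem Lead.neg (hf : Lead U s m f h) : Lead U s m (fun x => -f x) (fun x => -h x) :=
  (hf.const_mul (-1)).congr (fun _ _ => by ring) fun _ _ _ => by ring

theorem Lead.sub {f' h' : Coord d → ℝ} (hf : Lead U s m f h) (hg : Lead U s m f' h') :
    Lead U s m (fun x => f x - f' x) (fun x => h x - h' x) :=
  (hf.add hg.neg).congr (fun _ _ => by ring) fun _ _ _ => by ring

theorem Lead.sum {κ : Type*} {t : Finset κ} {f h : κ → Coord d → ℝ}
    (hf : ∀ i ∈ t, Lead U s m (f i) (h i)) :
    Lead U s m (fun x => ∑ i ∈ t, f i x) (fun x => ∑ i ∈ t, h i x) := by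
  classical
  induction t using Finset.induction_on with
  | empty => simpa using Lead.zero m
  | insert a t ha ih =>
    simp only [Finset.sum_insert ha]
    exact (hf a (Finset.mem_insert_self a t)).add
      (ih fun i hi => hf i (Finset.mem_insert_of_mem hi))

theorem Lead.eq_zero (hf : Lead U s (m + 1) f h) {x : Coord d} (hx : x ∈ U) (h0 : s x = 0) :
    f x = 0 := by
  obtain ⟨k, -, hk'⟩ := hf
  rw [(hk' x hx).1, h0]; simp

theorem Lead.eq_of_zero (hf : Lead U s 0 f h) {x : Coord d} (hx : x ∈ U) (h0 : s x = 0) :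
    f x = h x := by
  obtain ⟨k, -, hk'⟩ := hf
  rw [(hk' x hx).1, (hk' x hx).2 h0]; simp

variable (hs : IsDefiningOn U s)
include hs

theorem Lead.smooth (hf : Lead U s m f h) : ContDiffOn ℝ ∞ f U := by
  obtain ⟨k, hk, hk'⟩ := hf
  exact ((hs.smooth.pow m).mul hk).congr fun x hx => (hk' x hx).1

theorem Lead.s_mul (hf : Lead U s m f h) : Lead U s m (fun x => s x * f x) (fun _ => 0) :=
  (hf.smooth_mul hs.smooth).congr_right fun x _ h0 => by rw [h0, zero_mul]

omit hs in
theorem Lead.s_mul_succ (hf : Lead U s m f h) : Lead U s (m + 1) (fun x => s x * f x) h := by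
  obtain ⟨k, hk, hk'⟩ := hf
  exact ⟨k, hk, fun x hx => ⟨by dsimp only; rw [(hk' x hx).1]; ring, (hk' x hx).2⟩⟩

theorem Lead.weaken {n : ℕ} (hf : Lead U s n f h) (hmn : m < n) : Lead U s m f (fun _ => 0) := by
  obtain ⟨k, hk, hk'⟩ := hf
  obtain ⟨l, rfl⟩ := Nat.exists_eq_add_of_lt hmn
  refine ⟨fun x => s x ^ (l + 1) * k x, (hs.smooth.pow _).mul hk, fun x hx => ⟨?_, fun h0 => ?_⟩⟩
  · rw [(hk' x hx).1]; ring
  · simp [h0]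

theorem pd_pow_mul {k : Coord d → ℝ} (hk : ContDiffOn ℝ ∞ k U) {x : Coord d} (hx : x ∈ U)
    (m : ℕ) (i : Fin d) : pd i (fun y => s y ^ (m + 1) * k y) x
      = s x ^ m * ((m + 1) * pd i s x * k x + s x * pd i k x) := by
  have h1 := differentiableAt_of_smooth hs.isOpen hs.smooth hx
  have h2 := differentiableAt_of_smooth hs.isOpen hk hx
  have h3 : pd i (fun y => s y ^ (m + 1)) x = (m + 1) * s x ^ m * pd i s x := by
    simp only [pd]
    rw [fderiv_fun_pow _ h1]
    simp [mul_assoc]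
  rw [pd_mul i (h1.fun_pow (m + 1)) h2, h3]
  ring

theorem Lead.pd (hf : Lead U s (m + 1) f h) (i : Fin d) :
    Lead U s m (ConfHyp.pd i f) (fun x => (m + 1) * ConfHyp.pd i s x * h x) := by
  obtain ⟨k, hk, hk'⟩ := hf
  refine ⟨fun x => (m + 1) * ConfHyp.pd i s x * k x + s x * ConfHyp.pd i k x, ?_,
    fun x hx => ⟨?_, fun h0 => ?_⟩⟩
  · exact ((contDiffOn_const.mul (contDiffOn_pd hs.isOpen hs.smooth i)).mul hk).add
      (hs.smooth.mul (contDiffOn_pd hs.isOpen hk i))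
  · rw [pd_congr hs.isOpen (fun y hy => (hk' y hy).1) i hx, pd_pow_mul hs hk hx]
  · change _ * k x + s x * _ = _
    rw [h0, (hk' x hx).2 h0]; ring

/-- Multiplying a derivative by `s` restores the order. The factor `m` is also right for `m = 0`,
where the product is smooth and zero along the locus; the second-order terms of `𝐈𝐃` and `I·D`,
which carry a factor `s`, are treated uniformly this way. -/
theorem Lead.s_pd (hf : Lead U s m f h) (i : Fin d) :
    Lead U s m (fun x => s x * ConfHyp.pd i f x) (fun x => m * ConfHyp.pd i s x * h x) := by
  cases m with
  | zero =>
    exact ((Lead.of_smooth (contDiffOn_pd hs.isOpen (hf.smooth hs) i)).s_mul hs).congr_right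
      fun x _ _ => by simp
  | succ m => exact ((hf.pd hs i).s_mul_succ).congr_right fun x _ _ => by push_cast; ring

/-- Two smooth quotients by `s^m` agree where `s ≠ 0`, hence by continuity also at a regular zero.
Relations between leading coefficients are obtained by computing one function in two ways and
applying this. -/
theorem Lead.unique (hf : Lead U s m f h) (hg : Lead U s m f h') {x : Coord d} (hx : x ∈ U)
    (h0 : s x = 0) : h x = h' x := by
  obtain ⟨k, hk, hk'⟩ := hf
  obtain ⟨l, hl, hl'⟩ := hg
  rw [← (hk' x hx).2 h0, ← (hl' x hx).2 h0]
  refine eq_of_eventually_ne_zero (s := s) (hs.regular x hx)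
    (hk.contDiffAt (hs.isOpen.mem_nhds hx)).continuousAt
    (hl.contDiffAt (hs.isOpen.mem_nhds hx)).continuousAt ?_
  filter_upwards [hs.isOpen.mem_nhds hx] with y hy hy0
  have := (hk' y hy).1.symm.trans (hl' y hy).1
  exact mul_left_cancel₀ (pow_ne_zero m hy0) this

/-- The inductive step of every order argument: Hadamard's lemma divides the smooth quotient by one
more factor of `s`. -/
theorem Lead.succ (hf : Lead U s m f h) (h0 : ∀ x ∈ U, s x = 0 → h x = 0) :
    ∃ h', ContDiffOn ℝ ∞ h' U ∧ Lead U s (m + 1) f h' := by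
  obtain ⟨k, hk, hk'⟩ := hf
  obtain ⟨l, hl, hl'⟩ := hadamard hs.isOpen hk hs.smooth hs.regular
    fun x hx hx0 => ((hk' x hx).2 hx0).trans (h0 x hx hx0)
  refine ⟨l, hl, l, hl, fun x hx => ⟨?_, fun _ => rfl⟩⟩
  rw [(hk' x hx).1, hl' x hx]; ring

/-! ### Covariant derivatives -/

variable {G : Cov2 d} (hG : IsMetricOn U G)
include hG

/-- Only the derivative of the power of `s` reaches order `m`. The terms with Christoffel symbols
still vanish to order `m + 1`, so covariant and partial derivatives have the same leading
coefficient. -/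
theorem Lead.nabla1 {v w : Cov1 d}
    (hv : ∀ a, Lead U s (m + 1) (fun x => v x a) (fun x => w x a)) (c a : Fin d) :
    Lead U s m (fun x => nabla1 G v x c a) (fun x => (m + 1) * ConfHyp.pd c s x * w x a) := by
  have h1 := ((hv a).pd hs c).sub (Lead.sum (t := Finset.univ) fun e _ =>
    ((hv e).weaken hs (Nat.lt_succ_self m)).smooth_mul (hG.christ_smooth e c a))
  exact h1.congr_right fun x _ _ => by simp

theorem Lead.s_nabla1 {v w : Cov1 d}
    (hv : ∀ a, Lead U s m (fun x => v x a) (fun x => w x a)) (c a : Fin d) :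
    Lead U s m (fun x => s x * ConfHyp.nabla1 G v x c a)
      (fun x => m * ConfHyp.pd c s x * w x a) := by
  have h1 := ((hv a).s_pd hs c).sub (Lead.sum (t := Finset.univ) fun e _ =>
    ((hv e).s_mul hs).smooth_mul (hG.christ_smooth e c a))
  refine h1.congr (fun x _ => ?_) fun x _ _ => by simp
  simp only [ConfHyp.nabla1, mul_sub, Finset.mul_sum]
  congr 1
  exact Finset.sum_congr rfl fun e _ => by ring

theorem Lead.nabla2 {t F : Cov2 d}
    (ht : ∀ a b, Lead U s (m + 1) (fun x => t x a b) (fun x => F x a b)) (c a b : Fin d) :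
    Lead U s m (fun x => ConfHyp.nabla2 G t x c a b)
      (fun x => (m + 1) * ConfHyp.pd c s x * F x a b) := by
  have h0 := fun a b => (ht a b).weaken hs (Nat.lt_succ_self m)
  have h1 := ((ht a b).pd hs c).sub (Lead.sum (t := Finset.univ) fun e _ =>
    ((h0 e b).smooth_mul (hG.christ_smooth e c a)).add
      ((h0 a e).smooth_mul (hG.christ_smooth e c b)))
  exact h1.congr_right fun x _ _ => by simp

theorem Lead.s_nabla2 {t F : Cov2 d}
    (ht : ∀ a b, Lead U s m (fun x => t x a b) (fun x => F x a b)) (c a b : Fin d) :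
    Lead U s m (fun x => s x * ConfHyp.nabla2 G t x c a b)
      (fun x => m * ConfHyp.pd c s x * F x a b) := by
  have h0 := fun a b => (ht a b).s_mul hs
  have h1 := ((ht a b).s_pd hs c).sub (Lead.sum (t := Finset.univ) fun e _ =>
    ((h0 e b).smooth_mul (hG.christ_smooth e c a)).add
      ((h0 a e).smooth_mul (hG.christ_smooth e c b)))
  refine h1.congr (fun x _ => ?_) fun x _ _ => by simp
  simp only [ConfHyp.nabla2, mul_sub, Finset.mul_sum]
  congr 1
  exact Finset.sum_congr rfl fun e _ => by ring

theorem Lead.s_nabla3 {t F : Cov3 d}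
    (ht : ∀ c a b, Lead U s m (fun x => t x c a b) (fun x => F x c a b)) (f c a b : Fin d) :
    Lead U s m (fun x => s x * nabla3 G t x f c a b)
      (fun x => m * ConfHyp.pd f s x * F x c a b) := by
  have h0 := fun c a b => (ht c a b).s_mul hs
  have h1 := ((ht c a b).s_pd hs f).sub (Lead.sum (t := Finset.univ) fun e _ =>
    (((h0 e a b).smooth_mul (hG.christ_smooth e f c)).add
      ((h0 c e b).smooth_mul (hG.christ_smooth e f a))).add
      ((h0 c a e).smooth_mul (hG.christ_smooth e f b)))
  refine h1.congr (fun x _ => ?_) fun x _ _ => by simp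
  simp only [nabla3, mul_sub, Finset.mul_sum]
  congr 1
  exact Finset.sum_congr rfl fun e _ => by ring

omit hs in
theorem Lead.trace {t F : Cov2 d}
    (ht : ∀ a b, Lead U s m (fun x => t x a b) (fun x => F x a b)) :
    Lead U s m (fun x => ConfHyp.trace G t x) (fun x => ConfHyp.trace G F x) :=
  Lead.sum fun a _ => Lead.sum fun b _ => (ht a b).smooth_mul (hG.ginv_smooth a b)

omit hs in
theorem Lead.symTf {t F : Cov2 d}
    (ht : ∀ a b, Lead U s m (fun x => t x a b) (fun x => F x a b)) (a b : Fin d) :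
    Lead U s m (fun x => ConfHyp.symTf G t x a b) (fun x => ConfHyp.symTf G F x a b) := by
  have h1 := (((ht a b).add (ht b a)).const_mul (1 / 2)).sub
    (((Lead.trace hG ht).const_mul (1 / (d : ℝ))).mul_smooth (hG.smooth a b))
  refine h1.congr (fun x _ => ?_) fun x _ _ => ?_ <;> simp only [ConfHyp.symTf] <;> ring

omit hs in
theorem Lead.raise {v w : Cov1 d} (hv : ∀ a, Lead U s m (fun x => v x a) (fun x => w x a))
    (a : Fin d) : Lead U s m (fun x => ConfHyp.raise G v x a) (fun x => ConfHyp.raise G w x a) :=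
  Lead.sum fun b _ => (hv b).smooth_mul (hG.ginv_smooth a b)

omit hs in
/-- Contraction of the last index of a covariant derivative. -/
theorem Lead.contract_raise {v : Cov1 d} (hv : ∀ a, ContDiffOn ℝ ∞ (fun x => v x a) U)
    {t F : Fin d → Coord d → ℝ} (ht : ∀ c, Lead U s m (t c) (F c)) :
    Lead U s m (fun x => ∑ c, ConfHyp.raise G v x c * t c x)
      (fun x => ∑ c, ConfHyp.raise G v x c * F c x) :=
  Lead.sum fun c _ => (ht c).smooth_mul
    (ContDiffOn.sum fun b _ => (hG.ginv_smooth c b).mul (hv b))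

/-- The contraction of the gradient of `s` with a tensor. -/
def gradContract (G : Cov2 d) (s : Coord d → ℝ) (F : Cov2 d) : Cov1 d := fun x b =>
  ∑ a, ∑ c, ginv G x a c * (pd a s x * F x c b)

theorem Lead.div2 {t F : Cov2 d}
    (ht : ∀ a b, Lead U s (m + 1) (fun x => t x a b) (fun x => F x a b)) (b : Fin d) :
    Lead U s m (fun x => ConfHyp.div2 G t x b) (fun x => (m + 1) * gradContract G s F x b) := by
  have h1 := Lead.sum (t := Finset.univ) fun a _ => Lead.sum (t := Finset.univ) fun c _ =>
    (Lead.nabla2 hs hG ht a c b).smooth_mul (hG.ginv_smooth a c)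
  refine h1.congr_right fun x _ _ => ?_
  simp only [gradContract, Finset.mul_sum]
  exact Finset.sum_congr rfl fun a _ => Finset.sum_congr rfl fun c _ => by ring

theorem Lead.s_div2 {t F : Cov2 d}
    (ht : ∀ a b, Lead U s m (fun x => t x a b) (fun x => F x a b)) (b : Fin d) :
    Lead U s m (fun x => s x * ConfHyp.div2 G t x b) (fun x => m * gradContract G s F x b) := by
  have h1 := Lead.sum (t := Finset.univ) fun a _ => Lead.sum (t := Finset.univ) fun c _ =>
    (Lead.s_nabla2 hs hG ht a c b).smooth_mul (hG.ginv_smooth a c)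
  refine h1.congr (fun x _ => ?_) fun x _ _ => ?_
  · simp only [ConfHyp.div2, Finset.mul_sum]
    exact Finset.sum_congr rfl fun a _ => Finset.sum_congr rfl fun c _ => by ring
  · simp only [gradContract, Finset.mul_sum]
    exact Finset.sum_congr rfl fun a _ => Finset.sum_congr rfl fun c _ => by ring

end Lead

end ConfHyp

end

noncomputable section

namespace ConfHyp

/-! ## Identities for the scale tractor -/

section Scale

variable {d : ℕ} {U : Set (Coord d)} {G : Cov2 d} {s : Coord d → ℝ}

/-- The one-form `∇_a ρ - P_{ab} n^b`. -/
def slotOne (G : Cov2 d) (s : Coord d → ℝ) : Cov1 d := fun x i =>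
  pd i (rho G s) x - ∑ j, schouten G x i j * raise G (grad s) x j

/-- The Ricci matrix is built from the connection alone. Thus the identification of Christoffel
symbols suffices to transfer the algebraic conformal formula to a concrete metric. -/
theorem LeviCivita.Ric_congr {A : Type*} [CommRing A] [Algebra ℝ A] {ι : Type*} [Fintype ι]
    [DecidableEq ι] {D : ι → Derivation ℝ A A} {L L' : LeviCivita D}
    (h : ∀ i k j, L.Γ i k j = L'.Γ i k j) : L.Ric = L'.Ric := by
  have hΓ : L.Γ = L'.Γ := by
    funext i
    exact Matrix.ext fun k j => h i k j
  simp only [LeviCivita.Ric, LeviCivita.R, hΓ]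

namespace IsMetricOn

variable (hG : IsMetricOn U G)
include hG

theorem ginv_symm {x : Coord d} (hx : x ∈ U) (i j : Fin d) : ginv G x i j = ginv G x j i := by
  rw [← hG.ev_gi ⟨x, hx⟩, hG.lc.gi_symm_apply, hG.ev_gi]

variable (hd : 3 ≤ d) (hs : ContDiffOn ℝ ∞ s U)

/-- The trace of the Schouten tensor in the algebra of smooth functions. -/
def elJ : smoothAlg U := (2 * ((d : ℝ) - 1))⁻¹ • hG.lc.Sc

/-- The Schouten tensor in the algebra of smooth functions. -/
def elP : Matrix (Fin d) (Fin d) (smoothAlg U) :=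
  ((d : ℝ) - 2)⁻¹ • (hG.lc.Ric - hG.elJ • hG.lc.G)

/-- The function `ρ` in the algebra of smooth functions. -/
def elρ : smoothAlg U := (d : ℝ)⁻¹ •
  -((hG.lc.gi * hG.lc.cd1 fun i => smoothAlg.D hG.isOpen i (smoothAlg.res s hs)).trace
    + hG.elJ * smoothAlg.res s hs)

/-- The extension of the second fundamental form in the algebra of smooth functions. -/
def elE : Matrix (Fin d) (Fin d) (smoothAlg U) :=
  (hG.lc.cd1 fun i => smoothAlg.D hG.isOpen i (smoothAlg.res s hs))
    + smoothAlg.res s hs • hG.elP + hG.elρ hs • hG.lc.G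

include hd in
theorem isScale : hG.lc.IsScale d (smoothAlg.res s hs) hG.elJ (hG.elρ hs) hG.elP (hG.elE hs) := by
  have h3 : (3 : ℝ) ≤ d := by exact_mod_cast hd
  refine ⟨by simp, by linarith, ?_, ?_, ?_, rfl⟩
  · rw [elP, smul_smul, mul_inv_cancel₀ (by linarith), one_smul]
  · rw [elJ, smul_smul, mul_inv_cancel₀ (by nlinarith), one_smul]
  · rw [elρ, smul_smul, mul_inv_cancel₀ (by linarith), one_smul]

omit hd

theorem ev_J (x : U) : smoothAlg.ev x hG.elJ = schoutenJ G x := by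
  rw [elJ, map_smul, hG.ev_Sc, schoutenJ, smul_eq_mul, div_eq_inv_mul]

theorem ev_P (x : U) (i j : Fin d) : smoothAlg.ev x (hG.elP i j) = schouten G x i j := by
  rw [elP, Matrix.smul_apply, map_smul, Matrix.sub_apply, map_sub, hG.ev_Ric, Matrix.smul_apply,
    smul_eq_mul, smul_eq_mul, map_mul, hG.ev_J, hG.ev_G, schouten, div_eq_inv_mul]

theorem ev_hess (x : U) (i j : Fin d) :
    smoothAlg.ev x (hG.lc.cd1 (fun i => smoothAlg.D hG.isOpen i (smoothAlg.res s hs)) i j)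
      = nabla1 G (grad s) x i j :=
  hG.ev_cd1 x _ (grad s) (fun x i => by rw [smoothAlg.ev_D_res]; rfl) i j

theorem ev_ρ (x : U) : smoothAlg.ev x (hG.elρ hs) = rho G s x := by
  rw [elρ, map_smul, map_neg, map_add, map_mul, hG.ev_J, smoothAlg.ev_res,
    hG.ev_trace x _ (nabla1 G (grad s)) (hG.ev_hess hs x), rho, smul_eq_mul, div_eq_inv_mul]

theorem ev_E (x : U) (i j : Fin d) : smoothAlg.ev x (hG.elE hs i j) = secondFFExt G s x i j := by
  rw [elE, Matrix.add_apply, Matrix.add_apply, map_add, map_add, hG.ev_hess, Matrix.smul_apply,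
    Matrix.smul_apply, smul_eq_mul, smul_eq_mul, map_mul, map_mul, hG.ev_P, hG.ev_ρ, hG.ev_G]
  rfl

theorem schoutenJ_smooth : ContDiffOn ℝ ∞ (schoutenJ G) U := smoothAlg.smooth_of_ev hG.ev_J

theorem schouten_smooth (i j : Fin d) : ContDiffOn ℝ ∞ (fun x => schouten G x i j) U :=
  smoothAlg.smooth_of_ev fun x => hG.ev_P x i j

include hs in
theorem rho_smooth : ContDiffOn ℝ ∞ (rho G s) U := smoothAlg.smooth_of_ev (hG.ev_ρ hs)

include hs in
theorem secondFFExt_smooth (i j : Fin d) : ContDiffOn ℝ ∞ (fun x => secondFFExt G s x i j) U :=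
  smoothAlg.smooth_of_ev fun x => hG.ev_E hs x i j

include hs in
theorem grad_smooth (i : Fin d) : ContDiffOn ℝ ∞ (fun x => grad s x i) U :=
  contDiffOn_pd hG.isOpen hs i

theorem raise_smooth {v : Cov1 d} (hv : ∀ a, ContDiffOn ℝ ∞ (fun x => v x a) U) (a : Fin d) :
    ContDiffOn ℝ ∞ (fun x => raise G v x a) U :=
  ContDiffOn.sum fun b _ => (hG.ginv_smooth a b).mul (hv b)

include hs in
theorem hess_smooth (i j : Fin d) : ContDiffOn ℝ ∞ (fun x => nabla1 G (grad s) x i j) U :=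
  smoothAlg.smooth_of_ev fun x => hG.ev_hess hs x i j

include hs in
theorem scaleTractorSq_smooth : ContDiffOn ℝ ∞ (scaleTractorSq G s) U :=
  (ContDiffOn.sum fun a _ => (hG.grad_smooth hs a).mul
    (hG.raise_smooth (hG.grad_smooth hs) a)).add
    ((contDiffOn_const.mul hs).mul (hG.rho_smooth hs))

include hd in
theorem schouten_symm {x : Coord d} (hx : x ∈ U) (i j : Fin d) :
    schouten G x i j = schouten G x j i := by
  have := (hG.isScale hd (s := fun _ => 0) contDiffOn_const).P_symm
  rw [← hG.ev_P ⟨x, hx⟩, ← hG.ev_P ⟨x, hx⟩, ← congrFun (congrFun this i) j,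
    Matrix.transpose_apply]

include hd hs in
theorem secondFFExt_symm {x : Coord d} (hx : x ∈ U) (i j : Fin d) :
    secondFFExt G s x i j = secondFFExt G s x j i := by
  have := (hG.isScale hd hs).E_symm
  rw [← hG.ev_E hs ⟨x, hx⟩, ← hG.ev_E hs ⟨x, hx⟩, ← congrFun (congrFun this i) j,
    Matrix.transpose_apply]

include hd hs in
theorem trace_secondFFExt {x : Coord d} (hx : x ∈ U) : trace G (secondFFExt G s) x = 0 := by
  rw [← hG.ev_trace ⟨x, hx⟩ _ _ (hG.ev_E hs ⟨x, hx⟩), (hG.isScale hd hs).trace_E, map_zero]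

include hd in
theorem ev_slotP (x : U) (b : Fin d) :
    smoothAlg.ev x (hG.lc.slotP (smoothAlg.res s hs) (hG.elρ hs) hG.elP b) = slotOne G s x b := by
  simp only [LeviCivita.slotP, map_sub, map_sum, map_mul, Matrix.mul_apply, smoothAlg.ev_D_res,
    hG.ev_gi, hG.ev_P, slotOne, smoothAlg.ev_D_of hG.isOpen (hG.ev_ρ hs)]
  congr 1
  simp only [raise, Finset.mul_sum, grad]
  rw [Finset.sum_comm]
  refine Finset.sum_congr rfl fun c _ => Finset.sum_congr rfl fun a _ => ?_
  rw [hG.ginv_symm x.2 c a, hG.schouten_symm hd x.2 b c]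
  ring

include hd hs in
/-- The divergence of the canonical extension of the second fundamental form. -/
theorem sub_one_mul_slotOne {x : Coord d} (hx : x ∈ U) (b : Fin d) :
    ((d : ℝ) - 1) * slotOne G s x b = -div2 G (secondFFExt G s) x b := by
  have h := congrArg (smoothAlg.ev ⟨x, hx⟩) ((hG.isScale hd hs).div_E b)
  rw [map_smul, map_neg, hG.ev_slotP hd, hG.ev_div ⟨x, hx⟩ _ _ (hG.ev_E hs)] at h
  exact h

include hd hs in
/-- The derivative of the squared length of the scale tractor. -/
theorem pd_scaleTractorSq {x : Coord d} (hx : x ∈ U) (a : Fin d) :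
    pd a (scaleTractorSq G s) x
      = 2 * ∑ b, secondFFExt G s x a b * raise G (grad s) x b
        + 2 * s x * slotOne G s x a := by
  have h := congrArg (smoothAlg.ev ⟨x, hx⟩) ((hG.isScale hd hs).deriv_sq a)
  rw [smoothAlg.ev_D_of hG.isOpen (f := scaleTractorSq G s)] at h
  · rw [h]
    simp only [map_add, map_mul, map_sum, hG.ev_E, hG.ev_gi, smoothAlg.ev_D_res,
      hG.ev_slotP hd, smoothAlg.ev_res, map_ofNat]
    rfl
  · intro y
    simp only [map_add, map_mul, map_sum, hG.ev_gi, smoothAlg.ev_D_res,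
      hG.ev_ρ, smoothAlg.ev_res, map_ofNat]
    rfl

include hs in
/-- The divergence of the contraction of a tensor with the gradient. -/
theorem trace_nabla1_contract {t : Cov2 d} (ht : ∀ a b, ContDiffOn ℝ ∞ (fun x => t x a b) U)
    (hts : ∀ x ∈ U, ∀ a b, t x a b = t x b a) {x : Coord d} (hx : x ∈ U) :
    trace G (nabla1 G fun x a => ∑ b, t x a b * raise G (grad s) x b) x
      = ∑ b, raise G (grad s) x b * div2 G t x b
        + trace G (contract G (nabla1 G (grad s)) t) x := by
  let T : Matrix (Fin d) (Fin d) (smoothAlg U) := Matrix.of fun a b => smoothAlg.res _ (ht a b)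
  have hT : ∀ (x : U) a b, smoothAlg.ev x (T a b) = t x a b := fun _ _ _ => rfl
  have h := congrArg (smoothAlg.ev ⟨x, hx⟩) (hG.lc.div1_contract (smoothAlg.res s hs) T)
  rw [LeviCivita.div1, hG.ev_trace ⟨x, hx⟩ _
    (nabla1 G fun x a => ∑ b, t x a b * raise G (grad s) x b)] at h
  · rw [h, map_add]
    congr 1
    · simp only [map_sum, map_mul, hG.ev_gi, smoothAlg.ev_D_res, hG.ev_div ⟨x, hx⟩ T t hT]
      rfl
    · rw [Matrix.mul_assoc, Matrix.mul_assoc, hG.ev_trace ⟨x, hx⟩]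
      intro i j
      simp only [Matrix.mul_apply, map_sum, map_mul, hG.ev_hess, hG.ev_gi,
        Matrix.transpose_apply, hT, contract, Finset.mul_sum]
      refine Finset.sum_congr rfl fun a _ => Finset.sum_congr rfl fun b _ => ?_
      rw [hts x hx j b]; ring
  · intro i j
    refine hG.ev_cd1 ⟨x, hx⟩ _ _ (fun y a => ?_) i j
    simp only [map_sum, map_mul, hG.ev_gi, smoothAlg.ev_D_res, hT]
    rfl

theorem trace_self {x : Coord d} (hx : x ∈ U) : trace G G x = d := by
  have : ∀ a, ∑ b, ginv G x a b * G x a b = 1 := by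
    intro a
    have h := hG.ginv_mul hx a a
    rw [if_pos rfl] at h
    rw [← h]
    exact Finset.sum_congr rfl fun b _ => by rw [hG.symm x hx a b]
  simp [trace, this]

/-- The derivative of the inverse metric, contracted with a one-form. -/
theorem pd_raise {v : Cov1 d} (hv : ∀ a, ContDiffOn ℝ ∞ (fun x => v x a) U) {x : Coord d}
    (hx : x ∈ U) (i k : Fin d) :
    pd i (fun y => raise G v y k) x + ∑ j, christ G k i j x * raise G v x j
      = ∑ l, ginv G x k l * nabla1 G v x i l := by
  let w : Fin d → smoothAlg U := fun a => smoothAlg.res _ (hv a)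
  let W : Matrix (Fin d) Unit (smoothAlg U) := Matrix.of fun j _ => w j
  have h1 : dmat (smoothAlg.D hG.isOpen i) (hG.lc.gi * W) + hG.lc.Γ i * (hG.lc.gi * W)
      = hG.lc.gi * (dmat (smoothAlg.D hG.isOpen i) W - (hG.lc.Γ i).transpose * W) := by
    simp only [dmat_mul, hG.lc.dmat_gi, Matrix.mul_sub, Matrix.add_mul,
      Matrix.neg_mul, Matrix.mul_assoc]
    abel
  have h2 := congrArg (smoothAlg.ev ⟨x, hx⟩) (congrFun (congrFun h1 k) ())
  have hw : ∀ (x : U) a, smoothAlg.ev x (w a) = v x a := fun _ _ => rfl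
  have hr : ∀ x : U, smoothAlg.ev x (∑ l, hG.lc.gi k l * w l) = raise G v x k := by
    intro x
    simp only [map_sum, map_mul, hG.ev_gi, hw]; rfl
  simp only [Matrix.add_apply, Matrix.mul_apply, dmat_apply, map_add, map_sum, map_mul,
    hG.ev_Γ, hG.ev_gi, Matrix.sub_apply, map_sub, Matrix.transpose_apply, W, Matrix.of_apply,
    hw] at h2
  simp only [nabla1]
  have h4 := smoothAlg.ev_D_of hG.isOpen (f := fun y => raise G v y k) hr i ⟨x, hx⟩
  simp only [map_sum] at h4
  rw [h4] at h2
  have h5 : ∀ a, smoothAlg.ev ⟨x, hx⟩ (smoothAlg.D hG.isOpen i (w a)) = pd i (fun y => v y a) x :=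
    fun a => smoothAlg.ev_D_res hG.isOpen i _ (hv a) ⟨x, hx⟩
  simp only [h5] at h2
  exact h2

end IsMetricOn

/-! ### Conformal change of the metric -/

theorem symTf_add_smul (hG : IsMetricOn U G) (hd0 : (d : ℝ) ≠ 0) {t u : Cov2 d} {x : Coord d}
    (hx : x ∈ U) (c f : ℝ) (htu : ∀ a b, t x a b = c * u x a b + f * G x a b) (a b : Fin d) :
    symTf G t x a b = c * symTf G u x a b := by
  have h1 : trace G t x = c * trace G u x + f * d := by
    rw [← hG.trace_self hx]
    simp only [trace, htu, mul_add, Finset.sum_add_distrib, Finset.mul_sum]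
    congr 1 <;> exact Finset.sum_congr rfl fun a _ => Finset.sum_congr rfl fun b _ => by ring
  simp only [symTf, h1, htu, hG.symm x hx b a]
  field_simp
  ring

theorem ginv_smul {x : Coord d} {G' : Cov2 d} {r : ℝ} (hr : r ≠ 0) (hdet : IsUnit (Matrix.of (G x)).det)
    (hG' : ∀ i j, G' x i j = r⁻¹ * G x i j) (i j : Fin d) : ginv G' x i j = r * ginv G x i j := by
  have h : (Matrix.of (G' x))⁻¹ = r • (Matrix.of (G x))⁻¹ := by
    apply Matrix.inv_eq_right_inv
    have : Matrix.of (G' x) = r⁻¹ • Matrix.of (G x) := by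
      ext i j; simp [hG']
    rw [this, Matrix.smul_mul, Matrix.mul_smul, Matrix.mul_nonsing_inv _ hdet, smul_smul,
      inv_mul_cancel₀ hr, one_smul]
  rw [ginv, h]; rfl

theorem symTf_smul_metric {x : Coord d} {G' : Cov2 d} {r : ℝ} (hr : r ≠ 0)
    (hdet : IsUnit (Matrix.of (G x)).det) (hG' : ∀ i j, G' x i j = r⁻¹ * G x i j) (t : Cov2 d)
    (a b : Fin d) : symTf G' t x a b = symTf G t x a b := by
  have h1 : trace G' t x = r * trace G t x := by
    simp only [trace, ginv_smul hr hdet hG', Finset.mul_sum]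
    exact Finset.sum_congr rfl fun a _ => Finset.sum_congr rfl fun b _ => by ring
  simp only [symTf, h1, hG']
  field_simp

/-- The trace-free Schouten tensor of `s⁻² g`. -/
theorem symTf_schouten_singular (hG : IsMetricOn U G) (hd : 3 ≤ d) (hs : ContDiffOn ℝ ∞ s U)
    (h0 : ∀ x ∈ U, s x ≠ 0) {G' : Cov2 d} (hG' : ∀ x ∈ U, ∀ i j, G' x i j = (s x ^ 2)⁻¹ * G x i j)
    {x : Coord d} (hx : x ∈ U) (a b : Fin d) :
    symTf G' (schouten G') x a b = (s x)⁻¹ * secondFFExt G s x a b := by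
  have h3 : (3 : ℝ) ≤ d := by exact_mod_cast hd
  have hM : IsMetricOn U G' :=
    { isOpen := hG.isOpen
      smooth := fun i j => ((ContDiffOn.inv (hs.pow 2) fun x hx => pow_ne_zero 2 (h0 x hx)).mul
        (hG.smooth i j)).congr fun x hx => hG' x hx i j
      symm := fun x hx i j => by rw [hG' x hx, hG' x hx, hG.symm x hx]
      det := fun x hx => by
        have : Matrix.of (G' x) = (s x ^ 2)⁻¹ • Matrix.of (G x) := by
          ext i j; simp [hG' x hx]
        rw [this, Matrix.det_smul]
        exact (IsUnit.mk0 _ (pow_ne_zero _ (inv_ne_zero (pow_ne_zero 2 (h0 x hx))))).mul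
          (hG.det x hx) }
  let r : smoothAlg U := smoothAlg.res (fun x => (s x)⁻¹) (hs.inv h0)
  have hr : r * smoothAlg.res s hs = 1 := smoothAlg.ext_ev fun x => by
    rw [map_mul, map_one]
    exact inv_mul_cancel₀ (h0 x x.2)
  let L := hG.lc.conformal (smoothAlg.res s hs) r hr
  have hLG : ∀ (x : U) i j, smoothAlg.ev x (L.G i j) = G' x i j := by
    intro x i j
    change smoothAlg.ev x (r * r * hG.lc.G i j) = _
    rw [map_mul, map_mul, hG' x x.2]
    change (s x)⁻¹ * (s x)⁻¹ * G x i j = _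
    congr 1
    rw [pow_two, mul_inv]
  -- The algebraic connection of `s⁻²g` is torsion-free and compatible with the components of `G'`,
  -- so it consists of the Christoffel symbols of `G'`.
  have hΓ : ∀ i k j, hM.lc.Γ i k j = L.Γ i k j := by
    intro i k j
    refine smoothAlg.ext_ev fun x => ?_
    rw [hM.ev_Γ]
    refine hM.christ_unique x.2 (Γ := fun k i j => smoothAlg.ev x (L.Γ i k j))
      (fun k i j => by rw [L.torsion]) (fun i j k => ?_) k i j
    have h1 := congrArg (smoothAlg.ev x) (congrFun (congrFun (L.compat i) j) k)
    rw [dmat_apply, smoothAlg.ev_D_of hG.isOpen (f := fun y => G' y j k) (fun x => hLG x j k)] at h1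
    rw [h1]
    simp only [Matrix.add_apply, Matrix.mul_apply, Matrix.transpose_apply, map_add, map_sum,
      map_mul, hLG]
  obtain ⟨f, hf⟩ := hG.lc.conformal_Ric (smoothAlg.res s hs) r hr
  rw [← LeviCivita.Ric_congr hΓ] at hf
  have hric : ∀ i j, ricci G' x i j = ricci G x i j
      + ((d : ℝ) - 2) * ((s x)⁻¹ * nabla1 G (grad s) x i j)
      + smoothAlg.ev ⟨x, hx⟩ f * G x i j := by
    intro i j
    have := congrArg (smoothAlg.ev ⟨x, hx⟩) (congrFun (congrFun hf i) j)
    rw [hM.ev_Ric] at this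
    rw [this]
    simp only [Matrix.add_apply, Matrix.smul_apply, smul_eq_mul, map_add, map_mul, map_sub,
      hG.ev_Ric, hG.ev_hess, hG.ev_G, map_natCast, map_ofNat, Fintype.card_fin]
    rfl
  have hsx := h0 x hx
  rw [symTf_smul_metric (pow_ne_zero 2 hsx) (hG.det x hx) (hG' x hx)]
  -- The Ricci tensor changes by `(d-2) s⁻¹ ∇∇s` modulo the metric. After division by `d - 2` the
  -- new Schouten tensor is `P + s⁻¹ ∇∇s`, that is `s⁻¹E`, up to a multiple of `G`; the long
  -- coefficient collects these multiples, and the trace-free part discards them.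
  have key := symTf_add_smul hG (by linarith) (t := schouten G') (u := secondFFExt G s) hx (s x)⁻¹
    ((smoothAlg.ev ⟨x, hx⟩ f + schoutenJ G x - schoutenJ G' x * (s x ^ 2)⁻¹) / ((d : ℝ) - 2)
      - (s x)⁻¹ * rho G s x) (by
        intro i j
        have hd2 : (d : ℝ) - 2 ≠ 0 := by linarith
        simp only [schouten, hric, secondFFExt, hG' x hx]
        field_simp
        ring) a b
  rw [key]
  congr 1
  rw [symTf, hG.trace_secondFFExt hd hs hx, hG.secondFFExt_symm hd hs hx b a]
  ring

end Scale

end ConfHyp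

end

noncomputable section

namespace ConfHyp

/-! ## Canonical fundamental forms and the vanishing order of the second fundamental form -/

section Forms

variable {d : ℕ} {U V : Set (Coord d)} {G : Cov2 d} {s : Coord d → ℝ}

theorem Lead.mono {f h : Coord d → ℝ} {m : ℕ} (hf : Lead U s m f h) (hV : V ⊆ U) :
    Lead V s m f h := by
  obtain ⟨k, hk, hk'⟩ := hf
  exact ⟨k, hk.mono hV, fun x hx => hk' x (hV hx)⟩

theorem IsMetricOn.mono (hG : IsMetricOn U G) (hV : V ⊆ U) (ho : IsOpen V) : IsMetricOn V G :=
  ⟨ho, fun i j => (hG.smooth i j).mono hV, fun x hx => hG.symm x (hV hx),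
    fun x hx => hG.det x (hV hx)⟩

theorem IsDefiningOn.mono (hs : IsDefiningOn U s) (hV : V ⊆ U) (ho : IsOpen V) :
    IsDefiningOn V s :=
  ⟨ho, hs.smooth.mono hV, fun x hx => hs.regular x (hV hx)⟩

/-- A defining function that satisfies the asymptotic unit condition in coordinates, with `ds`
nowhere zero. -/
structure IsUnitOn (U : Set (Coord d)) (G : Cov2 d) (s : Coord d → ℝ) : Prop where
  three_le : 3 ≤ d
  metric : IsMetricOn U G
  defining : IsDefiningOn U s
  unit : ∃ B, Lead U s d (fun x => scaleTractorSq G s x - 1) B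
  pos : ∀ x ∈ U, 0 < ∑ a, grad s x a * raise G (grad s) x a

/-- Tangential, trace-free symmetric tensors at a point. -/
structure IsTangential (G : Cov2 d) (s : Coord d → ℝ) (x : Coord d) (T : Fin d → Fin d → ℝ) :
    Prop where
  symm : ∀ a b, T a b = T b a
  normal : ∀ a, ∑ b, T a b * raise G (grad s) x b = 0
  trace : ∑ a, ∑ b, ginv G x a b * T a b = 0

theorem gradContract_eq (hG : IsMetricOn U G) {F : Cov2 d} {x : Coord d} (hx : x ∈ U) (b : Fin d) :
    gradContract G s F x b = ∑ c, F x c b * raise G (grad s) x c := by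
  simp only [gradContract, raise, grad, Finset.mul_sum]
  rw [Finset.sum_comm]
  refine Finset.sum_congr rfl fun c _ => Finset.sum_congr rfl fun a _ => ?_
  rw [hG.ginv_symm hx a c]; ring

theorem symTf_eq_zero {t : Cov2 d} {x : Coord d} (h : ∀ a b, t x a b = 0) (a b : Fin d) :
    symTf G t x a b = 0 := by
  simp [symTf, trace, h]

theorem sum_ginv_grad (x : Coord d) :
    ∑ e, ∑ f, ginv G x e f * (pd e s x * pd f s x) = ∑ a, grad s x a * raise G (grad s) x a := by
  simp only [raise, grad, Finset.mul_sum]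
  exact Finset.sum_congr rfl fun c _ => Finset.sum_congr rfl fun a _ => by ring

namespace IsTangential

variable {x : Coord d} {T : Fin d → Fin d → ℝ}

theorem smul (h : IsTangential G s x T) (c : ℝ) : IsTangential G s x fun a b => c * T a b where
  symm a b := by rw [h.symm]
  normal a := by simp only [mul_assoc, ← Finset.mul_sum, h.normal, mul_zero]
  trace := by
    have : ∀ a b, ginv G x a b * (c * T a b) = c * (ginv G x a b * T a b) := fun a b => by ring
    simp only [this, ← Finset.mul_sum, h.trace, mul_zero]

theorem normal' (h : IsTangential G s x T) (b : Fin d) :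
    ∑ a, T a b * raise G (grad s) x a = 0 := by
  rw [← h.normal b]
  exact Finset.sum_congr rfl fun a _ => by rw [h.symm]

theorem normal_right (h : IsTangential G s x T) (b : Fin d) :
    ∑ a, raise G (grad s) x a * T a b = 0 := by
  rw [← h.normal' b]
  exact Finset.sum_congr rfl fun a _ => mul_comm _ _

end IsTangential

theorem raise_conormal (x : Coord d) (a : Fin d) : raise G (conormal G s) x a
    = raise G (grad s) x a / Real.sqrt (∑ b, grad s x b * raise G (grad s) x b) := by
  simp only [raise, conormal, Finset.sum_div, mul_div_assoc]

theorem tanProj_mul_grad {x : Coord d} (h : 0 < ∑ b, grad s x b * raise G (grad s) x b)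
    (a : Fin d) : ∑ b, tanProj G s x a b * pd b s x = 0 := by
  simp only [tanProj, sub_mul, Finset.sum_sub_distrib, ite_mul, one_mul, zero_mul,
    Finset.sum_ite_eq, Finset.mem_univ, if_true, raise_conormal, conormal]
  set N := ∑ b, grad s x b * raise G (grad s) x b with hN
  have h1 : ∑ b, grad s x a / Real.sqrt N * (raise G (grad s) x b / Real.sqrt N) * pd b s x
      = grad s x a / (Real.sqrt N * Real.sqrt N) * N := by
    have hA : ∀ A : ℝ, A * N = ∑ b, A * (grad s x b * raise G (grad s) x b) := fun A => by
      rw [hN, Finset.mul_sum]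
    rw [hA]
    refine Finset.sum_congr rfl fun b _ => ?_
    simp only [grad]; ring
  rw [h1, Real.mul_self_sqrt h.le]
  have hN0 := h.ne'
  simp only [grad]
  field_simp
  ring

/-- The projection to the tangential trace-free part fixes tangential trace-free tensors. -/
theorem topTf_of_isTangential {x : Coord d} {t : Cov2 d} {T : Fin d → Fin d → ℝ}
    (hT : IsTangential G s x T) (ht : ∀ a b, t x a b = T a b) (a b : Fin d) :
    topTf G s t x a b = T a b := by
  have hr : ∀ c, ∑ e, raise G (conormal G s) x e * T c e = 0 := by
    intro c
    simp only [raise_conormal, div_mul_eq_mul_div]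
    rw [← Finset.sum_div]
    have := hT.normal c
    simp only [mul_comm (T c _)] at this
    rw [this, zero_div]
  have h1 : ∀ b c, ∑ e, tanProj G s x b e * T c e = T c b := by
    intro b c
    simp only [tanProj, sub_mul, Finset.sum_sub_distrib, ite_mul, one_mul, zero_mul,
      Finset.sum_ite_eq, Finset.mem_univ, if_true, mul_assoc, ← Finset.mul_sum, hr, mul_zero,
      sub_zero]
  have h2 : ∀ a b, top2 G s t x a b = T a b := by
    intro a b
    simp only [top2, ht, mul_assoc, ← Finset.mul_sum, h1]
    simp only [hT.symm _ b, h1]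
  have h3 : indTrace G s t x = 0 := by
    simp only [indTrace, indInv, ht, sub_mul, Finset.sum_sub_distrib, hT.trace, mul_assoc,
      ← Finset.mul_sum, hr, mul_zero, sub_zero]
  rw [topTf, h2, h2, h3, hT.symm b a]
  ring

namespace IsUnitOn

variable (h : IsUnitOn U G s)
include h

theorem normSq_eq_one {x : Coord d} (hx : x ∈ U) (h0 : s x = 0) :
    ∑ a, grad s x a * raise G (grad s) x a = 1 := by
  obtain ⟨B, hB⟩ := h.unit
  have hd := h.three_le
  obtain ⟨e, rfl⟩ : ∃ e, d = e + 1 := ⟨d - 1, by omega⟩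
  have h1 := hB.eq_zero hx h0
  simp only [scaleTractorSq, h0, mul_zero, zero_mul, add_zero] at h1
  linarith

theorem grad_smooth (a : Fin d) : ContDiffOn ℝ ∞ (fun x => grad s x a) U :=
  h.metric.grad_smooth h.defining.smooth a

theorem raise_grad_smooth (a : Fin d) : ContDiffOn ℝ ∞ (fun x => raise G (grad s) x a) U :=
  h.metric.raise_smooth h.grad_smooth a

theorem conormal_smooth (a : Fin d) : ContDiffOn ℝ ∞ (fun x => conormal G s x a) U :=
  (h.grad_smooth a).div ((ContDiffOn.sum fun b _ =>
    (h.grad_smooth b).mul (h.raise_grad_smooth b)).sqrt fun x hx => (h.pos x hx).ne')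
    fun x hx => (Real.sqrt_pos.2 (h.pos x hx)).ne'

theorem tanProj_smooth (a b : Fin d) : ContDiffOn ℝ ∞ (fun x => tanProj G s x a b) U :=
  contDiffOn_const.sub ((h.conormal_smooth a).mul (h.metric.raise_smooth h.conormal_smooth b))

theorem raise_conormal_eq {x : Coord d} (hx : x ∈ U) (h0 : s x = 0) (a : Fin d) :
    raise G (conormal G s) x a = raise G (grad s) x a := by
  rw [raise_conormal, h.normSq_eq_one hx h0, Real.sqrt_one, div_one]

theorem lead_top1 {m : ℕ} {v w : Cov1 d} (hv : ∀ a, Lead U s m (fun x => v x a) (fun x => w x a))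
    (a : Fin d) : Lead U s m (fun x => top1 G s v x a) (fun x => top1 G s w x a) :=
  Lead.sum fun b _ => (hv b).smooth_mul (h.tanProj_smooth a b)

/-- The derivative of a one-form that vanishes along the locus is `ds ⊗ w` there, and the tangential
projection annihilates `ds`. -/
theorem indNabla_eq_zero {v w : Cov1 d} (hv : ∀ a, Lead U s 1 (fun x => v x a) (fun x => w x a))
    {x : Coord d} (hx : x ∈ U) (h0 : s x = 0) (a b : Fin d) : indNabla G s v x a b = 0 := by
  have h1 : ∀ c e, nabla1 G v x c e = pd c s x * w x e := by
    intro c e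
    have := (Lead.nabla1 h.defining h.metric (m := 0) hv c e).eq_of_zero hx h0
    simpa using this
  simp only [indNabla, top2, h1]
  have h2 : ∀ c e, tanProj G s x a c * tanProj G s x b e * (pd c s x * w x e)
      = (tanProj G s x a c * pd c s x) * (tanProj G s x b e * w x e) := fun c e => by ring
  simp only [h2, ← Finset.mul_sum, ← Finset.sum_mul, tanProj_mul_grad (h.pos x hx), zero_mul]

/-! ### The leading coefficient is tangential -/

/-- By the unit condition `E n + s(∇ρ - P n)`, half the gradient of `I²`, vanishes to order `d - 1`,
hence beyond order `k`. The second summand equals `-s div E / (d-1)`, with leading coefficient `-k F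
n / (d-1)`. The two summands therefore give a linear equation for `F n`. -/
theorem secondFFExt_normal {k : ℕ} (hk : k + 3 ≤ d) {F : Cov2 d}
    (hE : ∀ a b, Lead U s k (fun x => secondFFExt G s x a b) (fun x => F x a b))
    {x : Coord d} (hx : x ∈ U) (h0 : s x = 0) (a : Fin d) :
    ∑ b, F x a b * raise G (grad s) x b = 0 := by
  have hd3 : (3 : ℝ) ≤ d := by exact_mod_cast h.three_le
  have hG := h.metric
  have hs := h.defining
  have hsymm : ∀ x ∈ U, s x = 0 → ∀ a b, F x a b = F x b a := fun x hx h0 a b =>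
    (hE a b).unique hs ((hE b a).congr_left fun y hy =>
      hG.secondFFExt_symm h.three_le hs.smooth hy b a) hx h0
  obtain ⟨B, hB⟩ := h.unit
  -- the derivative of the squared length of the scale tractor vanishes to high order
  have h1 : Lead U s k (fun x => (1 / 2) * pd a (scaleTractorSq G s) x) (fun _ => 0) := by
    obtain ⟨e, rfl⟩ : ∃ e, d = e + 1 := ⟨d - 1, by omega⟩
    refine (((hB.pd hs a).weaken hs (m := k) (by omega)).const_mul (1 / 2)).congr
      (fun y hy => ?_) fun _ _ _ => by simp
    congr 1
    have hd' := differentiableAt_of_smooth hs.isOpen (hG.scaleTractorSq_smooth hs.smooth) hy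
    simp only [pd]
    rw [fderiv_sub_const]
  have h2 : Lead U s k (fun x => ∑ b, secondFFExt G s x a b * raise G (grad s) x b)
      (fun x => ∑ b, F x a b * raise G (grad s) x b) :=
    Lead.sum fun b _ => (hE a b).mul_smooth (h.raise_grad_smooth b)
  have h3 : Lead U s k (fun x => s x * slotOne G s x a)
      (fun x => (-1 / ((d : ℝ) - 1)) * (k * gradContract G s F x a)) := by
    refine ((Lead.s_div2 hs hG hE a).const_mul (-1 / ((d : ℝ) - 1))).congr_left fun y hy => ?_
    have := hG.sub_one_mul_slotOne h.three_le hs.smooth hy a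
    have hd1 : (d : ℝ) - 1 ≠ 0 := by linarith
    field_simp
    linear_combination -s y * this
  have h4 := (h1.congr_left (g := fun x => ∑ b, secondFFExt G s x a b * raise G (grad s) x b
      + s x * slotOne G s x a) fun y hy => by
    rw [hG.pd_scaleTractorSq h.three_le hs.smooth hy]; ring).unique hs (h2.add h3) hx h0
  have h5 : gradContract G s F x a = ∑ b, F x a b * raise G (grad s) x b := by
    rw [gradContract_eq hG hx]
    exact Finset.sum_congr rfl fun c _ => by rw [hsymm x hx h0]
  rw [h5] at h4
  have hk' : (k : ℝ) + 3 ≤ d := by exact_mod_cast hk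
  -- The factor is nonzero because `k ≤ d - 3 < d - 1`.
  have h6 : (1 - k / ((d : ℝ) - 1)) * ∑ b, F x a b * raise G (grad s) x b = 0 := by
    rw [h4]; ring
  refine (mul_eq_zero.1 h6).resolve_left ?_
  have hd1 : (0 : ℝ) < (d : ℝ) - 1 := by linarith
  intro h7
  have h8 : (k : ℝ) / ((d : ℝ) - 1) = 1 := by linarith
  rw [div_eq_iff hd1.ne'] at h8
  linarith

/-- Symmetry and trace-freeness hold for `E` identically and pass to the leading coefficient by
uniqueness. -/
theorem isTangential {k : ℕ} (hk : k + 3 ≤ d) {F : Cov2 d}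
    (hE : ∀ a b, Lead U s k (fun x => secondFFExt G s x a b) (fun x => F x a b))
    {x : Coord d} (hx : x ∈ U) (h0 : s x = 0) : IsTangential G s x (F x) where
  symm a b := (hE a b).unique h.defining ((hE b a).congr_left fun _ hy =>
    h.metric.secondFFExt_symm h.three_le h.defining.smooth hy b a) hx h0
  normal := h.secondFFExt_normal hk hE hx h0
  trace := (Lead.trace h.metric hE).unique h.defining (((Lead.zero k).congr_left fun _ hy =>
    (h.metric.trace_secondFFExt h.three_le h.defining.smooth hy).symm)) hx h0

/-! ### The operator `𝐈𝐃` -/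

/-- Of all the terms only `∇_n`, with coefficient `m + 1`, and `sΔ`, with coefficient `m(m+1)`,
contribute, because `|ds|² = 1` along the locus. The divergence terms and the contraction with `∇t`
contain `F n = 0`, and the remaining terms vanish to too high an order. The sum is `(d+2w-6)(m+1) -
m(m+1)`. -/
theorem lead_opID {m : ℕ} {w : ℝ} {t F : Cov2 d}
    (ht : ∀ a b, Lead U s (m + 1) (fun x => t x a b) (fun x => F x a b))
    (hF : ∀ x ∈ U, s x = 0 → IsTangential G s x (F x)) (a b : Fin d) :
    Lead U s m (fun x => opID G s w t x a b)
      (fun x => (((m : ℝ) + 1) * (d + 2 * w - 6 - m)) * F x a b) := by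
  have hG := h.metric
  have hs := h.defining
  have ht0 : ∀ a b, Lead U s m (fun x => t x a b) (fun _ => 0) := fun a b =>
    (ht a b).weaken hs (Nat.lt_succ_self m)
  have hgc : ∀ x ∈ U, s x = 0 → ∀ b, gradContract G s F x b = 0 := fun x hx h0 b => by
    rw [gradContract_eq hG hx, (hF x hx h0).normal']
  have e1 : Lead U s m (fun x => ∑ c, raise G (grad s) x c * nabla2 G t x c a b)
      (fun x => (m + 1) * F x a b) := by
    refine (Lead.contract_raise hG h.grad_smooth fun c =>
      Lead.nabla2 hs hG ht c a b).congr_right fun x hx h0 => ?_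
    have : ∀ c, raise G (grad s) x c * ((m + 1) * pd c s x * F x a b)
        = ((m + 1) * F x a b) * (grad s x c * raise G (grad s) x c) := fun c => by
      simp only [grad]; ring
    rw [Finset.sum_congr rfl fun c _ => this c, ← Finset.mul_sum, h.normSq_eq_one hx h0, mul_one]
  have e2 : Lead U s m (fun x => rho G s x * t x a b) (fun _ => 0) :=
    ((ht0 a b).smooth_mul (hG.rho_smooth hs.smooth)).congr_right fun x _ _ => mul_zero _
  have e3 : Lead U s m
      (fun x => symTf G (fun x a b => grad s x a * div2 G t x b) x a b) (fun _ => 0) := by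
    refine (Lead.symTf hG (F := fun x a b => grad s x a * ((m + 1) * gradContract G s F x b))
      (fun a b => (Lead.div2 hs hG ht b).smooth_mul (h.grad_smooth a)) a b).congr_right
      fun x hx h0 => symTf_eq_zero (fun a b => ?_) a b
    rw [hgc x hx h0, mul_zero, mul_zero]
  have e4 : Lead U s m
      (fun x => symTf G (fun x a b => ∑ c, raise G (grad s) x c * nabla2 G t x a c b) x a b)
      (fun _ => 0) := by
    refine (Lead.symTf hG
      (F := fun x a b => ∑ c, raise G (grad s) x c * ((m + 1) * pd a s x * F x c b))
      (fun a b => Lead.contract_raise hG h.grad_smooth fun c =>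
        Lead.nabla2 hs hG ht a c b) a b).congr_right
      fun x hx h0 => symTf_eq_zero (fun a b => ?_) a b
    have : ∀ c, raise G (grad s) x c * ((m + 1) * pd a s x * F x c b)
        = ((m + 1) * pd a s x) * (raise G (grad s) x c * F x c b) := fun c => by ring
    simp only [this]
    rw [← Finset.mul_sum, (hF x hx h0).normal_right, mul_zero]
  have econ : ∀ u : Cov2 d, (∀ a b, ContDiffOn ℝ ∞ (fun x => u x a b) U) →
      Lead U s m (fun x => symTf G (contract G u t) x a b) (fun _ => 0) := by
    intro u hu
    refine (Lead.symTf hG (F := fun _ _ _ => 0) (fun a b => ?_) a b).congr_right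
      fun x _ _ => symTf_eq_zero (fun _ _ => rfl) a b
    have := Lead.sum (t := Finset.univ) fun c _ => Lead.sum (t := Finset.univ) fun e _ =>
      (ht0 e b).smooth_mul ((hG.ginv_smooth c e).mul (hu a c))
    exact this.congr_right fun x _ _ => by simp
  have e5 := econ _ (hG.hess_smooth hs.smooth)
  have e6 : Lead U s m (fun x => s x * lap2 G t x a b)
      (fun x => m * (m + 1) * F x a b) := by
    have := Lead.sum (t := Finset.univ) fun e _ => Lead.sum (t := Finset.univ) fun f _ =>
      (Lead.s_nabla3 hs hG (t := nabla2 G t) (F := fun x c a b => (m + 1) * pd c s x * F x a b)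
        (fun c a b => Lead.nabla2 hs hG ht c a b) e f a b).smooth_mul (hG.ginv_smooth e f)
    refine this.congr (fun x hx => ?_) fun x hx h0 => ?_
    · simp only [lap2, Finset.mul_sum]
      exact Finset.sum_congr rfl fun e _ => Finset.sum_congr rfl fun f _ => by ring
    · have h3 : ∀ e f, ginv G x e f * (m * pd e s x * ((m + 1) * pd f s x * F x a b))
          = (m * (m + 1) * F x a b) * (ginv G x e f * (pd e s x * pd f s x)) := fun e f => by ring
      simp only [h3, ← Finset.mul_sum]
      rw [sum_ginv_grad, h.normSq_eq_one hx h0, mul_one]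
  have e7 : Lead U s m (fun x => s x * (schoutenJ G x * t x a b)) (fun _ => 0) :=
    ((ht0 a b).smooth_mul hG.schoutenJ_smooth).s_mul hs
  have e8 : Lead U s m (fun x => s x * symTf G (nabla1 G (div2 G t)) x a b) (fun _ => 0) := by
    refine (Lead.symTf hG (t := fun x a b => s x * nabla1 G (div2 G t) x a b)
      (F := fun x a b => m * pd a s x * ((m + 1) * gradContract G s F x b))
      (fun a b => Lead.s_nabla1 hs hG (v := div2 G t)
        (w := fun x b => (m + 1) * gradContract G s F x b)
        (fun b => Lead.div2 hs hG ht b) a b) a b).congr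
      (fun x _ => ?_) fun x hx h0 => symTf_eq_zero (fun a b => ?_) a b
    · have : trace G (fun x a b => s x * nabla1 G (div2 G t) x a b) x
          = s x * trace G (nabla1 G (div2 G t)) x := by
        simp only [trace, Finset.mul_sum]
        exact Finset.sum_congr rfl fun e _ => Finset.sum_congr rfl fun f _ => by ring
      simp only [symTf, this]; ring
    · rw [hgc x hx h0, mul_zero, mul_zero]
  have e9 := (econ _ hG.schouten_smooth).s_mul hs
  have key := (((((e1.add (e2.const_mul (w - 2))).sub
      (e3.const_mul (2 * (w - 2) / ((w - 3) * ((d : ℝ) + w - 2))))).add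
      ((e4.add e5).const_mul (2 / (w - 3)))).const_mul ((d : ℝ) + 2 * w - 6)).sub
      (((e6.add (e7.const_mul (w - 2))).add
      (e8.const_mul (2 * (d : ℝ) / ((w - 3) * ((d : ℝ) + w - 2))))).sub (e9.const_mul 4)))
  refine key.congr (fun x _ => ?_) fun x _ _ => by ring
  simp only [opID]
  ring

/-- The leading factor of the powers of `𝐈𝐃`. -/
theorem lead_opIDPow {k : ℕ} {t F : Cov2 d}
    (ht : ∀ a b, Lead U s k (fun x => t x a b) (fun x => F x a b))
    (hF : ∀ x ∈ U, s x = 0 → IsTangential G s x (F x)) (i : ℕ) (hi : i ≤ k) (a b : Fin d) :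
    Lead U s (k - i) (fun x => opIDPow G s 1 i t x a b)
      (fun x => (∏ l ∈ Finset.range i, (((k : ℝ) - l) * (d - 3 - k - l))) * F x a b) := by
  induction i generalizing a b with
  | zero => simpa [opIDPow] using ht a b
  | succ i ih =>
    obtain ⟨m, rfl⟩ : ∃ m, k = m + 1 + i := ⟨k - i - 1, by omega⟩
    have e1 : m + 1 + i - i = m + 1 := by omega
    have e2 : m + 1 + i - (i + 1) = m := by omega
    rw [e2]
    have ih' := fun a b => ih (by omega) a b
    rw [e1] at ih'
    -- After `i` applications the weight is `1 - i` and the order is `m + 1 = k - i`, so `d + 2w - 6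
    -- - m` becomes `d - 3 - k - i`.
    have := h.lead_opID (w := 1 - i) (t := opIDPow G s 1 i t)
      (F := fun x a b => (∏ l ∈ Finset.range i,
        (((m + 1 + i : ℕ) : ℝ) - l) * (d - 3 - (m + 1 + i : ℕ) - l)) * F x a b) ih'
      (fun x hx h0 => (hF x hx h0).smul _) a b
    refine this.congr_right fun x _ _ => ?_
    rw [Finset.prod_range_succ]
    push_cast
    ring

/-- On a tensor `sF` with `F` tangential and trace-free, the normal derivative returns `F`. The mean
curvature term vanishes with the tensor and the tangential derivative with its argument, whatever
the weight. -/
theorem robin_eq {t F : Cov2 d} (ht : ∀ a b, Lead U s 1 (fun x => t x a b) (fun x => F x a b))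
    {x : Coord d} (hx : x ∈ U) (h0 : s x = 0) (hF : IsTangential G s x (F x)) (w : ℝ)
    (a b : Fin d) : robin G s w t x a b = F x a b := by
  have hG := h.metric
  have hs := h.defining
  have hnu : ∀ a, ContDiffOn ℝ ∞ (fun x => raise G (conormal G s) x a) U :=
    hG.raise_smooth h.conormal_smooth
  have hv : ∀ a, Lead U s 1
      (fun x => top1 G s (fun x b => ∑ a, raise G (conormal G s) x a * t x a b) x a)
      (fun x => top1 G s (fun x b => ∑ a, raise G (conormal G s) x a * F x a b) x a) :=
    fun a => h.lead_top1 (v := fun x b => ∑ a, raise G (conormal G s) x a * t x a b)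
      (w := fun x b => ∑ a, raise G (conormal G s) x a * F x a b)
      (fun b => Lead.sum fun c _ => (ht c b).smooth_mul (hnu c)) a
  refine topTf_of_isTangential hF (fun a b => ?_) a b
  rw [h.indNabla_eq_zero hv hx h0, (ht a b).eq_zero hx h0, mul_zero, mul_zero, sub_zero, add_zero]
  have h1 : ∀ c, nabla2 G t x c a b = pd c s x * F x a b := by
    intro c
    have := (Lead.nabla2 hs hG (m := 0) ht c a b).eq_of_zero hx h0
    simpa using this
  have h2 : ∀ c, raise G (conormal G s) x c * nabla2 G t x c a b
      = (grad s x c * raise G (grad s) x c) * F x a b := fun c => by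
    rw [h1, h.raise_conormal_eq hx h0, grad]; ring
  rw [Finset.sum_congr rfl fun c _ => h2 c, ← Finset.sum_mul, h.normSq_eq_one hx h0, one_mul]

/-- The canonical fundamental forms are nonzero multiples of the leading coefficient of the second
fundamental form. -/
theorem canonicalFF_eq {k : ℕ} (hk : 2 * k + 1 < d) (hk3 : k + 3 ≤ d) {F : Cov2 d}
    (hE : ∀ a b, Lead U s k (fun x => secondFFExt G s x a b) (fun x => F x a b)) :
    ∃ c : ℝ, c ≠ 0 ∧ ∀ x ∈ U, s x = 0 → ∀ a b, canonicalFF G s (k + 2) x a b = c * F x a b := by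
  have hT := fun x hx h0 => h.isTangential hk3 hE (x := x) hx h0
  cases k with
  | zero =>
    refine ⟨1, one_ne_zero, fun x hx h0 a b => ?_⟩
    rw [one_mul]
    exact topTf_of_isTangential (hT x hx h0) (fun a b => (hE a b).eq_of_zero hx h0) a b
  | succ k =>
    refine ⟨∏ l ∈ Finset.range k, ((((k + 1 : ℕ) : ℝ) - l) * (d - 3 - (k + 1 : ℕ) - l)), ?_,
      fun x hx h0 a b => ?_⟩
    -- The order is `k + 1` here and `𝐈𝐃` is applied `k` times, so `l ≤ k - 1`. Then `d - 3 - (k+1)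
    -- - l ≥ d - 2k - 3`, which is positive because `2(k+1) + 1 < d`.
    · refine Finset.prod_ne_zero_iff.2 fun l hl => ?_
      have hl' : (l : ℝ) + 1 ≤ k := by exact_mod_cast Finset.mem_range.1 hl
      have hk' : 2 * ((k : ℝ) + 1) + 1 + 1 ≤ d := by exact_mod_cast hk
      push_cast
      refine mul_ne_zero ?_ ?_
      · have : 0 < (k : ℝ) + 1 - l := by linarith
        exact this.ne'
      · have : 0 < (d : ℝ) - 3 - (k + 1) - l := by linarith
        exact this.ne'
    · have h1 := fun a b => h.lead_opIDPow hE hT k (Nat.le_succ k) a b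
      rw [show k + 1 - k = 1 by omega] at h1
      exact h.robin_eq (F := fun x a b => (∏ l ∈ Finset.range k,
        ((((k + 1 : ℕ) : ℝ) - l) * (d - 3 - (k + 1 : ℕ) - l))) * F x a b) h1 hx h0
        ((hT x hx h0).smul _) _ a b

end IsUnitOn

end Forms

end ConfHyp

end

noncomputable section

namespace ConfHyp

/-! ## The tractor `P^{AB}` -/

section TractorP

variable {d : ℕ} {U : Set (Coord d)} {G : Cov2 d} {s : Coord d → ℝ}

namespace IsMetricOn

theorem lower_raise (hG : IsMetricOn U G) {x : Coord d} (hx : x ∈ U) (v : Cov1 d) (i : Fin d) :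
    ∑ j, G x i j * raise G v x j = v x i := by
  simp only [raise, Finset.mul_sum]
  rw [Finset.sum_comm]
  simp only [← mul_assoc, ← Finset.sum_mul, hG.mul_ginv hx, ite_mul, one_mul, zero_mul,
    Finset.sum_ite_eq, Finset.mem_univ, if_true]

variable (hG : IsMetricOn U G) (hd : 3 ≤ d) (hs : ContDiffOn ℝ ∞ s U)
include hG hd hs

omit hd hs in
theorem tracNabla1_scaleTractor_top {x : Coord d} (hx : x ∈ U) (i : Fin d) :
    tracNabla1 G i (scaleTractor G s) x (.inl ()) = 0 := by
  simp only [tracNabla1, Fintype.sum_sum_type, Finset.univ_unique, Finset.sum_singleton, tracConn,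
    Matrix.of_apply, scaleTractor, neg_mul, Finset.sum_neg_distrib, hG.lower_raise hx, zero_mul]
  simp [grad]

/-- The connection adds `s P` and `ρ g` to the Hessian; so `E` is the middle slot of the derivative
of the scale tractor. -/
theorem tracNabla1_scaleTractor_mid {x : Coord d} (hx : x ∈ U) (i k : Fin d) :
    tracNabla1 G i (scaleTractor G s) x (.inr (.inl k))
      = raise G (fun x l => secondFFExt G s x i l) x k := by
  have h1 := hG.pd_raise (hG.grad_smooth hs) hx i k
  simp only [tracNabla1, Fintype.sum_sum_type, Finset.univ_unique, Finset.sum_singleton, tracConn,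
    Matrix.of_apply, scaleTractor]
  have h2 : raise G (fun x l => secondFFExt G s x i l) x k
      = ∑ l, ginv G x k l * nabla1 G (grad s) x i l
        + (∑ l, ginv G x k l * schouten G x l i) * s x
        + (if k = i then 1 else 0) * rho G s x := by
    rw [← hG.ginv_mul hx]
    simp only [raise, secondFFExt, mul_add, Finset.sum_add_distrib, Finset.sum_mul]
    congr 1
    · congr 1
      exact Finset.sum_congr rfl fun l _ => by rw [hG.schouten_symm hd hx i l]; ring
    · exact Finset.sum_congr rfl fun l _ => by rw [hG.symm x hx i l]; ring
  rw [h2, ← h1]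
  ring

omit hG hd hs in
theorem tracNabla1_scaleTractor_bot (x : Coord d) (i : Fin d) (u : Unit) :
    tracNabla1 G i (scaleTractor G s) x (.inr (.inr u)) = slotOne G s x i := by
  simp only [tracNabla1, Fintype.sum_sum_type, Finset.univ_unique, Finset.sum_singleton, tracConn,
    Matrix.of_apply, scaleTractor, slotOne, neg_mul, Finset.sum_neg_distrib]
  ring

/-- The top slot of `∇I` is identically zero, so the second derivative sees only the contribution
`-E_{ij}` of the middle slot, which is trace-free. -/
theorem tracLap1_scaleTractor_top {x : Coord d} (hx : x ∈ U) :
    tracLap1 G (scaleTractor G s) x (.inl ()) = 0 := by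
  rw [← neg_zero, ← hG.trace_secondFFExt hd hs hx]
  simp only [tracLap1, trace, ← Finset.sum_neg_distrib]
  refine Finset.sum_congr rfl fun i _ => Finset.sum_congr rfl fun j _ => ?_
  have h1 : tracNabla1 G i (tracNabla1 G j (scaleTractor G s)) x (.inl ())
      = -secondFFExt G s x i j := by
    rw [tracNabla1, pd_congr hG.isOpen (g := fun _ => 0)
      fun y hy => hG.tracNabla1_scaleTractor_top hy j]
    · simp only [Fintype.sum_sum_type, Finset.univ_unique, Finset.sum_singleton, tracConn,
        Matrix.of_apply, hG.tracNabla1_scaleTractor_mid hd hs hx, neg_mul, Finset.sum_neg_distrib,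
        hG.lower_raise hx, zero_mul]
      rw [hG.secondFFExt_symm hd hs hx j i]
      simp [pd]
    · exact hx
  rw [h1]
  simp [hG.tracNabla1_scaleTractor_top hx]

/-- The divergence of `E` gives `-(d-1)` times `∇ρ - P n`, and the bottom slot of `∇I` adds it back
once. Division by `-(d-2)` thus makes the bottom row of the tractor `P^{AB}` match its bottom
column. -/
theorem tracLap1_scaleTractor_mid {x : Coord d} (hx : x ∈ U) (k : Fin d) :
    tracLap1 G (scaleTractor G s) x (.inr (.inl k))
      = -((d : ℝ) - 2) * raise G (slotOne G s) x k := by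
  have h1 : ∀ i j, tracNabla1 G i (tracNabla1 G j (scaleTractor G s)) x (.inr (.inl k))
        - ∑ m, christ G m i j x * tracNabla1 G m (scaleTractor G s) x (.inr (.inl k))
      = ∑ l, ginv G x k l * nabla2 G (secondFFExt G s) x i j l
        + (if k = i then 1 else 0) * slotOne G s x j := by
    intro i j
    have h2 := hG.pd_raise (v := fun x l => secondFFExt G s x j l)
      (fun a => hG.secondFFExt_smooth hs j a) hx i k
    rw [tracNabla1, pd_congr hG.isOpen
      (g := fun y => raise G (fun x l => secondFFExt G s x j l) y k)
      (fun y hy => hG.tracNabla1_scaleTractor_mid hd hs hy j k) i hx]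
    simp only [Fintype.sum_sum_type, Finset.univ_unique, Finset.sum_singleton, tracConn,
        Matrix.of_apply, hG.tracNabla1_scaleTractor_mid hd hs hx,
        hG.tracNabla1_scaleTractor_top hx, tracNabla1_scaleTractor_bot, mul_zero,
        zero_add]
    have h3 : ∑ l, ginv G x k l * nabla2 G (secondFFExt G s) x i j l
        = ∑ l, ginv G x k l * nabla1 G (fun x l => secondFFExt G s x j l) x i l
          - ∑ m, christ G m i j x * raise G (fun x l => secondFFExt G s x m l) x k := by
      simp only [raise, Finset.mul_sum]
      rw [Finset.sum_comm, ← Finset.sum_sub_distrib]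
      refine Finset.sum_congr rfl fun l _ => ?_
      simp only [nabla2, nabla1, Finset.sum_add_distrib, mul_sub, mul_add, Finset.mul_sum]
      have : ∀ m, christ G m i j x * (ginv G x k l * secondFFExt G s x m l)
        = ginv G x k l * (christ G m i j x * secondFFExt G s x m l) := fun m => by ring
      simp only [this]
      ring
    rw [h3, ← h2]
    ring
  have h2 := fun l => hG.sub_one_mul_slotOne hd hs hx l
  have h3 : ∑ i, ∑ j, ginv G x i j * ∑ l, ginv G x k l * nabla2 G (secondFFExt G s) x i j l
      = -((d : ℝ) - 1) * raise G (slotOne G s) x k := by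
    have h4 : ∀ l, div2 G (secondFFExt G s) x l = -((d : ℝ) - 1) * slotOne G s x l := fun l => by
      linear_combination h2 l
    have h5 : -((d : ℝ) - 1) * raise G (slotOne G s) x k
        = ∑ l, ginv G x k l * div2 G (secondFFExt G s) x l := by
      simp only [h4, raise, Finset.mul_sum]
      exact Finset.sum_congr rfl fun l _ => by ring
    rw [h5]
    simp only [div2, Finset.mul_sum]
    conv_rhs => rw [Finset.sum_comm]
    refine Finset.sum_congr rfl fun i _ => ?_
    rw [Finset.sum_comm]
    refine Finset.sum_congr rfl fun l _ => Finset.sum_congr rfl fun j _ => by ring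
  simp only [tracLap1, h1, mul_add, Finset.sum_add_distrib, h3]
  have h4 : ∑ i, ∑ j, ginv G x i j * ((if k = i then 1 else 0) * slotOne G s x j)
      = raise G (slotOne G s) x k := by
    simp only [raise, ← mul_assoc, mul_ite, mul_one, mul_zero, ite_mul, zero_mul]
    rw [Finset.sum_comm]
    simp
  rw [h4]
  ring

theorem tracLap1_scaleTractor_bot {x : Coord d} (hx : x ∈ U) :
    tracLap1 G (scaleTractor G s) x (.inr (.inr ()))
      = trace G (nabla1 G (slotOne G s)) x
        - trace G (contract G (schouten G) (secondFFExt G s)) x := by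
  simp only [tracLap1, trace, ← Finset.sum_sub_distrib, ← mul_sub]
  refine Finset.sum_congr rfl fun i _ => Finset.sum_congr rfl fun j _ => ?_
  rw [tracNabla1, pd_congr hG.isOpen (g := fun y => slotOne G s y j)
      (fun y _ => tracNabla1_scaleTractor_bot y j ()) i hx]
  simp only [Fintype.sum_sum_type, Finset.univ_unique, Finset.sum_singleton, tracConn,
        Matrix.of_apply, hG.tracNabla1_scaleTractor_mid hd hs hx,
        tracNabla1_scaleTractor_bot, contract, nabla1]
  have h1 : ∑ m, -schouten G x i m * raise G (fun x l => secondFFExt G s x j l) x m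
      = -∑ c, ∑ e, ginv G x c e * schouten G x i c * secondFFExt G s x e j := by
    simp only [raise, neg_mul, Finset.mul_sum, Finset.sum_neg_distrib]
    congr 1
    refine Finset.sum_congr rfl fun c _ => Finset.sum_congr rfl fun e _ => ?_
    rw [hG.secondFFExt_symm hd hs hx j e]; ring
  rw [h1]
  ring

end IsMetricOn

end TractorP

end ConfHyp

end

noncomputable section

namespace ConfHyp

/-! ## Conditional fundamental forms and the vanishing order of the second fundamental form -/

section Tractors

variable {d : ℕ} {U : Set (Coord d)} {G : Cov2 d} {s : Coord d → ℝ}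

namespace IsUnitOn

variable (h : IsUnitOn U G s)
include h

theorem sum_raise_mul_pd {x : Coord d} (hx : x ∈ U) (h0 : s x = 0) :
    ∑ i, raise G (grad s) x i * pd i s x = 1 := by
  rw [← h.normSq_eq_one hx h0]
  exact Finset.sum_congr rfl fun i _ => mul_comm _ _

/-- The one-form `∇_a ρ - P_{ab} n^b` vanishes to the same order as the second fundamental form,
and its leading coefficient is tangential. -/
theorem lead_slotOne {m : ℕ} (hk : m + 1 + 3 ≤ d) {F : Cov2 d}
    (hE : ∀ a b, Lead U s (m + 1) (fun x => secondFFExt G s x a b) (fun x => F x a b)) :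
    ∃ v : Cov1 d, (∀ a, Lead U s (m + 1) (fun x => slotOne G s x a) (fun x => v x a)) ∧
      ∀ x ∈ U, s x = 0 → ∑ a, raise G (grad s) x a * v x a = 0 := by
  have hd := h.three_le
  have hG := h.metric
  have hs := h.defining
  have hd3 : (3 : ℝ) ≤ d := by exact_mod_cast hd
  have hkd : (m : ℝ) + 1 + 3 ≤ d := by exact_mod_cast hk
  have hd1 : (d : ℝ) - 1 ≠ 0 := by linarith
  have hT := fun x hx h0 => h.isTangential hk hE (x := x) hx h0
  -- The divergence of `E` would in general vanish only to order `m`. Its coefficient at that order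
  -- is a multiple of `F n = 0`, which gains one order.
  have h1 : ∀ a, ∃ v, ContDiffOn ℝ ∞ v U ∧ Lead U s (m + 1) (fun x => slotOne G s x a) v := by
    intro a
    refine Lead.succ hs (h := fun x => (-1 / ((d : ℝ) - 1)) * ((m + 1) * gradContract G s F x a))
      (((Lead.div2 hs hG hE a).const_mul (-1 / ((d : ℝ) - 1))).congr_left fun y hy => ?_)
      fun x hx h0 => ?_
    · have := hG.sub_one_mul_slotOne hd hs.smooth hy a
      field_simp
      linear_combination -this
    · rw [gradContract_eq hG hx, (hT x hx h0).normal']; ring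
  choose v hv hpv using h1
  refine ⟨fun x a => v a x, hpv, fun x hx h0 => ?_⟩
  obtain ⟨B, hB⟩ := h.unit
  let Y : Cov1 d := fun x a => ∑ b, secondFFExt G s x a b * raise G (grad s) x b
  -- The sum `E n + s(∇ρ - P n)` vanishes to order `d - 1 > m + 2`, so `E n` has leading coefficient
  -- opposite to that of `s(∇ρ - P n)`.
  have hY : ∀ a, Lead U s (m + 1 + 1) (fun x => Y x a) (fun x => -v a x) := by
    intro a
    have e1 : Lead U s (m + 1 + 1) (fun x => (1 / 2) * pd a (scaleTractorSq G s) x)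
        (fun _ => 0) := by
      obtain ⟨e, rfl⟩ : ∃ e, d = e + 1 := ⟨d - 1, by omega⟩
      refine (((hB.pd hs a).weaken hs (m := m + 1 + 1) (by omega)).const_mul (1 / 2)).congr
        (fun y hy => ?_) fun _ _ _ => by simp
      congr 1
      simp only [pd]
      rw [fderiv_sub_const]
    refine (e1.sub (hpv a).s_mul_succ).congr (fun y hy => ?_) fun y _ _ => by simp
    rw [hG.pd_scaleTractorSq hd hs.smooth hy]
    simp only [Y]
    ring
  have e1 := Lead.trace hG (F := fun x c a => ((m + 1 : ℕ) + 1 : ℝ) * pd c s x * -v a x)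
    fun c a => Lead.nabla1 hs hG (w := fun x a => -v a x) hY c a
  have e2 : Lead U s (m + 1) (fun x => ∑ b, raise G (grad s) x b * div2 G (secondFFExt G s) x b)
      (fun x => ∑ b, raise G (grad s) x b * (-((d : ℝ) - 1) * v b x)) := by
    refine Lead.contract_raise hG h.grad_smooth fun b => ((hpv b).const_mul _).congr_left
      fun y hy => ?_
    linear_combination -hG.sub_one_mul_slotOne hd hs.smooth hy b
  have e3 : Lead U s (m + 1) (fun x => trace G (contract G (nabla1 G (grad s)) (secondFFExt G s)) x)
      (fun x => trace G (contract G (nabla1 G (grad s)) F) x) := by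
    refine Lead.trace hG fun a b => Lead.sum fun c _ => Lead.sum fun e _ => ?_
    exact (hE e b).smooth_mul ((hG.ginv_smooth c e).mul (hG.hess_smooth hs.smooth a c))
  -- The divergence of `E n` is computed twice: from its leading coefficient, and as `n · div E`
  -- plus the contraction of `∇n` with `E`.
  have key := (e1.congr_left fun y hy => hG.trace_nabla1_contract hs.smooth
    (hG.secondFFExt_smooth hs.smooth)
    (fun y hy => hG.secondFFExt_symm hd hs.smooth hy) hy).unique hs (e2.add e3) hx h0
  -- Since `E` and `s` vanish at `x`, the Hessian is pure trace there, and its contraction with the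
  -- trace-free `F` is zero.
  have hH : ∀ a b, nabla1 G (grad s) x a b = -rho G s x * G x a b := by
    intro a b
    have := (hE a b).eq_zero hx h0
    rw [secondFFExt, h0] at this
    linarith
  have h3 : trace G (contract G (nabla1 G (grad s)) F) x = 0 := by
    have h4 : ∀ a b, contract G (nabla1 G (grad s)) F x a b = -rho G s x * F x a b := by
      intro a b
      have : ∀ c e, ginv G x c e * nabla1 G (grad s) x a c * F x e b
          = -rho G s x * ((G x a c * ginv G x c e) * F x e b) := fun c e => by rw [hH]; ring
      simp only [contract, this, ← Finset.mul_sum]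
      rw [Finset.sum_comm]
      simp only [← Finset.sum_mul, hG.mul_ginv hx, ite_mul, one_mul, zero_mul, Finset.sum_ite_eq,
        Finset.mem_univ, if_true]
    have h5 : ∀ a b, ginv G x a b * (-rho G s x * F x a b)
        = -rho G s x * (ginv G x a b * F x a b) := fun a b => by ring
    simp only [trace, h4, h5, ← Finset.mul_sum, (hT x hx h0).trace, mul_zero]
  have h4 : trace G (fun x c a => ((m + 1 : ℕ) + 1 : ℝ) * pd c s x * -v a x) x
      = -((m : ℝ) + 2) * ∑ a, raise G (grad s) x a * v a x := by
    simp only [trace, raise, Finset.mul_sum, Finset.sum_mul, grad]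
    rw [Finset.sum_comm]
    refine Finset.sum_congr rfl fun a _ => Finset.sum_congr rfl fun b _ => ?_
    rw [hG.ginv_symm hx]
    push_cast
    ring
  have h5 : ∑ b, raise G (grad s) x b * (-((d : ℝ) - 1) * v b x)
      = -((d : ℝ) - 1) * ∑ a, raise G (grad s) x a * v a x := by
    rw [Finset.mul_sum]
    exact Finset.sum_congr rfl fun _ _ => by ring
  rw [h3, h4, h5] at key
  -- The two computations give `-(m+2) n·v = -(d-1) n·v`; the difference of the constants is
  -- positive as `m + 4 ≤ d`.
  have h6 : ((d : ℝ) - 3 - m) * ∑ a, raise G (grad s) x a * v a x = 0 := by linear_combination key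
  exact (mul_eq_zero.1 h6).resolve_left (by intro h7; linarith)

/-- Every entry of the tractor is built from `E`, from `∇ρ - P n`, or from the trace of the
derivative of the latter. The zero top row and the middle block are recorded since the extraction to
the hypersurface uses nothing else. -/
theorem lead_tractorP {m : ℕ} (hk : m + 1 + 3 ≤ d) {F : Cov2 d}
    (hE : ∀ a b, Lead U s (m + 1) (fun x => secondFFExt G s x a b) (fun x => F x a b)) :
    ∃ Q : Trac2 d, (∀ A B, Lead U s (m + 1) (fun x => tractorP G s x A B) (fun x => Q x A B)) ∧
      (∀ x B, Q x (.inl ()) B = 0) ∧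
      ∀ x a b, Q x (.inr (.inl a)) (.inr (.inl b))
        = ∑ i, ginv G x a i * raise G (fun x l => F x i l) x b := by
  have hd := h.three_le
  have hG := h.metric
  have hs := h.defining
  have hd3 : (3 : ℝ) ≤ d := by exact_mod_cast hd
  have hd2 : (d : ℝ) - 2 ≠ 0 := by linarith
  obtain ⟨v, hv, hvn⟩ := h.lead_slotOne hk hE
  -- A derivative normally costs one order. Here the coefficient at the lower order is a multiple of
  -- `n · v`, which is zero, so the order `m + 1` is kept.
  have hp : ∃ q, Lead U s (m + 1) (fun x => trace G (nabla1 G (slotOne G s)) x) q := by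
    have h1 := Lead.trace hG (F := fun x c a => ((m : ℝ) + 1) * pd c s x * v x a)
      fun c a => Lead.nabla1 hs hG hv c a
    obtain ⟨q, -, hq⟩ := h1.succ hs fun x hx h0 => by
      have : trace G (fun x c a => ((m : ℝ) + 1) * pd c s x * v x a) x
          = ((m : ℝ) + 1) * ∑ a, raise G (grad s) x a * v x a := by
        simp only [trace, raise, Finset.mul_sum, Finset.sum_mul, grad]
        rw [Finset.sum_comm]
        refine Finset.sum_congr rfl fun a _ => Finset.sum_congr rfl fun b _ => ?_
        rw [hG.ginv_symm hx]
        ring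
      rw [this, hvn x hx h0, mul_zero]
    exact ⟨q, hq⟩
  obtain ⟨q, hq⟩ := hp
  let Q : Trac2 d := fun x => Matrix.of fun A B => match A, B with
    | .inl _, _ => 0
    | .inr (.inl _), .inl _ => 0
    | .inr (.inl a), .inr (.inl b) => ∑ i, ginv G x a i * raise G (fun x l => F x i l) x b
    | .inr (.inl a), .inr (.inr _) => raise G v x a
    | .inr (.inr _), .inl _ => 0
    | .inr (.inr _), .inr (.inl b) => raise G v x b
    | .inr (.inr _), .inr (.inr _) =>
      -1 / ((d : ℝ) - 2) * (q x - trace G (contract G (schouten G) F) x)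
  refine ⟨Q, ?_, fun _ _ => rfl, fun _ _ _ => rfl⟩
  rintro (_ | a | _) (_ | b | _)
  · exact Lead.zero _
  · exact Lead.zero _
  · exact Lead.zero _
  · refine (Lead.zero _).congr_left fun x hx => ?_
    simp [tractorP, hG.tracNabla1_scaleTractor_top hx]
  · refine Lead.congr_left (f := fun x =>
      ∑ j, ginv G x a j * raise G (fun x l => secondFFExt G s x j l) x b)
      (Lead.sum fun j _ => (Lead.raise hG (v := fun x l => secondFFExt G s x j l)
        (w := fun x l => F x j l) (fun l => hE j l) b).smooth_mul (hG.ginv_smooth a j))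
      fun x hx => ?_
    simp only [tractorP, Matrix.of_apply, hG.tracNabla1_scaleTractor_mid hd hs.smooth hx]
  · refine (Lead.raise hG hv a).congr_left fun x hx => ?_
    simp only [tractorP, Matrix.of_apply, IsMetricOn.tracNabla1_scaleTractor_bot]
    rfl
  · refine (Lead.zero _).congr_left fun x hx => ?_
    simp [tractorP, hG.tracLap1_scaleTractor_top hd hs.smooth hx]
  · refine (Lead.raise hG hv b).congr_left fun x hx => ?_
    simp only [tractorP, Matrix.of_apply, hG.tracLap1_scaleTractor_mid hd hs.smooth hx]
    field_simp
  · have e3 : Lead U s (m + 1) (fun x => trace G (contract G (schouten G) (secondFFExt G s)) x)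
        (fun x => trace G (contract G (schouten G) F) x) := by
      refine Lead.trace hG fun a b => Lead.sum fun c _ => Lead.sum fun e _ => ?_
      exact (hE e b).smooth_mul ((hG.ginv_smooth c e).mul (hG.schouten_smooth a c))
    refine ((hq.sub e3).const_mul (-1 / ((d : ℝ) - 2))).congr_left fun x hx => ?_
    simp only [tractorP, Matrix.of_apply, hG.tracLap1_scaleTractor_bot hd hs.smooth hx]
    ring

/-! ### The operator `I·D` -/

theorem tracConn_smooth (i : Fin d) (A B : TrIdx d) :
    ContDiffOn ℝ ∞ (fun x => tracConn G i x A B) U := by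
  have hG := h.metric
  rcases A with _ | a | _ <;> rcases B with _ | b | _ <;>
    simp only [tracConn, Matrix.of_apply]
  · exact contDiffOn_const
  · exact (hG.smooth i b).neg
  · exact contDiffOn_const
  · exact ContDiffOn.sum fun l _ => (hG.ginv_smooth a l).mul (hG.schouten_smooth l i)
  · exact hG.christ_smooth a i b
  · exact contDiffOn_const
  · exact contDiffOn_const
  · exact (hG.schouten_smooth i b).neg
  · exact contDiffOn_const

theorem lead_tracNabla2 {m : ℕ} {T Q : Trac2 d}
    (hT : ∀ A B, Lead U s (m + 1) (fun x => T x A B) (fun x => Q x A B)) (i : Fin d)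
    (A B : TrIdx d) : Lead U s m (fun x => tracNabla2 G i T x A B)
      (fun x => (m + 1) * pd i s x * Q x A B) := by
  have h0 := fun A B => (hT A B).weaken h.defining (Nat.lt_succ_self m)
  have h1 := (((hT A B).pd h.defining i).add (Lead.sum (t := Finset.univ) fun C _ =>
    (h0 C B).smooth_mul (h.tracConn_smooth i A C))).add (Lead.sum (t := Finset.univ) fun C _ =>
    (h0 A C).mul_smooth (h.tracConn_smooth i B C))
  refine h1.congr (fun x _ => ?_) fun x _ _ => by simp
  simp [tracNabla2, Matrix.mul_apply]

theorem lead_s_tracNabla2 {m : ℕ} {T Q : Trac2 d}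
    (hT : ∀ A B, Lead U s m (fun x => T x A B) (fun x => Q x A B)) (i : Fin d)
    (A B : TrIdx d) : Lead U s m (fun x => s x * tracNabla2 G i T x A B)
      (fun x => m * pd i s x * Q x A B) := by
  have h0 := fun A B => (hT A B).s_mul h.defining
  have h1 := (((hT A B).s_pd h.defining i).add (Lead.sum (t := Finset.univ) fun C _ =>
    (h0 C B).smooth_mul (h.tracConn_smooth i A C))).add (Lead.sum (t := Finset.univ) fun C _ =>
    (h0 A C).mul_smooth (h.tracConn_smooth i B C))
  refine h1.congr (fun x _ => ?_) fun x _ _ => by simp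
  simp only [tracNabla2, Matrix.mul_apply, Matrix.add_apply, Matrix.of_apply,
    Matrix.transpose_apply, mul_add, Finset.mul_sum]
  congr 1
  · congr 1
    exact Finset.sum_congr rfl fun C _ => by ring
  · exact Finset.sum_congr rfl fun C _ => by ring

theorem lead_tracNablaN {m : ℕ} {T Q : Trac2 d}
    (hT : ∀ A B, Lead U s (m + 1) (fun x => T x A B) (fun x => Q x A B)) (A B : TrIdx d) :
    Lead U s m (fun x => ∑ i, raise G (grad s) x i * tracNabla2 G i T x A B)
      (fun x => (m + 1) * Q x A B) := by
  refine (Lead.contract_raise h.metric h.grad_smooth fun i =>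
    h.lead_tracNabla2 hT i A B).congr_right fun x hx h0 => ?_
  have : ∀ i, raise G (grad s) x i * ((m + 1) * pd i s x * Q x A B)
      = ((m + 1) * Q x A B) * (raise G (grad s) x i * pd i s x) := fun i => by ring
  rw [Finset.sum_congr rfl fun i _ => this i, ← Finset.mul_sum, h.sum_raise_mul_pd hx h0, mul_one]

theorem lead_s_tracLap2 {m : ℕ} {T Q : Trac2 d}
    (hT : ∀ A B, Lead U s (m + 1) (fun x => T x A B) (fun x => Q x A B)) (A B : TrIdx d) :
    Lead U s m (fun x => s x * tracLap2 G T x A B) (fun x => m * (m + 1) * Q x A B) := by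
  have hG := h.metric
  have h1 := fun (i j : Fin d) => (h.lead_s_tracNabla2 (T := tracNabla2 G j T)
    (Q := fun x => Matrix.of fun A B => (m + 1) * pd j s x * Q x A B)
    (fun A B => h.lead_tracNabla2 hT j A B) i A B).sub (Lead.sum (t := Finset.univ) fun k _ =>
      ((h.lead_tracNabla2 hT k A B).s_mul h.defining).smooth_mul (hG.christ_smooth k i j))
  have h2 := Lead.sum (t := Finset.univ) fun i _ => Lead.sum (t := Finset.univ) fun j _ =>
    (h1 i j).smooth_mul (hG.ginv_smooth i j)
  refine h2.congr (fun x _ => ?_) fun x hx h0 => ?_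
  · simp only [tracLap2, Matrix.sum_apply, Matrix.smul_apply, Matrix.sub_apply, smul_eq_mul,
      Finset.mul_sum]
    refine Finset.sum_congr rfl fun i _ => Finset.sum_congr rfl fun j _ => ?_
    have : ∀ k, christ G k i j x * (s x * tracNabla2 G k T x A B)
      = s x * (christ G k i j x * tracNabla2 G k T x A B) := fun k => by ring
    simp only [this, ← Finset.mul_sum]
    ring
  · have h3 : ∀ i j, ginv G x i j * (m * pd i s x * ((m + 1) * pd j s x * Q x A B)
          - ∑ k, christ G k i j x * 0)
        = (m * (m + 1) * Q x A B) * (ginv G x i j * (pd i s x * pd j s x)) := fun i j => by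
      simp; ring
    simp only [Matrix.of_apply, h3, ← Finset.mul_sum]
    rw [sum_ginv_grad, h.normSq_eq_one hx h0, mul_one]

/-- The scalar is `(m+1)(d-2+2w) - m(m+1)`, as for `𝐈𝐃` but without any condition on the
coefficients. The logarithmic part additionally feeds `2(m+1)β` into the plain part, since the
weight operator sends `log τ` to `1` in the factor `d + 2w̲ - 2`. -/
theorem lead_opIdotD {m : ℕ} {w : ℝ} {F : LogTrac2 d} {α β : Trac2 d}
    (h1 : ∀ A B, Lead U s (m + 1) (fun x => F.1 x A B) (fun x => α x A B))
    (h2 : ∀ A B, Lead U s (m + 1) (fun x => F.2 x A B) (fun x => β x A B)) (A B : TrIdx d) :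
    Lead U s m (fun x => (opIdotD G s w F).1 x A B)
        (fun x => (m + 1) * ((d - 2 + 2 * w - m) * α x A B + 2 * β x A B)) ∧
      Lead U s m (fun x => (opIdotD G s w F).2 x A B)
        (fun x => (m + 1) * ((d - 2 + 2 * w - m) * β x A B)) := by
  have hs := h.defining
  have hρ := h.metric.rho_smooth hs.smooth
  have z1 := (h1 A B).weaken hs (Nat.lt_succ_self m)
  have z2 := (h2 A B).weaken hs (Nat.lt_succ_self m)
  have zz : ∀ c : ℝ, Lead U s m (fun x => c * F.1 x A B + F.2 x A B) (fun _ => 0) := fun c =>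
    ((z1.const_mul c).add z2).congr_right fun _ _ _ => by simp
  have K2 := (h.lead_tracNablaN h2 A B).add ((z2.const_mul w).smooth_mul hρ)
  have K1 := (h.lead_tracNablaN h1 A B).add ((zz w).smooth_mul hρ)
  have L2 := (h.lead_s_tracLap2 h2 A B).add
    (((z2.const_mul w).smooth_mul h.metric.schoutenJ_smooth).s_mul hs)
  have L1 := (h.lead_s_tracLap2 h1 A B).add
    (((zz w).smooth_mul h.metric.schoutenJ_smooth).s_mul hs)
  constructor
  · refine (((K1.const_mul ((d : ℝ) - 2 + 2 * w)).add (K2.const_mul 2)).sub L1).congr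
      (fun x _ => ?_) fun x _ _ => by ring
    simp [opIdotD, weightOp, Matrix.sum_apply]
    ring
  · refine ((K2.const_mul ((d : ℝ) - 2 + 2 * w)).sub L2).congr
      (fun x _ => ?_) fun x _ _ => by ring
    simp [opIdotD, weightOp, Matrix.sum_apply]
    ring

end IsUnitOn

end Tractors

end ConfHyp

end

noncomputable section

namespace ConfHyp

/-! ### The logarithmic coefficient and the conditional fundamental forms -/

section Conditional

variable {d : ℕ} {U : Set (Coord d)} {G : Cov2 d} {s : Coord d → ℝ}

/-- The leading factors of the powers of `I·D`, acting on a tractor of weight `-1` and its product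
with a logarithm, both vanishing to order `k`. -/
def logCoeff (d k : ℕ) : ℕ → ℝ × ℝ
  | 0 => (1, 0)
  | i + 1 => (((k : ℝ) - i) * (d - 3 - k - i) * (logCoeff d k i).1,
      ((k : ℝ) - i) * ((d - 3 - k - i) * (logCoeff d k i).2 + 2 * (logCoeff d k i).1))

/-- With `d = e + k + 3` the scalar at step `i` is `(k-i)(e-i)`, which vanishes for exactly one
step, `i = e`, and `d ≤ 2k + 2` says that this step occurs among the first `k`. At this step the
plain coefficient dies and the logarithmic one receives twice its previous value; all later scalars
are nonzero. -/
theorem logCoeff_ne_zero {d k : ℕ} (hk : d ≤ 2 * k + 2) (hk3 : k + 3 ≤ d) :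
    (logCoeff d k k).2 ≠ 0 := by
  obtain ⟨e, rfl⟩ : ∃ e, d = e + k + 3 := ⟨d - k - 3, by omega⟩
  have key : ∀ i, i ≤ k → (i ≤ e → (logCoeff (e + k + 3) k i).1 ≠ 0) ∧
      (e < i → (logCoeff (e + k + 3) k i).1 = 0 ∧ (logCoeff (e + k + 3) k i).2 ≠ 0) := by
    intro i
    induction i with
    | zero => exact fun _ => ⟨fun _ => one_ne_zero, fun h => absurd h (Nat.not_lt_zero _)⟩
    | succ i ih =>
      intro hi
      obtain ⟨h1, h2⟩ := ih (by omega)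
      have hki : (k : ℝ) - i ≠ 0 := by
        have : (i : ℝ) + 1 ≤ k := by exact_mod_cast hi
        have : 0 < (k : ℝ) - i := by linarith
        exact this.ne'
      have he : (((e + k + 3 : ℕ) : ℝ) - 3 - k - i) = (e : ℝ) - i := by push_cast; ring
      simp only [logCoeff, he]
      refine ⟨fun hie => ?_, fun hei => ?_⟩
      · refine mul_ne_zero (mul_ne_zero hki ?_) (h1 (by omega))
        have : (i : ℝ) + 1 ≤ e := by exact_mod_cast hie
        have : 0 < (e : ℝ) - i := by linarith
        exact this.ne'
      · rcases Nat.lt_succ_iff_lt_or_eq.1 hei with hlt | rfl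
        · obtain ⟨h3, h4⟩ := h2 hlt
          refine ⟨by rw [h3, mul_zero], mul_ne_zero hki ?_⟩
          rw [h3, mul_zero, add_zero]
          refine mul_ne_zero ?_ h4
          have : (e : ℝ) + 1 ≤ i := by exact_mod_cast hlt
          have : (e : ℝ) - i < 0 := by linarith
          exact this.ne
        · refine ⟨by rw [sub_self, mul_zero, zero_mul], mul_ne_zero hki ?_⟩
          rw [sub_self, zero_mul, zero_add]
          exact mul_ne_zero two_ne_zero (h1 le_rfl)
  exact ((key k le_rfl).2 (by omega)).2

namespace IsUnitOn

variable (h : IsUnitOn U G s)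
include h

theorem lead_opIdotDPow {k : ℕ} {F : LogTrac2 d} {α β : Trac2 d}
    (h1 : ∀ A B, Lead U s k (fun x => F.1 x A B) (fun x => α x A B))
    (h2 : ∀ A B, Lead U s k (fun x => F.2 x A B) (fun x => β x A B)) (i : ℕ) (hi : i ≤ k)
    (A B : TrIdx d) :
    Lead U s (k - i) (fun x => (opIdotDPow G s (-1) i F).1 x A B)
        (fun x => (logCoeff d k i).1 * α x A B + (logCoeff d k i).2 * β x A B) ∧
      Lead U s (k - i) (fun x => (opIdotDPow G s (-1) i F).2 x A B)
        (fun x => (logCoeff d k i).1 * β x A B) := by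
  induction i generalizing A B with
  | zero => simpa [opIdotDPow, logCoeff] using And.intro (h1 A B) (h2 A B)
  | succ i ih =>
    obtain ⟨m, rfl⟩ : ∃ m, k = m + 1 + i := ⟨k - i - 1, by omega⟩
    have e1 : m + 1 + i - i = m + 1 := by omega
    have e2 : m + 1 + i - (i + 1) = m := by omega
    rw [e2]
    have ih' := fun A B => ih (by omega) A B
    rw [e1] at ih'
    have := h.lead_opIdotD (w := -1 - i) (F := opIdotDPow G s (-1) i F)
      (α := fun x => Matrix.of fun A B => (logCoeff d (m + 1 + i) i).1 * α x A B
        + (logCoeff d (m + 1 + i) i).2 * β x A B)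
      (β := fun x => Matrix.of fun A B => (logCoeff d (m + 1 + i) i).1 * β x A B)
      (fun A B => (ih' A B).1) (fun A B => (ih' A B).2) A B
    refine ⟨this.1.congr_right fun x _ _ => ?_, this.2.congr_right fun x _ _ => ?_⟩ <;>
    · simp only [logCoeff, Matrix.of_apply]
      push_cast
      ring

/-- Both summands contain `log t` times the plain coefficient of `Q`, and these cancel. Only the
logarithmic coefficient survives, so the result does not involve `t` along the hypersurface. -/
theorem lead_logCommutator {k : ℕ} {t : Coord d → ℝ} (ht : ContDiffOn ℝ ∞ t U)
    (ht0 : ∀ x ∈ U, 0 < t x) {Q : Trac2 d}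
    (hQ : ∀ A B, Lead U s k (fun x => tractorP G s x A B) (fun x => Q x A B)) (A B : TrIdx d) :
    Lead U s 0 (fun x => logCommutator G s t k x A B)
      (fun x => (logCoeff d k k).2 * Q x A B) := by
  have hl : ContDiffOn ℝ ∞ (fun x => Real.log (t x)) U := ht.log fun x hx => (ht0 x hx).ne'
  have h1 := (h.lead_opIdotDPow (F := (fun y => Real.log (t y) • tractorP G s y, tractorP G s))
    (α := fun x => Real.log (t x) • Q x) (fun A B => (hQ A B).smooth_mul hl) hQ k le_rfl A B).1
  have h2 := (h.lead_opIdotDPow (F := (tractorP G s, 0)) (β := fun _ => 0) hQ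
    (fun A B => Lead.zero k) k le_rfl A B).1
  rw [Nat.sub_self] at h1 h2
  refine (h1.sub (h2.smooth_mul hl)).congr (fun x _ => ?_) fun x _ _ => ?_
  · simp [logCommutator]
  · simp
    ring

/-- The correction terms involve only the top row of `T`, which vanishes along the hypersurface.
They drop out for every `w`, leaving the lowered middle block. -/
theorem extractHyp_eq {w : ℝ} {T : Trac2 d} (hT : ∀ A B, ContDiffOn ℝ ∞ (fun x => T x A B) U)
    (hT0 : ∀ x ∈ U, s x = 0 → ∀ B, T x (.inl ()) B = 0) {F : Fin d → Fin d → ℝ} {x : Coord d}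
    (hx : x ∈ U) (h0 : s x = 0) (hF : IsTangential G s x F)
    (hTF : ∀ a b, T x (.inr (.inl a)) (.inr (.inl b))
      = ∑ i, ginv G x a i * ∑ l, ginv G x b l * F i l) (a b : Fin d) :
    extractHyp G s w T x a b = F a b := by
  have hG := h.metric
  have hs := h.defining
  have hL : ∀ B, ∃ r, ContDiffOn ℝ ∞ r U ∧ Lead U s 1 (fun x => T x (.inl ()) B) r := fun B =>
    (Lead.of_smooth (hT (.inl ()) B)).succ hs fun x hx h0 => hT0 x hx h0 B
  choose r hr hTr using hL
  have z1 : ∀ a b, indNabla G s (top1 G s fun x b => ∑ c, G x b c * T x (.inl ()) (.inr (.inl c)))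
      x a b = 0 := by
    refine h.indNabla_eq_zero (w := top1 G s fun x b => ∑ c, G x b c * r (.inr (.inl c)) x)
      (fun a => h.lead_top1 (w := fun x b => ∑ c, G x b c * r (.inr (.inl c)) x)
        (fun b => Lead.sum fun c _ => (hTr _).smooth_mul (hG.smooth b c)) a) hx h0
  -- Writing `T⁺⁺ = s k`, its gradient is `s dk + k ds`, and the projection removes the second
  -- summand. The projected gradient is thus a multiple of `s`, so its tangential derivative
  -- vanishes too.
  have z2 : ∀ a b, indNabla G s (top1 G s (grad fun x => T x (.inl ()) (.inl ()))) x a b = 0 := by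
    obtain ⟨k, hk, hk'⟩ := hTr (.inl ())
    have hk1 : ∀ y ∈ U, T y (.inl ()) (.inl ()) = s y * k y := fun y hy => by
      rw [← pow_one (s y)]; exact (hk' y hy).1
    refine h.indNabla_eq_zero (w := top1 G s (grad k)) (fun a => ?_) hx h0
    refine Lead.congr_left (f := fun x => s x * top1 G s (grad k) x a) ?_ fun y hy => ?_
    · have : ContDiffOn ℝ ∞ (fun x => top1 G s (grad k) x a) U := ContDiffOn.sum fun b _ =>
        (h.tanProj_smooth a b).mul (contDiffOn_pd hs.isOpen hk b)
      exact (Lead.of_smooth this).s_mul_succ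
    · have e1 : ∀ b, pd b (fun x => T x (.inl ()) (.inl ())) y = s y * pd b k y + k y * pd b s y := by
        intro b
        rw [← pd_mul b (differentiableAt_of_smooth hs.isOpen hs.smooth hy)
          (differentiableAt_of_smooth hs.isOpen hk hy)]
        exact pd_congr hs.isOpen hk1 b hy
      have e2 : ∀ b, tanProj G s y a b * (s y * pd b k y + k y * pd b s y)
          = s y * (tanProj G s y a b * pd b k y) + k y * (tanProj G s y a b * pd b s y) :=
        fun b => by ring
      simp only [top1, grad, e1, e2, Finset.sum_add_distrib, ← Finset.mul_sum,
        tanProj_mul_grad (h.pos y hy), mul_zero, add_zero]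
  have e2 : ∀ a b, ∑ c, ∑ e, G x a c * G x b e * T x (.inr (.inl c)) (.inr (.inl e)) = F a b := by
    intro a b
    have e3 : ∀ c, ∑ e, G x a c * G x b e * T x (.inr (.inl c)) (.inr (.inl e))
        = G x a c * ∑ i, ginv G x c i * F i b := by
      intro c
      simp only [hTF, mul_assoc, ← Finset.mul_sum]
      congr 1
      simp only [Finset.mul_sum]
      rw [Finset.sum_comm]
      refine Finset.sum_congr rfl fun i _ => ?_
      rw [Finset.sum_comm]
      have e4 : ∀ l e, G x b e * (ginv G x c i * (ginv G x e l * F i l))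
          = ginv G x c i * ((G x b e * ginv G x e l) * F i l) := fun l e => by ring
      simp only [e4, ← Finset.mul_sum, ← Finset.sum_mul, hG.mul_ginv hx, ite_mul, one_mul, zero_mul,
        Finset.sum_ite_eq, Finset.mem_univ, if_true]
    simp only [e3, Finset.mul_sum]
    rw [Finset.sum_comm]
    simp only [← mul_assoc, ← Finset.sum_mul, hG.mul_ginv hx, ite_mul, one_mul, zero_mul,
      Finset.sum_ite_eq, Finset.mem_univ, if_true]
  refine topTf_of_isTangential hF (fun a b => ?_) a b
  rw [z1, z2]
  dsimp only
  rw [hT0 x hx h0, mul_zero, mul_zero, mul_zero, sub_zero, sub_zero, add_zero]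
  exact e2 a b

/-- The conditional fundamental forms are nonzero multiples of the leading coefficient of the second
fundamental form. -/
theorem conditionalFF_eq {k : ℕ} (hk0 : 1 ≤ k) (hk : d ≤ 2 * k + 2) (hk3 : k + 3 ≤ d) {F : Cov2 d}
    {t : Coord d → ℝ} (ht : ContDiffOn ℝ ∞ t U) (ht0 : ∀ x ∈ U, 0 < t x)
    (hE : ∀ a b, Lead U s k (fun x => secondFFExt G s x a b) (fun x => F x a b)) :
    ∃ c : ℝ, c ≠ 0 ∧ ∀ x ∈ U, s x = 0 → ∀ a b, conditionalFF G s t (k + 2) x a b = c * F x a b := by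
  refine ⟨_, logCoeff_ne_zero hk hk3, fun x hx h0 => ?_⟩
  obtain ⟨m, rfl⟩ : ∃ m, k = m + 1 := ⟨k - 1, by omega⟩
  obtain ⟨Q, hQ, hQ0, hQF⟩ := h.lead_tractorP hk3 hE
  have hL := h.lead_logCommutator ht ht0 hQ
  refine h.extractHyp_eq (fun A B => (hL A B).smooth h.defining) (fun y hy hy0 B => ?_) hx h0
    ((h.isTangential hk3 hE hx h0).smul _) fun a b => ?_
  · exact ((hL _ _).eq_of_zero hy hy0).trans (by rw [hQ0, mul_zero])
  · refine ((hL _ _).eq_of_zero hx h0).trans ?_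
    rw [hQF]
    simp only [raise, Finset.mul_sum]
    exact Finset.sum_congr rfl fun i _ => Finset.sum_congr rfl fun l _ => by ring

end IsUnitOn

end Conditional

end ConfHyp

end

noncomputable section

namespace ConfHyp

/-! ## Vanishing of the fundamental forms and asymptotically Einstein scales -/

section Scales

variable {d : ℕ} {U V : Set (Coord d)} {G : Cov2 d} {s u : Coord d → ℝ}

/-- Leading coefficients may be computed near the zero locus. -/
theorem Lead.of_subset {f h : Coord d → ℝ} {m : ℕ} (hV : IsOpen V) (hU : IsOpen U)
    (hs : ContDiffOn ℝ ∞ s U) (hf : ContDiffOn ℝ ∞ f U) (hUV : ∀ x ∈ U, s x = 0 → x ∈ V)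
    (hL : Lead V s m f h) : Lead U s m f h := by
  classical
  obtain ⟨k, hk, hk'⟩ := hL
  -- Away from the zero locus the quotient is simply `f / s^m`; near it this agrees with the given
  -- one.
  refine ⟨fun x => if s x = 0 then k x else f x / s x ^ m, fun x hx => ?_, fun x hx => ?_⟩
  · refine ContDiffAt.contDiffWithinAt ?_
    by_cases h0 : s x = 0
    · refine (hk.contDiffAt (hV.mem_nhds (hUV x hx h0))).congr_of_eventuallyEq ?_
      filter_upwards [hV.mem_nhds (hUV x hx h0)] with y hy
      split_ifs with hy0
      · rfl
      · rw [(hk' y hy).1, mul_div_cancel_left₀ _ (pow_ne_zero m hy0)]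
    · have hsx := hs.contDiffAt (hU.mem_nhds hx)
      refine ((hf.contDiffAt (hU.mem_nhds hx)).div (hsx.pow m)
        (pow_ne_zero m h0)).congr_of_eventuallyEq ?_
      filter_upwards [hsx.continuousAt.eventually_ne h0] with y hy
      rw [if_neg hy]
      rfl
  · by_cases h0 : s x = 0
    · have hxV := hUV x hx h0
      simp only [if_pos h0]
      exact ⟨(hk' x hxV).1, (hk' x hxV).2⟩
    · simp only [if_neg h0]
      exact ⟨(mul_div_cancel₀ _ (pow_ne_zero m h0)).symm, fun h => absurd h h0⟩

theorem nabla1_grad_mul (hU : IsOpen U) (hs : ContDiffOn ℝ ∞ s U) (hu : ContDiffOn ℝ ∞ u U)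
    {x : Coord d} (hx : x ∈ U) (a b : Fin d) :
    nabla1 G (grad fun y => u y * s y) x a b
      = u x * nabla1 G (grad s) x a b + (grad s x a * grad u x b + grad u x a * grad s x b
        + s x * nabla1 G (grad u) x a b) := by
  have hsx := fun y hy => differentiableAt_of_smooth (x := y) hU hs hy
  have hux := fun y hy => differentiableAt_of_smooth (x := y) hU hu hy
  have h1 : ∀ y ∈ U, ∀ b, pd b (fun y => u y * s y) y = u y * pd b s y + s y * pd b u y :=
    fun y hy b => pd_mul b (hux y hy) (hsx y hy)
  have hds := fun b => differentiableAt_of_smooth (x := x) hU (contDiffOn_pd hU hs b) hx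
  have hdu := fun b => differentiableAt_of_smooth (x := x) hU (contDiffOn_pd hU hu b) hx
  have h2 : pd a (fun y => pd b (fun y => u y * s y) y) x
      = u x * pd a (fun y => pd b s y) x + pd b s x * pd a u x
        + (s x * pd a (fun y => pd b u y) x + pd b u x * pd a s x) := by
    rw [pd_congr hU (fun y hy => h1 y hy b) a hx,
      pd_add a ((hux x hx).fun_mul (hds b)) ((hsx x hx).fun_mul (hdu b)),
      pd_mul a (hux x hx) (hds b), pd_mul a (hsx x hx) (hdu b)]
  simp only [nabla1, grad, h2, h1 x hx, mul_add, Finset.sum_add_distrib, mul_sub, Finset.mul_sum]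
  have h3 : ∀ (c : ℝ) (v : Fin d → ℝ), ∑ e, christ G e a b x * (c * v e)
      = ∑ e, c * (christ G e a b x * v e) := fun c v =>
    Finset.sum_congr rfl fun e _ => by ring
  rw [h3, h3]
  ring

/-- The change of the trace-free Hessian under multiplication of `s` by a function. -/
theorem secondFFExt_mul (hU : IsOpen U) (hs : ContDiffOn ℝ ∞ s U) (hu : ContDiffOn ℝ ∞ u U)
    {x : Coord d} (hx : x ∈ U) (a b : Fin d) :
    secondFFExt G (fun y => u y * s y) x a b = u x * secondFFExt G s x a b
      + (grad s x a * grad u x b + grad u x a * grad s x b + s x * nabla1 G (grad u) x a b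
        - trace G (fun x a b => grad s x a * grad u x b + grad u x a * grad s x b
          + s x * nabla1 G (grad u) x a b) x / d * G x a b) := by
  have h1 : trace G (nabla1 G (grad fun y => u y * s y)) x
      = u x * trace G (nabla1 G (grad s)) x
        + trace G (fun x a b => grad s x a * grad u x b + grad u x a * grad s x b
          + s x * nabla1 G (grad u) x a b) x := by
    simp only [trace, nabla1_grad_mul hU hs hu hx, mul_add, Finset.sum_add_distrib, Finset.mul_sum]
    congr 1
    exact Finset.sum_congr rfl fun e _ => Finset.sum_congr rfl fun f _ => by ring
  simp only [secondFFExt, nabla1_grad_mul hU hs hu hx, rho, h1]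
  ring

namespace IsUnitOn

variable (h : IsUnitOn U G s)
include h

/-- The tensor `E(us)` is `u E(s)` plus the trace-free part of `ds ⊗ du + du ⊗ ds + s ∇du`. The
orders of `E(s)` and of `du` are raised together: the unit condition makes the leading coefficient
of `E(s)` tangential, so its normal contraction decouples from that of the correction. -/
theorem lead_of_rescaled (hu : ContDiffOn ℝ ∞ u U) (hu0 : ∀ x ∈ U, s x = 0 → u x ≠ 0)
    (hE : ∀ a b, ∃ F, Lead U s (d - 2) (fun x => secondFFExt G (fun y => u y * s y) x a b) F)
    (k : ℕ) (hk : k ≤ d - 2) :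
    (∃ F : Cov2 d, ∀ a b, Lead U s k (fun x => secondFFExt G s x a b) fun x => F x a b) ∧
      ∃ w : Cov1 d, ∀ a, Lead U s k (fun x => grad u x a) fun x => w x a := by
  have hd := h.three_le
  have hG := h.metric
  have hs := h.defining
  have hd3 : (3 : ℝ) ≤ d := by exact_mod_cast hd
  have hgu : ∀ a, ContDiffOn ℝ ∞ (fun x => grad u x a) U := hG.grad_smooth hu
  induction k with
  | zero =>
    exact ⟨⟨_, fun a b => Lead.of_smooth (hG.secondFFExt_smooth hs.smooth a b)⟩,
      ⟨_, fun a => Lead.of_smooth (hgu a)⟩⟩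
  | succ k ih =>
    obtain ⟨⟨F, hF⟩, w, hw⟩ := ih (by omega)
    let M : Cov2 d := fun x a b => grad s x a * grad u x b + grad u x a * grad s x b
      + s x * nabla1 G (grad u) x a b
    -- The last summand is the leading coefficient of `s ∇du` when `du = s^k w`.
    let N : Cov2 d := fun x a b => grad s x a * w x b + w x a * grad s x b + k * pd a s x * w x b
    have hM : ∀ a b, Lead U s k (fun x => M x a b) (fun x => N x a b) := fun a b =>
      (((hw b).smooth_mul (h.grad_smooth a)).add ((hw a).mul_smooth (h.grad_smooth b))).add
        (Lead.s_nabla1 hs hG hw a b)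
    have key : ∀ x ∈ U, s x = 0 → (∀ a b, F x a b = 0) ∧ ∀ a, w x a = 0 := by
      intro x hx h0
      have hT := h.isTangential (by omega) hF hx h0
      have e1 : ∀ a b, u x * F x a b + (N x a b - trace G N x / d * G x a b) = 0 := by
        intro a b
        obtain ⟨F', hF'⟩ := hE a b
        have e2 := ((hF a b).smooth_mul hu).add ((hM a b).sub
          (((Lead.trace hG hM).const_mul (1 / (d : ℝ))).mul_smooth (hG.smooth a b)))
        have e3 := (e2.congr_left fun y hy => by
          rw [secondFFExt_mul hs.isOpen hs.smooth hu hy]; simp only [M]; ring).unique hs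
          (hF'.weaken hs (m := k) (by omega)) hx h0
        rw [← e3]
        ring
      have hn : ∑ b, grad s x b * raise G (grad s) x b = 1 := h.normSq_eq_one hx h0
      set α := ∑ b, w x b * raise G (grad s) x b with hα
      have hGn : ∀ a, ∑ b, G x a b * raise G (grad s) x b = grad s x a := fun a =>
        hG.lower_raise hx _ a
      have hNn : ∀ a, ∑ b, N x a b * raise G (grad s) x b
          = (1 + k) * α * grad s x a + w x a := by
        intro a
        have : ∀ b, N x a b * raise G (grad s) x b
            = (1 + k) * grad s x a * (w x b * raise G (grad s) x b)
              + w x a * (grad s x b * raise G (grad s) x b) := fun b => by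
          simp only [N, grad]; ring
        simp only [this, Finset.sum_add_distrib, ← Finset.mul_sum, hn, ← hα]
        ring
      have htr : trace G N x = (2 + k) * α := by
        have t1 : ∀ v w' : Fin d → ℝ, ∑ a, ∑ b, ginv G x a b * (v a * w' b)
            = ∑ b, w' b * ∑ a, ginv G x b a * v a := by
          intro v w'
          rw [Finset.sum_comm]
          simp only [Finset.mul_sum]
          refine Finset.sum_congr rfl fun b _ => Finset.sum_congr rfl fun a _ => ?_
          rw [hG.ginv_symm hx]; ring
        have t2 : ∑ a, ∑ b, ginv G x a b * (grad s x a * w x b) = α := t1 _ _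
        have t3 : ∑ a, ∑ b, ginv G x a b * (w x a * grad s x b) = α := by
          rw [← t2, Finset.sum_comm]
          refine Finset.sum_congr rfl fun b _ => Finset.sum_congr rfl fun a _ => ?_
          rw [hG.ginv_symm hx]; ring
        have t4 : ∀ a b, ginv G x a b * N x a b = (1 + k) * (ginv G x a b * (grad s x a * w x b))
            + ginv G x a b * (w x a * grad s x b) := fun a b => by simp only [N, grad]; ring
        simp only [trace, t4, Finset.sum_add_distrib, ← Finset.mul_sum, t2, t3]
        ring
      have e4 : ∀ a, (1 + k) * α * grad s x a + w x a - (2 + k) * α / d * grad s x a = 0 := by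
        intro a
        have e5 : ∑ b, (u x * F x a b + (N x a b - trace G N x / d * G x a b))
            * raise G (grad s) x b = 0 := by simp only [e1, zero_mul, Finset.sum_const_zero]
        simp only [add_mul, sub_mul, Finset.sum_add_distrib, Finset.sum_sub_distrib, mul_assoc,
          ← Finset.mul_sum, hT.normal, hGn] at e5
        rw [hNn, htr] at e5
        linear_combination e5
      -- A second contraction with the normal turns the equation for `w` into `(2+k)(1 - 1/d) α =
      -- 0`. Once `α = n · w` is zero, so is `w`, and then `u F = 0`.
      have hα0 : α = 0 := by
        have e6 : ∑ a, ((1 + k) * α * grad s x a + w x a - (2 + k) * α / d * grad s x a)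
            * raise G (grad s) x a = 0 := by simp only [e4, zero_mul, Finset.sum_const_zero]
        simp only [add_mul, sub_mul, Finset.sum_add_distrib, Finset.sum_sub_distrib, mul_assoc,
          ← Finset.mul_sum, hn] at e6
        rw [← hα] at e6
        have e7 : ((2 + k : ℝ) * (d - 1)) * α = 0 := by
          have : (d : ℝ) ≠ 0 := by linarith
          field_simp at e6
          linear_combination e6
        refine (mul_eq_zero.1 e7).resolve_left (mul_ne_zero (by positivity) ?_)
        intro h8; linarith
      have hw0 : ∀ a, w x a = 0 := fun a => by
        have := e4 a
        rw [hα0] at this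
        linear_combination this
      refine ⟨fun a b => ?_, hw0⟩
      have e8 := e1 a b
      rw [htr, hα0] at e8
      simp only [N, hw0, mul_zero, zero_mul, add_zero, zero_div, sub_zero] at e8
      exact (mul_eq_zero.1 e8).resolve_left (hu0 x hx h0)
    constructor
    · choose F' _ hF' using fun a b => (hF a b).succ hs fun x hx h0 => (key x hx h0).1 a b
      exact ⟨fun x a b => F' a b x, hF'⟩
    · choose w' _ hw' using fun a => (hw a).succ hs fun x hx h0 => (key x hx h0).2 a
      exact ⟨fun x a => w' a x, hw'⟩

/-- The second fundamental form vanishes to order `d - 2` if and only if all fundamental forms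
vanish. -/
theorem lead_iff {t : Coord d → ℝ} (ht : ContDiffOn ℝ ∞ t U) (ht0 : ∀ x ∈ U, 0 < t x) :
    (∃ F : Cov2 d, ∀ a b, Lead U s (d - 2) (fun x => secondFFExt G s x a b) fun x => F x a b) ↔
      ∀ k, k + 3 ≤ d → ∀ x ∈ U, s x = 0 → ∀ a b,
        (2 * k + 1 < d → canonicalFF G s (k + 2) x a b = 0) ∧
        (d ≤ 2 * k + 1 → conditionalFF G s t (k + 2) x a b = 0) := by
  have hd := h.three_le
  have hs := h.defining
  constructor
  · rintro ⟨F, hF⟩ k hk x hx h0 a b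
    -- Order `d - 2` exceeds `k`, so at order `k` the leading coefficient is zero, and every form is
    -- a multiple of it.
    have hE : ∀ a b, Lead U s k (fun x => secondFFExt G s x a b)
        (fun x => (fun _ _ _ => 0 : Cov2 d) x a b) := fun a b => (hF a b).weaken hs (by omega)
    refine ⟨fun hk2 => ?_, fun hk2 => ?_⟩
    · obtain ⟨c, -, hc⟩ := h.canonicalFF_eq hk2 hk hE
      rw [hc x hx h0, mul_zero]
    · obtain ⟨c, -, hc⟩ := h.conditionalFF_eq (by omega) (by omega) hk ht ht0 hE
      rw [hc x hx h0, mul_zero]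
  · intro hforms
    -- At each order the form with index `k + 2`, canonical or conditional according to the size of
    -- `k`, forces the leading coefficient to vanish, and Hadamard's lemma gains one order.
    have key : ∀ k, k ≤ d - 2 →
        ∃ F : Cov2 d, ∀ a b, Lead U s k (fun x => secondFFExt G s x a b) fun x => F x a b := by
      intro k
      induction k with
      | zero => exact fun _ =>
          ⟨_, fun a b => Lead.of_smooth (h.metric.secondFFExt_smooth hs.smooth a b)⟩
      | succ k ih =>
        intro hk
        obtain ⟨F, hF⟩ := ih (by omega)
        have hF0 : ∀ x ∈ U, s x = 0 → ∀ a b, F x a b = 0 := by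
          intro x hx h0 a b
          have hx' := hforms k (by omega) x hx h0 a b
          by_cases hk2 : 2 * k + 1 < d
          · obtain ⟨c, hc0, hc⟩ := h.canonicalFF_eq hk2 (by omega) hF
            have := hx'.1 hk2
            rw [hc x hx h0] at this
            exact (mul_eq_zero.1 this).resolve_left hc0
          · obtain ⟨c, hc0, hc⟩ := h.conditionalFF_eq (by omega) (by omega) (by omega) ht ht0 hF
            have := hx'.2 (by omega)
            rw [hc x hx h0] at this
            exact (mul_eq_zero.1 this).resolve_left hc0
        choose F' _ hF' using fun a b => (hF a b).succ hs fun x hx h0 => hF0 x hx h0 a b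
        exact ⟨fun x a b => F' a b x, hF'⟩
    exact key (d - 2) le_rfl

end IsUnitOn

end Scales

end ConfHyp

end

noncomputable section

namespace ConfHyp

/-! ## Invariance of the scale tractor under changes of coordinates -/

section Invariance

variable {d : ℕ} {U U' : Set (Coord d)} {G G' : Cov2 d} {s s' : Coord d → ℝ}

/-- Uniqueness of the Levi-Civita connection. -/
theorem IsMetricOn.eq_lc (hG : IsMetricOn U G) (L : LeviCivita (smoothAlg.D hG.isOpen))
    (hL : ∀ (x : U) i j, smoothAlg.ev x (L.G i j) = G x i j) : L = hG.lc := by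
  have e1 : L.G = hG.lc.G := Matrix.ext fun i j => smoothAlg.ext_ev fun x => hL x i j
  have e2 : L.gi = hG.lc.gi := by
    have h1 : L.G * L.gi = 1 := mul_eq_one_comm.1 L.gi_mul
    calc L.gi = hG.lc.gi * hG.lc.G * L.gi := by rw [hG.lc.gi_mul, one_mul]
      _ = hG.lc.gi := by rw [← e1, mul_assoc, h1, mul_one]
  have e3 : L.Γ = hG.lc.Γ := by
    funext i
    refine Matrix.ext fun k j => smoothAlg.ext_ev fun x => ?_
    rw [hG.ev_Γ]
    refine (hG.christ_unique x.2 (Γ := fun k i j => smoothAlg.ev x (L.Γ i k j))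
      (fun k i j => by rw [L.torsion]) (fun i j k => ?_) k i j).symm
    have h1 := congrArg (smoothAlg.ev x) (congrFun (congrFun (L.compat i) j) k)
    rw [dmat_apply, smoothAlg.ev_D_of hG.isOpen (f := fun y => G y j k) (fun x => hL x j k)] at h1
    rw [h1]
    simp only [Matrix.add_apply, Matrix.mul_apply, Matrix.transpose_apply, map_add, map_sum,
      map_mul, hL]
  obtain ⟨LG, Lgi, LΓ, _, _, _, _, _⟩ := L
  subst e1 e2 e3
  rfl

theorem pd_comp {θ : Coord d → Coord d} {f : Coord d → ℝ} {x : Coord d}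
    (hθ : DifferentiableAt ℝ θ x) (hf : DifferentiableAt ℝ f (θ x)) (i : Fin d) :
    pd i (fun y => f (θ y)) x = ∑ c, pd i (fun y => θ y c) x * pd c f (θ x) := by
  have h1 : fderiv ℝ (fun y => f (θ y)) x = (fderiv ℝ f (θ x)).comp (fderiv ℝ θ x) :=
    fderiv_comp x hf hθ
  have h2 : ∀ c, pd i (fun y => θ y c) x = fderiv ℝ θ x (EuclideanSpace.single i 1) c := by
    intro c
    have : fderiv ℝ (fun y => θ y c) x = (EuclideanSpace.proj c).comp (fderiv ℝ θ x) := by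
      have := ((EuclideanSpace.proj (𝕜 := ℝ) c).hasFDerivAt.comp x hθ.hasFDerivAt).fderiv
      exact this
    rw [pd, this]; rfl
  simp only [h2]
  rw [pd, h1, ContinuousLinearMap.comp_apply]
  set v := fderiv ℝ θ x (EuclideanSpace.single i 1) with hv
  have h3 : v = ∑ c, v c • EuclideanSpace.single c (1 : ℝ) := by
    ext a
    simp [Finset.sum_apply, Pi.single_apply]
  conv_lhs => rw [h3]
  rw [map_sum]
  exact Finset.sum_congr rfl fun c _ => by rw [map_smul, smul_eq_mul]; rfl

variable (hG : IsMetricOn U G) (hG' : IsMetricOn U' G') {θ : Coord d → Coord d}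
  (hθ : ContDiffOn ℝ ∞ θ U) (hθU : ∀ x ∈ U, θ x ∈ U')
  (hGG : ∀ x ∈ U, ∀ i j, G x i j
    = ∑ k, ∑ l, pd i (fun y => θ y k) x * pd j (fun y => θ y l) x * G' (θ x) k l)

theorem smooth_coord (hθ : ContDiffOn ℝ ∞ θ U) (k : Fin d) :
    ContDiffOn ℝ ∞ (fun y => θ y k) U :=
  (contDiffOn_euclidean (n := ∞)).1 hθ k

/-- The change of coordinates `θ` that pulls `G'` back to `G`. -/
def coordChange : CoordChange (smoothAlg.D hG'.isOpen) (smoothAlg.D hG.isOpen) where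
  f :=
    { toFun := fun a => smoothAlg.res (fun x => smoothAlg.rep a (θ x))
        ((smoothAlg.rep_smooth a).comp hθ hθU)
      map_one' := smoothAlg.ext_ev fun x => by
        simp only [smoothAlg.ev_res, smoothAlg.rep_apply _ (⟨θ x, hθU x x.2⟩ : U'), map_one]
      map_zero' := smoothAlg.ext_ev fun x => by
        simp only [smoothAlg.ev_res, smoothAlg.rep_apply _ (⟨θ x, hθU x x.2⟩ : U'), map_zero]
      map_mul' := fun a b => smoothAlg.ext_ev fun x => by
        simp only [smoothAlg.ev_res, smoothAlg.rep_apply _ (⟨θ x, hθU x x.2⟩ : U'), map_mul]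
      map_add' := fun a b => smoothAlg.ext_ev fun x => by
        simp only [smoothAlg.ev_res, smoothAlg.rep_apply _ (⟨θ x, hθU x x.2⟩ : U'), map_add] }
  j := Matrix.of fun c i => smoothAlg.res (pd i fun y => θ y c)
    (contDiffOn_pd hG.isOpen (smooth_coord hθ c) i)
  -- The inverse Jacobian comes from the metrics: `G = jᵀ G' j` and the invertibility of `G` show
  -- that `G⁻¹ jᵀ G'` is a left inverse of `j`.
  k := hG.lc.gi * (Matrix.of fun i c => smoothAlg.res (pd i fun y => θ y c)
    (contDiffOn_pd hG.isOpen (smooth_coord hθ c) i)) *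
    (Matrix.of fun c l => smoothAlg.res (fun x => G' (θ x) c l) ((hG'.smooth c l).comp hθ hθU))
  mul_k := by
    refine mul_eq_one_comm.1 ?_
    rw [mul_assoc, mul_assoc, ← hG.lc.gi_mul]
    congr 1
    refine Matrix.ext fun i j => smoothAlg.ext_ev fun x => ?_
    simp only [Matrix.mul_apply, Matrix.of_apply, map_sum, map_mul, smoothAlg.ev_res, hG.ev_G,
      hGG x x.2, Finset.mul_sum]
    exact Finset.sum_congr rfl fun k _ => Finset.sum_congr rfl fun l _ => by ring
  chain i a := smoothAlg.ext_ev fun x => by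
    simp only [RingHom.coe_mk, MonoidHom.coe_mk, OneHom.coe_mk, smoothAlg.ev_D_res, map_sum,
      map_mul, Matrix.of_apply, smoothAlg.ev_res]
    rw [pd_comp ((hθ.contDiffAt (hG.isOpen.mem_nhds x.2)).differentiableAt (by simp))
      (differentiableAt_of_smooth hG'.isOpen (smoothAlg.rep_smooth a) (hθU x x.2))]
    refine Finset.sum_congr rfl fun c _ => ?_
    rw [smoothAlg.rep_apply _ (⟨θ x, hθU x x.2⟩ : U')]
    rfl
  closed i l c := smoothAlg.ext_ev fun x => by
    simp only [Matrix.of_apply, smoothAlg.ev_D_res]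
    exact pd_comm hG.isOpen (smooth_coord hθ c) i l x.2

theorem ev_coordChange (x : U) (a : smoothAlg U') :
    smoothAlg.ev x ((coordChange hG hG' hθ hθU hGG).f a)
      = smoothAlg.ev (⟨θ x, hθU x x.2⟩ : U') a := smoothAlg.rep_apply a ⟨θ x, hθU x x.2⟩

/-- The transformed connection belongs to the metric `jᵀ G' j`, which equals `G`, and the
Levi-Civita connection is unique. -/
theorem coordChange_lc : (coordChange hG hG' hθ hθU hGG).leviCivita hG'.lc
    (smoothAlg.D_comm hG.isOpen) = hG.lc := by
  refine hG.eq_lc _ fun x i j => ?_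
  change smoothAlg.ev x (((coordChange hG hG' hθ hθU hGG).j.transpose
    * hG'.lc.G.map (coordChange hG hG' hθ hθU hGG).f * (coordChange hG hG' hθ hθU hGG).j) i j) = _
  simp only [Matrix.mul_apply, Matrix.transpose_apply, Matrix.map_apply, map_sum, map_mul,
    ev_coordChange, hG'.ev_G, hGG x x.2, Finset.sum_mul]
  rw [Finset.sum_comm]
  refine Finset.sum_congr rfl fun k _ => Finset.sum_congr rfl fun l _ => ?_
  change pd i (fun y => θ y k) x * G' (θ x) k l * pd j (fun y => θ y l) x = _
  ring

include hG hG' hθ hθU hGG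

/-- The squared length of the scale tractor does not depend on the coordinates. -/
theorem scaleTractorSq_comp (hs' : ContDiffOn ℝ ∞ s' U') (hss : ∀ x ∈ U, s x = s' (θ x))
    {x : Coord d} (hx : x ∈ U) : scaleTractorSq G s x = scaleTractorSq G' s' (θ x) := by
  have hs : ContDiffOn ℝ ∞ s U := (hs'.comp hθ hθU).congr hss
  let Φ := coordChange hG hG' hθ hθU hGG
  have hf : Φ.f (smoothAlg.res s' hs') = smoothAlg.res s hs := smoothAlg.ext_ev fun x => by
    rw [ev_coordChange, smoothAlg.ev_res, smoothAlg.ev_res, hss x x.2]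
  have hlc := coordChange_lc hG hG' hθ hθU hGG
  have h1 := congrArg (smoothAlg.ev ⟨x, hx⟩)
    (Φ.grad_sq_eq hG'.lc (smoothAlg.D_comm hG.isOpen) (smoothAlg.res s' hs'))
  have h2 := congrArg (smoothAlg.ev ⟨x, hx⟩) (Φ.Sc_eq hG'.lc (smoothAlg.D_comm hG.isOpen))
  have h3 := congrArg (smoothAlg.ev ⟨x, hx⟩) (Φ.trace_gi_mul hG'.lc (smoothAlg.D_comm hG.isOpen)
    (hG'.lc.cd1 fun i => smoothAlg.D hG'.isOpen i (smoothAlg.res s' hs')))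
  rw [← Φ.hessian_eq hG'.lc (smoothAlg.D_comm hG.isOpen)] at h3
  rw [hlc, hf, ev_coordChange] at h1 h3
  rw [hlc, ev_coordChange, hG.ev_Sc, hG'.ev_Sc] at h2
  rw [hG.ev_trace _ _ _ (hG.ev_hess hs _), hG'.ev_trace _ _ _ (hG'.ev_hess hs' _)] at h3
  simp only [map_sum, map_mul, smoothAlg.ev_D_res, hG.ev_gi, hG'.ev_gi] at h1
  have h4 : rho G s x = rho G' s' (θ x) := by
    simp only [rho, schoutenJ]
    rw [h2, h3, hss x hx]
  simp only [scaleTractorSq]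
  rw [h4, hss x hx]
  congr 1

end Invariance

end ConfHyp

end

noncomputable section

namespace ConfHyp

/-! ## Improving a defining function -/

section Improve

variable {d : ℕ} {U : Set (Coord d)} {G : Cov2 d} {s δ : Coord d → ℝ}

theorem sum_mul_raise_comm (hG : IsMetricOn U G) {x : Coord d} (hx : x ∈ U) (v w : Cov1 d) :
    ∑ a, v x a * raise G w x a = ∑ a, w x a * raise G v x a := by
  simp only [raise, Finset.mul_sum]
  rw [Finset.sum_comm]
  refine Finset.sum_congr rfl fun b _ => Finset.sum_congr rfl fun a _ => ?_
  rw [hG.ginv_symm hx]; ring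

theorem grad_add (hU : IsOpen U) (hs : ContDiffOn ℝ ∞ s U) (hδ : ContDiffOn ℝ ∞ δ U)
    {x : Coord d} (hx : x ∈ U) (a : Fin d) :
    grad (fun y => s y + δ y) x a = grad s x a + grad δ x a :=
  pd_add a (differentiableAt_of_smooth hU hs hx) (differentiableAt_of_smooth hU hδ hx)

theorem rho_add (hU : IsOpen U) (hs : ContDiffOn ℝ ∞ s U) (hδ : ContDiffOn ℝ ∞ δ U)
    {x : Coord d} (hx : x ∈ U) :
    rho G (fun y => s y + δ y) x = rho G s x + rho G δ x := by
  have h1 : ∀ a b, nabla1 G (grad fun y => s y + δ y) x a b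
      = nabla1 G (grad s) x a b + nabla1 G (grad δ) x a b := by
    intro a b
    have h2 : pd a (fun y => grad (fun y => s y + δ y) y b) x
        = pd a (fun y => grad s y b) x + pd a (fun y => grad δ y b) x := by
      rw [pd_congr hU (fun y hy => grad_add hU hs hδ hy b) a hx]
      exact pd_add a (differentiableAt_of_smooth hU (contDiffOn_pd hU hs b) hx)
        (differentiableAt_of_smooth hU (contDiffOn_pd hU hδ b) hx)
    simp only [nabla1, h2, grad_add hU hs hδ hx, mul_add, Finset.sum_add_distrib]
    ring
  have h3 : trace G (nabla1 G (grad fun y => s y + δ y)) x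
      = trace G (nabla1 G (grad s)) x + trace G (nabla1 G (grad δ)) x := by
    simp only [trace, h1, mul_add, Finset.sum_add_distrib]
  simp only [rho, h3]
  ring

theorem scaleTractorSq_add (hG : IsMetricOn U G) (hs : ContDiffOn ℝ ∞ s U)
    (hδ : ContDiffOn ℝ ∞ δ U) {x : Coord d} (hx : x ∈ U) :
    scaleTractorSq G (fun y => s y + δ y) x = scaleTractorSq G s x
      + (2 * ∑ a, raise G (grad s) x a * grad δ x a + ∑ a, raise G (grad δ) x a * grad δ x a
        + 2 * (s x * rho G δ x) + 2 * (rho G s x * δ x) + 2 * (rho G δ x * δ x)) := by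
  have h1 : ∀ a, raise G (grad fun y => s y + δ y) x a
      = raise G (grad s) x a + raise G (grad δ) x a := by
    intro a
    simp only [raise, grad_add hG.isOpen hs hδ hx, mul_add, Finset.sum_add_distrib]
  have h2 := sum_mul_raise_comm hG hx (grad s) (grad δ)
  simp only [scaleTractorSq, rho_add hG.isOpen hs hδ hx, h1, grad_add hG.isOpen hs hδ hx, add_mul,
    mul_add, Finset.sum_add_distrib, h2]
  simp only [mul_comm (raise G _ x _)]
  ring

theorem scaleTractorSq_mul_of_zero (hU : IsOpen U) {u : Coord d → ℝ} (hs : ContDiffOn ℝ ∞ s U)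
    (hu : ContDiffOn ℝ ∞ u U) {x : Coord d} (hx : x ∈ U) (h0 : s x = 0) :
    scaleTractorSq G (fun y => s y * u y) x = u x ^ 2 * scaleTractorSq G s x := by
  have h1 : ∀ a, grad (fun y => s y * u y) x a = u x * grad s x a := by
    intro a
    simp only [grad]
    rw [pd_mul a (differentiableAt_of_smooth hU hs hx) (differentiableAt_of_smooth hU hu hx), h0]
    ring
  simp only [scaleTractorSq, raise, h1, h0, mul_zero, zero_mul, add_zero, Finset.mul_sum]
  exact Finset.sum_congr rfl fun a _ => Finset.sum_congr rfl fun b _ => by ring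

/-- The factor `1 + y + y²` is positive and has the same linear part as the exponential. -/
theorem one_add_add_sq_pos (y : ℝ) : 0 < 1 + y + y ^ 2 := by nlinarith [sq_nonneg (y + 1 / 2)]

/-- The new function is `s + δ` with `δ = s^(m+2) f + …`. At order `m + 1` the term `2⟨ds, dδ⟩`
contributes `2(m+2)f` and `2sρ(δ)` contributes `-2(m+1)(m+2)f/d`; together they are
`2(m+2)(d-m-1)f/d`, chosen to cancel `A`. The change is made by a positive factor so that the zero
locus stays the same. -/
theorem lead_improve (hd : 3 ≤ d) (hG : IsMetricOn U G) (hs : IsDefiningOn U s) {m : ℕ}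
    {A : Coord d → ℝ}
    (hA : Lead U s (m + 1) (fun x => scaleTractorSq G s x - 1) A) {f : Coord d → ℝ}
    (hf : ContDiffOn ℝ ∞ f U)
    (hfA : ∀ x ∈ U, 2 * ((m : ℝ) + 2) * (d - m - 1) * f x = -(d * A x)) :
    ∃ B, Lead U s (m + 2) (fun x => scaleTractorSq G
      (fun y => s y * (1 + s y ^ (m + 1) * f y + (s y ^ (m + 1) * f y) ^ 2)) x - 1) B := by
  have hd0 : (d : ℝ) ≠ 0 := by
    have : (3 : ℝ) ≤ d := by exact_mod_cast hd
    linarith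
  have hy : ContDiffOn ℝ ∞ (fun x => s x ^ (m + 1) * f x) U := (hs.smooth.pow _).mul hf
  let δ : Coord d → ℝ := fun x => s x ^ (m + 2) * (f x * (1 + s x ^ (m + 1) * f x))
  have hδL : Lead U s (m + 1 + 1) δ f := by
    refine ⟨_, hf.mul (contDiffOn_const.add hy), fun x _ => ⟨rfl, fun h0 => ?_⟩⟩
    simp [h0]
  have hδ : ContDiffOn ℝ ∞ δ U := hδL.smooth hs
  have hδ0 := hδL.weaken hs (Nat.lt_succ_self (m + 1))
  have hn : ∀ x ∈ U, s x = 0 → ∑ a, raise G (grad s) x a * grad s x a = 1 := by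
    intro x hx h0
    have := hA.eq_zero hx h0
    simp only [scaleTractorSq, h0, mul_zero, zero_mul, add_zero] at this
    simp only [mul_comm (raise G _ x _)]
    linarith
  have hgδ : ∀ a, Lead U s (m + 1) (fun x => grad δ x a)
      (fun x => ((m + 1 : ℕ) + 1 : ℝ) * pd a s x * f x) := fun a => hδL.pd hs a
  have e1 : Lead U s (m + 1) (fun x => ∑ a, raise G (grad s) x a * grad δ x a)
      (fun x => (m + 2) * f x) := by
    refine (Lead.contract_raise hG (hG.grad_smooth hs.smooth) hgδ).congr_right fun x hx h0 => ?_
    have : ∀ a, raise G (grad s) x a * (((m + 1 : ℕ) + 1 : ℝ) * pd a s x * f x)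
        = ((m + 2) * f x) * (raise G (grad s) x a * grad s x a) := fun a => by
      simp only [grad]; push_cast; ring
    simp only [this, ← Finset.mul_sum, hn x hx h0, mul_one]
  have e2 : Lead U s (m + 1) (fun x => ∑ a, raise G (grad δ) x a * grad δ x a) (fun _ => 0) := by
    refine (Lead.contract_raise hG (hG.grad_smooth hδ) hgδ).congr_right fun x hx h0 => ?_
    have : ∀ a, raise G (grad δ) x a = 0 := fun a => Finset.sum_eq_zero fun b _ => by
      rw [(hgδ b).eq_zero hx h0, mul_zero]
    simp only [this, zero_mul, Finset.sum_const_zero]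
  have e3 : Lead U s (m + 1) (fun x => s x * rho G δ x)
      (fun x => -((m + 1) * (m + 2) / d * f x)) := by
    have t1 : Lead U s (m + 1) (fun x => trace G (fun x a b => s x * nabla1 G (grad δ) x a b) x)
        (fun x => (m + 1) * (m + 2) * f x) := by
      refine (Lead.trace hG (F := fun x a b => ((m + 1 : ℕ) : ℝ) * pd a s x
        * (((m + 1 : ℕ) + 1 : ℝ) * pd b s x * f x)) fun a b =>
        Lead.s_nabla1 hs hG (w := fun x a => ((m + 1 : ℕ) + 1 : ℝ) * pd a s x * f x)
          hgδ a b).congr_right fun x hx h0 => ?_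
      have : ∀ a b, ginv G x a b * (((m + 1 : ℕ) : ℝ) * pd a s x
          * (((m + 1 : ℕ) + 1 : ℝ) * pd b s x * f x))
          = ((m + 1) * (m + 2) * f x) * (ginv G x a b * (pd a s x * pd b s x)) := fun a b => by
        push_cast; ring
      simp only [trace, this, ← Finset.mul_sum]
      rw [sum_ginv_grad]
      simp only [mul_comm (grad s x _), hn x hx h0, mul_one]
    have t2 := (hδ0.smooth_mul hG.schoutenJ_smooth).s_mul hs
    refine ((t1.add t2).const_mul (-1 / d)).congr (fun x _ => ?_) fun x _ _ => by ring
    have : trace G (fun x a b => s x * nabla1 G (grad δ) x a b) x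
        = s x * trace G (nabla1 G (grad δ)) x := by
      simp only [trace, Finset.mul_sum]
      exact Finset.sum_congr rfl fun e _ => Finset.sum_congr rfl fun f _ => by ring
    rw [this, rho]
    ring
  have e4 := hδ0.smooth_mul (hG.rho_smooth hs.smooth)
  have e5 := hδ0.smooth_mul (hG.rho_smooth hδ)
  have key := hA.add (((((e1.const_mul 2).add e2).add (e3.const_mul 2)).add
    (e4.const_mul 2)).add (e5.const_mul 2))
  obtain ⟨B, -, hB⟩ := key.succ hs fun x hx h0 => by
    have := hfA x hx
    field_simp
    linear_combination this
  refine ⟨B, hB.congr_left fun x hx => ?_⟩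
  have : (fun y => s y * (1 + s y ^ (m + 1) * f y + (s y ^ (m + 1) * f y) ^ 2))
      = fun y => s y + δ y := funext fun y => by simp only [δ]; ring
  rw [this, scaleTractorSq_add hG hs.smooth hδ hx]
  ring

end Improve

end ConfHyp

end

noncomputable section

namespace ConfHyp

/-! ## Metrics and defining functions on a manifold -/

section Charts

open IsManifold

variable {d : ℕ} {M : Type*} [TopologicalSpace M] [ChartedSpace (Coord d) M]
  [IsManifold (𝓡 d) ∞ M] {φ ψ : OpenPartialHomeomorph M (Coord d)} {F : M → ℝ} {g : RMetric d M}

omit [IsManifold (𝓡 d) ∞ M] in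
theorem contDiffOn_of_contMDiff (hF : ContMDiff (𝓡 d) 𝓘(ℝ, ℝ) ∞ F)
    (hφ : φ ∈ maximalAtlas (𝓡 d) ∞ M) : ContDiffOn ℝ ∞ (F ∘ φ.symm) φ.target :=
  contMDiffOn_iff_contDiffOn.1 (hF.comp_contMDiffOn (contMDiffOn_symm_of_mem_maximalAtlas hφ))

theorem contMDiff_of_charts
    (h : ∀ φ ∈ maximalAtlas (𝓡 d) ∞ M, ContDiffOn ℝ ∞ (F ∘ φ.symm) φ.target) :
    ContMDiff (𝓡 d) 𝓘(ℝ, ℝ) ∞ F := by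
  intro p
  have hφ : chartAt (Coord d) p ∈ maximalAtlas (𝓡 d) ∞ M := chart_mem_maximalAtlas p
  have h1 := (contMDiffOn_iff_contDiffOn.2 (h _ hφ)).comp (contMDiffOn_of_mem_maximalAtlas hφ)
    (fun q hq => (chartAt (Coord d) p).map_source hq)
  refine (h1.contMDiffAt ((chartAt (Coord d) p).open_source.mem_nhds
    (mem_chart_source _ p))).congr_of_eventuallyEq ?_
  filter_upwards [(chartAt (Coord d) p).open_source.mem_nhds (mem_chart_source _ p)] with q hq
  simp [(chartAt (Coord d) p).left_inv hq]

omit [IsManifold (𝓡 d) ∞ M] in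
theorem mdifferentiable_of_mem_maximalAtlas (hφ : φ ∈ maximalAtlas (𝓡 d) ∞ M) :
    φ.MDifferentiable (𝓡 d) (𝓡 d) :=
  ⟨(contMDiffOn_of_mem_maximalAtlas hφ).mdifferentiableOn (by simp),
    (contMDiffOn_symm_of_mem_maximalAtlas hφ).mdifferentiableOn (by simp)⟩

/-- The coordinate vector field is the image of a constant field under the tangent map of the
inverse chart, hence smooth. -/
theorem contMDiffOn_comp_symm_vec (hφ : φ ∈ maximalAtlas (𝓡 d) ∞ M) (v : Coord d) :
    ContMDiffOn (𝓡 d) (𝓡 d).tangent ∞ (fun x => (⟨φ.symm x,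
      mfderiv 𝓘(ℝ, Coord d) (𝓡 d) φ.symm x v⟩ : TangentBundle (𝓡 d) M)) φ.target := by
  have h1 := (contMDiffOn_symm_of_mem_maximalAtlas hφ).contMDiffOn_tangentMapWithin
    (m := ∞) (by simp) φ.open_target.uniqueMDiffOn
  have h2 : ContMDiff (𝓡 d) (𝓡 d).tangent ∞
      (fun x : Coord d => (⟨x, v⟩ : TangentBundle (𝓡 d) (Coord d))) := by
    rw [← contMDiffOn_univ]
    exact contMDiffOn_vectorSpace_iff_contDiffOn.2 contDiffOn_const
  refine (h1.comp h2.contMDiffOn fun x hx => hx).congr fun x hx => ?_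
  simp only [Function.comp, tangentMapWithin]
  rw [mfderivWithin_of_isOpen φ.open_target hx]

theorem comp_smooth (hφ : φ ∈ maximalAtlas (𝓡 d) ∞ M) (i j : Fin d) :
    ContDiffOn ℝ ∞ (fun x => g.comp φ x i j) φ.target := by
  rw [← contMDiffOn_iff_contDiffOn]
  intro x hx
  have : ContMDiffWithinAt (𝓡 d) ((𝓡 d).prod 𝓘(ℝ)) ∞
      (fun x => Bundle.TotalSpace.mk' ℝ (E := Bundle.Trivial M ℝ) (φ.symm x) (g.comp φ x i j))
      φ.target x := by
    apply ContMDiffWithinAt.clm_bundle_apply₂ (F₁ := Coord d) (F₂ := Coord d)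
    · exact ContMDiffAt.comp_contMDiffWithinAt x g.contMDiff.contMDiffAt
        (contMDiffOn_symm_of_mem_maximalAtlas hφ x hx)
    · exact contMDiffOn_comp_symm_vec hφ _ x hx
    · exact contMDiffOn_comp_symm_vec hφ _ x hx
  simp only [Bundle.contMDiffWithinAt_totalSpace] at this
  exact this.2

omit [IsManifold (𝓡 d) ∞ M] in
theorem mfderiv_symm_injective (hφ : φ ∈ maximalAtlas (𝓡 d) ∞ M) {x : Coord d}
    (hx : x ∈ φ.target) :
    Function.Injective (mfderiv 𝓘(ℝ, Coord d) (𝓡 d) φ.symm x) :=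
  (mdifferentiable_of_mem_maximalAtlas hφ).symm.mfderiv_injective hx

omit [IsManifold (𝓡 d) ∞ M] in
theorem mfderiv_symm_surjective (hφ : φ ∈ maximalAtlas (𝓡 d) ∞ M) {x : Coord d}
    (hx : x ∈ φ.target) :
    Function.Surjective (mfderiv 𝓘(ℝ, Coord d) (𝓡 d) φ.symm x) :=
  (mdifferentiable_of_mem_maximalAtlas hφ).symm.mfderiv_surjective hx

theorem sum_smul_single (v : Coord d) : ∑ i, v i • EuclideanSpace.single i (1 : ℝ) = v := by
  ext a
  simp [Pi.single_apply]

theorem sum_comp (x : Coord d) (v w : Coord d) :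
    ∑ i, ∑ j, v i * w j * g.comp φ x i j
      = g.inner (φ.symm x) (mfderiv 𝓘(ℝ, Coord d) (𝓡 d) φ.symm x v)
          (mfderiv 𝓘(ℝ, Coord d) (𝓡 d) φ.symm x w) := by
  let L : Coord d →L[ℝ] TangentSpace (𝓡 d) (φ.symm x) := mfderiv 𝓘(ℝ, Coord d) (𝓡 d) φ.symm x
  change _ = g.inner (φ.symm x) (L v) (L w)
  conv_rhs => rw [← sum_smul_single v, ← sum_smul_single w]
  simp only [map_sum, map_smul, sum_apply, smul_apply,
    smul_eq_mul, Finset.mul_sum]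
  rw [Finset.sum_comm]
  refine Finset.sum_congr rfl fun i _ => Finset.sum_congr rfl fun j _ => ?_
  change _ * _ * g.inner (φ.symm x) (L _) (L _) = _
  ring

theorem posDef_comp (hφ : φ ∈ maximalAtlas (𝓡 d) ∞ M) {x : Coord d} (hx : x ∈ φ.target) :
    (Matrix.of (g.comp φ x)).PosDef := by
  refine Matrix.PosDef.of_dotProduct_mulVec_pos ?_ fun v hv => ?_
  · ext i j
    simp only [Matrix.conjTranspose_apply, Matrix.of_apply, star_trivial]
    exact g.symm _ _ _
  · have h1 := sum_comp (g := g) (φ := φ) x (WithLp.toLp 2 v) (WithLp.toLp 2 v)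
    have h2 : mfderiv 𝓘(ℝ, Coord d) (𝓡 d) φ.symm x (WithLp.toLp 2 v) ≠ 0 := by
      intro h0
      have h3 : (WithLp.toLp 2 v : Coord d) = 0 :=
        mfderiv_symm_injective hφ hx (h0.trans (map_zero _).symm)
      exact hv ((WithLp.toLp_eq_zero 2).1 h3)
    have h3 := g.pos _ _ h2
    rw [← h1] at h3
    refine lt_of_lt_of_eq h3 ?_
    simp only [dotProduct, Matrix.mulVec, Matrix.of_apply, star_trivial, Finset.mul_sum]
    exact Finset.sum_congr rfl fun i _ => Finset.sum_congr rfl fun j _ => by ring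

theorem isMetricOn_comp (g : RMetric d M) (hφ : φ ∈ maximalAtlas (𝓡 d) ∞ M) :
    IsMetricOn φ.target (g.comp φ) where
  isOpen := φ.open_target
  smooth := comp_smooth hφ
  symm _ _ _ _ := g.symm _ _ _
  det _ hx := (Matrix.isUnit_iff_isUnit_det _).1 (posDef_comp hφ hx).isUnit

theorem grad_sq_pos (hφ : φ ∈ maximalAtlas (𝓡 d) ∞ M) {x : Coord d} (hx : x ∈ φ.target)
    {s : Coord d → ℝ} (hs : fderiv ℝ s x ≠ 0) :
    0 < ∑ a, grad s x a * raise (g.comp φ) (grad s) x a := by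
  have h1 := (posDef_comp (g := g) hφ hx).inv
  have h2 : (fun a => grad s x a) ≠ 0 := by
    intro h0
    apply hs
    refine ContinuousLinearMap.ext fun v => ?_
    rw [← sum_smul_single v, map_sum]
    refine Finset.sum_eq_zero fun i _ => ?_
    rw [map_smul, show fderiv ℝ s x (EuclideanSpace.single i 1) = 0 from congrFun h0 i, smul_zero]
  have h3 := h1.dotProduct_mulVec_pos h2
  refine lt_of_lt_of_eq h3 ?_
  simp only [dotProduct, Matrix.mulVec, raise, ginv]
  rfl

omit [IsManifold (𝓡 d) ∞ M] in
theorem fderiv_comp_symm (hφ : φ ∈ maximalAtlas (𝓡 d) ∞ M) (hF : ContMDiff (𝓡 d) 𝓘(ℝ, ℝ) ∞ F)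
    {x : Coord d} (hx : x ∈ φ.target) : fderiv ℝ (F ∘ φ.symm) x
      = (mfderiv (𝓡 d) 𝓘(ℝ, ℝ) F (φ.symm x)).comp (mfderiv 𝓘(ℝ, Coord d) (𝓡 d) φ.symm x) := by
  rw [← mfderiv_eq_fderiv]
  exact mfderiv_comp x (hF.mdifferentiableAt (by simp))
    ((mdifferentiable_of_mem_maximalAtlas hφ).mdifferentiableAt_symm hx)

omit [IsManifold (𝓡 d) ∞ M] in
theorem IsDefiningFunction.isDefiningOn {S : Set M} {s : M → ℝ}
    (hs : IsDefiningFunction (d := d) S s) (hφ : φ ∈ maximalAtlas (𝓡 d) ∞ M) :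
    IsDefiningOn φ.target (s ∘ φ.symm) where
  isOpen := φ.open_target
  smooth := contDiffOn_of_contMDiff hs.1 hφ
  regular x hx h0 := by
    rw [fderiv_comp_symm hφ hs.1 hx]
    intro h1
    refine hs.2.2 (φ.symm x) ((hs.2.1 _).2 h0) (ContinuousLinearMap.ext fun v => ?_)
    obtain ⟨w, rfl⟩ := mfderiv_symm_surjective hφ hx v
    exact congrArg (fun L : Coord d →L[ℝ] ℝ => L w) h1

theorem isDefiningFunction_of_charts {S : Set M} {s : M → ℝ}
    (hs : ∀ φ ∈ maximalAtlas (𝓡 d) ∞ M, IsDefiningOn φ.target (s ∘ φ.symm))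
    (hS : ∀ p, p ∈ S ↔ s p = 0) : IsDefiningFunction (d := d) S s := by
  have hsm := contMDiff_of_charts fun φ hφ => (hs φ hφ).smooth
  refine ⟨hsm, hS, fun p hp h0 => ?_⟩
  have hφ : chartAt (Coord d) p ∈ maximalAtlas (𝓡 d) ∞ M := chart_mem_maximalAtlas p
  have hx := mem_chart_target (Coord d) p
  have hp' : (chartAt (Coord d) p).symm (chartAt (Coord d) p p) = p :=
    (chartAt (Coord d) p).left_inv (mem_chart_source _ p)
  refine (hs _ hφ).regular _ hx (by simp only [Function.comp, hp']; exact (hS p).1 hp) ?_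
  rw [fderiv_comp_symm hφ hsm hx, hp', h0]
  rfl

/-- The components of a metric in two charts. -/
theorem comp_change (hφ : φ ∈ maximalAtlas (𝓡 d) ∞ M) (hψ : ψ ∈ maximalAtlas (𝓡 d) ∞ M)
    {x : Coord d} (hx : x ∈ φ.target) (hxψ : φ.symm x ∈ ψ.source) (i j : Fin d) :
    g.comp φ x i j = ∑ k, ∑ l, pd i (fun y => ψ (φ.symm y) k) x
      * pd j (fun y => ψ (φ.symm y) l) x * g.comp ψ (ψ (φ.symm x)) k l := by
  have hθ : MDifferentiableAt 𝓘(ℝ, Coord d) 𝓘(ℝ, Coord d) (ψ ∘ φ.symm) x :=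
    ((mdifferentiable_of_mem_maximalAtlas hψ).mdifferentiableAt hxψ).comp x
      ((mdifferentiable_of_mem_maximalAtlas hφ).mdifferentiableAt_symm hx)
  have hθd : DifferentiableAt ℝ (fun y => ψ (φ.symm y)) x := hθ.differentiableAt
  have hp : ψ.symm (ψ (φ.symm x)) = φ.symm x := ψ.left_inv hxψ
  let B : M → Coord d →L[ℝ] Coord d →L[ℝ] ℝ := g.inner
  let K : Coord d →L[ℝ] Coord d := mfderiv 𝓘(ℝ, Coord d) (𝓡 d) φ.symm x
  let L : Coord d →L[ℝ] Coord d := mfderiv 𝓘(ℝ, Coord d) (𝓡 d) ψ.symm (ψ (φ.symm x))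
  let A : Coord d →L[ℝ] Coord d := fderiv ℝ (fun y => ψ (φ.symm y)) x
  have h1 : K = L.comp A := by
    have h2 : (φ.symm : Coord d → M) =ᶠ[nhds x] ψ.symm ∘ (ψ ∘ φ.symm) := by
      filter_upwards [φ.continuousAt_symm hx (ψ.open_source.mem_nhds hxψ)] with y hy
      exact (ψ.left_inv hy).symm
    have h3 := mfderiv_comp x ((mdifferentiable_of_mem_maximalAtlas hψ).mdifferentiableAt_symm
      (ψ.map_source hxψ)) hθ
    have h4 : K = mfderiv 𝓘(ℝ, Coord d) (𝓡 d) (ψ.symm ∘ (ψ ∘ φ.symm)) x := h2.mfderiv_eq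
    rw [h4, h3, mfderiv_eq_fderiv]
    rfl
  have h2 : ∀ i k, pd i (fun y => ψ (φ.symm y) k) x = A (EuclideanSpace.single i 1) k := by
    intro i k
    have : fderiv ℝ (fun y => ψ (φ.symm y) k) x = (EuclideanSpace.proj k).comp A :=
      ((EuclideanSpace.proj (𝕜 := ℝ) k).hasFDerivAt.comp x hθd.hasFDerivAt).fderiv
    rw [pd, this]; rfl
  simp only [h2]
  rw [sum_comp]
  change B (φ.symm x) (K _) (K _) = B (ψ.symm (ψ (φ.symm x))) (L _) (L _)
  rw [hp, h1]
  rfl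

end Charts

end ConfHyp

end

noncomputable section

namespace ConfHyp

/-! ## Existence of asymptotic unit defining densities -/

section Existence

open IsManifold

variable {d : ℕ} {M : Type*} [TopologicalSpace M] [ChartedSpace (Coord d) M]
  [IsManifold (𝓡 d) ∞ M] {φ : OpenPartialHomeomorph M (Coord d)} {g : RMetric d M} {S : Set M}
  {s : M → ℝ}

/-- The squared length of the scale tractor as a function on the manifold. -/
def unitSq (g : RMetric d M) (s : M → ℝ) (p : M) : ℝ :=
  scaleTractorSq (g.comp (chartAt (Coord d) p)) (s ∘ (chartAt (Coord d) p).symm)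
    (chartAt (Coord d) p p)

/-- The definition evaluates in the preferred chart at each point; invariance under coordinate
changes shows that any chart gives the same value. The corrections to a defining function can then
be made with global functions. -/
theorem unitSq_eq (hs : ContMDiff (𝓡 d) 𝓘(ℝ, ℝ) ∞ s) (hφ : φ ∈ maximalAtlas (𝓡 d) ∞ M)
    {x : Coord d} (hx : x ∈ φ.target) :
    unitSq g s (φ.symm x) = scaleTractorSq (g.comp φ) (s ∘ φ.symm) x := by
  set ψ := chartAt (Coord d) (φ.symm x) with hψ_def
  have hψ : ψ ∈ maximalAtlas (𝓡 d) ∞ M := chart_mem_maximalAtlas (φ.symm x)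
  have hxψ : φ.symm x ∈ ψ.source := mem_chart_source _ _
  have hopen : IsOpen (φ.target ∩ φ.symm ⁻¹' ψ.source) :=
    φ.symm.isOpen_inter_preimage ψ.open_source
  refine (scaleTractorSq_comp ((isMetricOn_comp g hφ).mono Set.inter_subset_left hopen)
    (isMetricOn_comp g hψ) (θ := fun y => ψ (φ.symm y)) (s' := s ∘ ψ.symm) ?_ ?_ ?_
    (contDiffOn_of_contMDiff hs hψ) ?_ ⟨hx, hxψ⟩).symm
  · exact contMDiffOn_iff_contDiffOn.1 ((contMDiffOn_of_mem_maximalAtlas hψ).comp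
      ((contMDiffOn_symm_of_mem_maximalAtlas hφ).mono Set.inter_subset_left) fun y hy => hy.2)
  · exact fun y hy => ψ.map_source hy.2
  · exact fun y hy => comp_change hφ hψ hy.1 hy.2
  · intro y hy
    simp only [Function.comp, ψ.left_inv hy.2]

theorem contMDiff_unitSq (hs : ContMDiff (𝓡 d) 𝓘(ℝ, ℝ) ∞ s) :
    ContMDiff (𝓡 d) 𝓘(ℝ, ℝ) ∞ (unitSq g s) :=
  contMDiff_of_charts fun _ hφ => ((isMetricOn_comp g hφ).scaleTractorSq_smooth
    (contDiffOn_of_contMDiff hs hφ)).congr fun _ hx => unitSq_eq hs hφ hx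

/-- A function that is divisible by a power of the defining function in every chart is divisible on
the manifold. -/
theorem exists_contMDiff_of_lead (hs : IsDefiningFunction (d := d) S s) {F : M → ℝ} {m : ℕ}
    (h : ∀ φ ∈ maximalAtlas (𝓡 d) ∞ M, ∃ B, Lead φ.target (s ∘ φ.symm) m (F ∘ φ.symm) B) :
    ∃ H : M → ℝ, ContMDiff (𝓡 d) 𝓘(ℝ, ℝ) ∞ H ∧ ∀ p, F p = s p ^ m * H p := by
  classical
  have h1 : ∀ φ : maximalAtlas (𝓡 d) ∞ M, ∃ k, ContDiffOn ℝ ∞ k φ.1.target ∧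
      ∀ x ∈ φ.1.target, F (φ.1.symm x) = s (φ.1.symm x) ^ m * k x := fun φ => by
    obtain ⟨B, k, hk, hk'⟩ := h φ.1 φ.2
    exact ⟨k, hk, fun x hx => (hk' x hx).1⟩
  choose k hk hFk using h1
  let c : M → maximalAtlas (𝓡 d) ∞ M := fun p =>
    ⟨chartAt (Coord d) p, chart_mem_maximalAtlas p⟩
  have hc : ∀ p, p ∈ (c p).1.source := fun p => mem_chart_source _ p
  -- At a zero of `s` the quotient in the preferred chart is used. Quotients in different charts
  -- agree there by continuity, since the points with `s ≠ 0` accumulate.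
  let H : M → ℝ := fun p => if s p = 0 then k (c p) ((c p).1 p) else F p / s p ^ m
  have hH : ∀ φ : maximalAtlas (𝓡 d) ∞ M, ∀ x ∈ φ.1.target, H (φ.1.symm x) = k φ x := by
    intro φ x hx
    by_cases h0 : s (φ.1.symm x) = 0
    · simp only [H, if_pos h0]
      set ψ := c (φ.1.symm x)
      have hxψ : φ.1.symm x ∈ ψ.1.source := hc _
      have hcont : ContinuousAt (fun y => ψ.1 (φ.1.symm y)) x :=
        (ψ.1.continuousAt hxψ).comp (φ.1.continuousAt_symm hx)
      refine eq_of_eventually_ne_zero (s := s ∘ φ.1.symm)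
        (f := fun y => k ψ (ψ.1 (φ.1.symm y))) (g := k φ)
        (fun h0 => (hs.isDefiningOn φ.2).regular x hx h0) ?_
        ((hk φ).contDiffAt (φ.1.open_target.mem_nhds hx)).continuousAt ?_
      · exact ContinuousAt.comp (g := k ψ) ((hk ψ).contDiffAt
          (ψ.1.open_target.mem_nhds (ψ.1.map_source hxψ))).continuousAt hcont
      · filter_upwards [φ.1.open_target.mem_nhds hx,
          φ.1.continuousAt_symm hx (ψ.1.open_source.mem_nhds hxψ)] with y hy hyψ hy0
        have e1 := hFk ψ _ (ψ.1.map_source hyψ)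
        rw [ψ.1.left_inv hyψ, hFk φ y hy] at e1
        exact (mul_left_cancel₀ (pow_ne_zero m hy0) e1).symm
    · simp only [H, if_neg h0]
      rw [hFk φ x hx, mul_div_cancel_left₀ _ (pow_ne_zero m h0)]
  refine ⟨H, contMDiff_of_charts fun φ hφ => (hk ⟨φ, hφ⟩).congr fun x hx => hH ⟨φ, hφ⟩ x hx,
    fun p => ?_⟩
  have hp : (c p).1.symm ((c p).1 p) = p := (c p).1.left_inv (hc p)
  have e1 := hH (c p) _ ((c p).1.map_source (hc p))
  have e2 := hFk (c p) _ ((c p).1.map_source (hc p))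
  rw [hp] at e1 e2
  rw [e1, e2]

theorem IsDefiningOn.mul {U : Set (Coord d)} {s u : Coord d → ℝ} (hs : IsDefiningOn U s)
    (hu : ContDiffOn ℝ ∞ u U) (hu0 : ∀ x ∈ U, u x ≠ 0) :
    IsDefiningOn U fun x => s x * u x where
  isOpen := hs.isOpen
  smooth := hs.smooth.mul hu
  regular x hx h0 := by
    have hs0 : s x = 0 := (mul_eq_zero.1 h0).resolve_right (hu0 x hx)
    rw [fderiv_fun_mul (differentiableAt_of_smooth hs.isOpen hs.smooth hx)
      (differentiableAt_of_smooth hs.isOpen hu hx), hs0, zero_smul, zero_add]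
    exact smul_ne_zero (hu0 x hx) (hs.regular x hx hs0)

theorem IsDefiningFunction.mul {u : M → ℝ} (hs : IsDefiningFunction (d := d) S s)
    (hu : ContMDiff (𝓡 d) 𝓘(ℝ, ℝ) ∞ u) (hu0 : ∀ p, u p ≠ 0) :
    IsDefiningFunction (d := d) S fun p => s p * u p :=
  isDefiningFunction_of_charts (fun _ hφ => (hs.isDefiningOn hφ).mul
    (contDiffOn_of_contMDiff hu hφ) fun _ _ => hu0 _) fun p => by
    rw [hs.2.1, mul_eq_zero, or_iff_left (hu0 p)]

theorem scaleTractorSq_of_zero {G : Cov2 d} {s : Coord d → ℝ} {x : Coord d}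
    (h0 : s x = 0) : scaleTractorSq G s x = ∑ a, grad s x a * raise G (grad s) x a := by
  simp [scaleTractorSq, h0]

theorem unitSq_pos (hs : IsDefiningFunction (d := d) S s) {p : M} (hp : s p = 0) :
    0 < unitSq g s p := by
  have hφ : chartAt (Coord d) p ∈ maximalAtlas (𝓡 d) ∞ M := chart_mem_maximalAtlas p
  have hx := mem_chart_target (Coord d) p
  have h0 : (s ∘ (chartAt (Coord d) p).symm) (chartAt (Coord d) p p) = 0 := by
    simp only [Function.comp, (chartAt (Coord d) p).left_inv (mem_chart_source _ p), hp]
  rw [unitSq, scaleTractorSq_of_zero h0]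
  exact grad_sq_pos hφ hx ((hs.isDefiningOn hφ).regular _ hx h0)

/-- A defining function with unit length scale tractor along the hypersurface. -/
theorem exists_unitSq_eq_one (g : RMetric d M) (hs : IsDefiningFunction (d := d) S s) :
    ∃ s' : M → ℝ, IsDefiningFunction (d := d) S s' ∧ ∀ p, s' p = 0 → unitSq g s' p = 1 := by
  let I : M → ℝ := unitSq g s
  have hI : ContMDiff (𝓡 d) 𝓘(ℝ, ℝ) ∞ I := contMDiff_unitSq hs.1
  have hpos : ∀ p, 0 < I p ^ 2 + s p ^ 2 := by
    intro p
    by_cases h0 : s p = 0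
    · have := unitSq_pos (g := g) hs h0
      positivity
    · positivity
  -- This is `(I² + s²)^(-1/4)`. Along the hypersurface it equals `I^(-1/2)`, the normalizing
  -- factor, while the summand `s²` keeps it smooth and positive where `I` may fail to be positive.
  let u : M → ℝ := fun p => (Real.sqrt (Real.sqrt (I p ^ 2 + s p ^ 2)))⁻¹
  have hu0 : ∀ p, 0 < u p := fun p =>
    inv_pos.2 (Real.sqrt_pos.2 (Real.sqrt_pos.2 (hpos p)))
  have hu : ContMDiff (𝓡 d) 𝓘(ℝ, ℝ) ∞ u := contMDiff_of_charts fun φ hφ => by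
    have h1 := contDiffOn_of_contMDiff hI hφ
    have h2 := contDiffOn_of_contMDiff hs.1 hφ
    exact ((((h1.pow 2).add (h2.pow 2)).sqrt fun x _ => (hpos _).ne').sqrt
      fun x _ => (Real.sqrt_pos.2 (hpos _)).ne').inv
      fun x _ => (Real.sqrt_pos.2 (Real.sqrt_pos.2 (hpos _))).ne'
  refine ⟨fun p => s p * u p, hs.mul hu fun p => (hu0 p).ne', fun p hp => ?_⟩
  have h0 : s p = 0 := (mul_eq_zero.1 hp).resolve_right (hu0 p).ne'
  have hφ : chartAt (Coord d) p ∈ maximalAtlas (𝓡 d) ∞ M := chart_mem_maximalAtlas p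
  have hp' : (chartAt (Coord d) p).symm (chartAt (Coord d) p p) = p :=
    (chartAt (Coord d) p).left_inv (mem_chart_source _ p)
  have h1 := scaleTractorSq_mul_of_zero (G := g.comp (chartAt (Coord d) p))
    (chartAt (Coord d) p).open_target (contDiffOn_of_contMDiff hs.1 hφ)
    (contDiffOn_of_contMDiff hu hφ) (mem_chart_target (Coord d) p)
    (by simp only [Function.comp, hp', h0])
  have h2 : unitSq g (fun p => s p * u p) p = u p ^ 2 * I p := by
    simp only [Function.comp, hp'] at h1
    exact h1
  have hIp : 0 < I p := unitSq_pos hs h0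
  rw [h2]
  simp only [u, h0]
  rw [inv_pow, Real.sq_sqrt (Real.sqrt_nonneg _), zero_pow two_ne_zero, add_zero,
    Real.sqrt_sq hIp.le, inv_mul_cancel₀ hIp.ne']

theorem exists_unitSq_eq (hd : 3 ≤ d) (g : RMetric d M) (hs : IsDefiningFunction (d := d) S s)
    (m : ℕ) (hm : m < d) : ∃ s' : M → ℝ, IsDefiningFunction (d := d) S s' ∧
      ∃ A : M → ℝ, ContMDiff (𝓡 d) 𝓘(ℝ, ℝ) ∞ A ∧
        ∀ p, unitSq g s' p - 1 = s' p ^ (m + 1) * A p := by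
  induction m with
  | zero =>
    obtain ⟨s', hs', h1⟩ := exists_unitSq_eq_one g hs
    refine ⟨s', hs', exists_contMDiff_of_lead hs' fun φ hφ => ?_⟩
    have h2 := contDiffOn_of_contMDiff (contMDiff_unitSq (g := g) hs'.1) hφ
    obtain ⟨B, -, hB⟩ := (Lead.of_smooth (h2.sub contDiffOn_const)).succ (hs'.isDefiningOn hφ)
      (f := fun x => unitSq g s' (φ.symm x) - 1) fun x _ h0 => by
        change unitSq g s' (φ.symm x) - 1 = 0
        rw [h1 _ h0, sub_self]
    exact ⟨B, hB⟩
  | succ m ih =>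
    obtain ⟨s₁, hs₁, A, hA, hA'⟩ := ih (by omega)
    have hmd : (m : ℝ) + 1 + 1 ≤ d := by exact_mod_cast hm
    have hc : 2 * ((m : ℝ) + 2) * (d - m - 1) ≠ 0 := by
      have : 0 < (d : ℝ) - m - 1 := by linarith
      positivity
    -- The solution of the linear equation of `lead_improve`; the denominator is nonzero because `m
    -- + 1 < d`.
    let f : M → ℝ := fun p => -d / (2 * ((m : ℝ) + 2) * (d - m - 1)) * A p
    have hf : ContMDiff (𝓡 d) 𝓘(ℝ, ℝ) ∞ f := contMDiff_of_charts fun φ hφ =>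
      contDiffOn_const.mul (contDiffOn_of_contMDiff hA hφ)
    let v : M → ℝ := fun p => 1 + s₁ p ^ (m + 1) * f p + (s₁ p ^ (m + 1) * f p) ^ 2
    have hv0 : ∀ p, 0 < v p := fun p => one_add_add_sq_pos _
    have hv : ContMDiff (𝓡 d) 𝓘(ℝ, ℝ) ∞ v := contMDiff_of_charts fun φ hφ => by
      have h1 := ((contDiffOn_of_contMDiff hs₁.1 hφ).pow (m + 1)).mul
        (contDiffOn_of_contMDiff hf hφ)
      exact (contDiffOn_const.add h1).add (h1.pow 2)
    have hs' := hs₁.mul hv fun p => (hv0 p).ne'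
    have key : ∃ H : M → ℝ, ContMDiff (𝓡 d) 𝓘(ℝ, ℝ) ∞ H ∧
        ∀ p, unitSq g (fun p => s₁ p * v p) p - 1 = s₁ p ^ (m + 2) * H p := by
      refine exists_contMDiff_of_lead hs₁ fun φ hφ => ?_
      obtain ⟨B, hB⟩ := lead_improve hd (isMetricOn_comp g hφ) (hs₁.isDefiningOn hφ) (m := m)
        (A := A ∘ φ.symm) ⟨_, contDiffOn_of_contMDiff hA hφ, fun x hx =>
          ⟨by dsimp only; rw [← unitSq_eq hs₁.1 hφ hx]; exact hA' _, fun _ => rfl⟩⟩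
        (contDiffOn_of_contMDiff hf hφ) fun x _ => by
          simp only [Function.comp, f]
          rw [← mul_assoc, mul_div_cancel₀ _ hc, neg_mul]
      exact ⟨B, hB.congr_left fun x hx => by
        simp only [Function.comp]
        rw [unitSq_eq hs'.1 hφ hx]
        rfl⟩
    obtain ⟨H, hH, hH'⟩ := key
    -- The remainder was expressed by powers of the old `s₁`; dividing by `v^(m+2)` rewrites it in
    -- powers of the new `s₁ v`.
    refine ⟨_, hs', fun p => H p / v p ^ (m + 2), contMDiff_of_charts fun φ hφ => ?_, fun p => ?_⟩
    · exact (contDiffOn_of_contMDiff hH hφ).div ((contDiffOn_of_contMDiff hv hφ).pow _)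
        fun x _ => pow_ne_zero _ (hv0 _).ne'
    · rw [hH', mul_pow]
      have := (hv0 p).ne'
      field_simp

theorem exists_isAsymptoticUnitDefining (hd : 3 ≤ d) (g : RMetric d M)
    (hs : IsDefiningFunction (d := d) S s) : ∃ s' : M → ℝ, IsAsymptoticUnitDefining g S s' := by
  obtain ⟨s', hs', A, hA, hA'⟩ := exists_unitSq_eq hd g hs (d - 1) (by omega)
  refine ⟨s', hs', fun φ hφ => ⟨A ∘ φ.symm, contDiffOn_of_contMDiff hA hφ, fun x hx => ?_⟩⟩
  have h1 := hA' (φ.symm x)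
  rw [unitSq_eq hs'.1 hφ hx, show d - 1 + 1 = d by omega] at h1
  simp only [Function.comp]
  linear_combination h1

end Existence

end ConfHyp

end

noncomputable section

namespace ConfHyp

/-! ## Asymptotically Poincaré-Einstein metrics and the fundamental forms -/

section Main

open IsManifold

variable {d : ℕ} {M : Type*} [TopologicalSpace M] [ChartedSpace (Coord d) M]
  [IsManifold (𝓡 d) ∞ M] {φ : OpenPartialHomeomorph M (Coord d)} {g : RMetric d M} {S : Set M}
  {s t : M → ℝ}

/-- The part of a chart domain where `ds` does not vanish. -/
def regularPart (g : RMetric d M) (s : M → ℝ) (φ : OpenPartialHomeomorph M (Coord d)) :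
    Set (Coord d) :=
  {x ∈ φ.target | 0 < ∑ a, grad (s ∘ φ.symm) x a
    * raise (g.comp φ) (grad (s ∘ φ.symm)) x a}

theorem isOpen_regularPart (hs : IsDefiningFunction (d := d) S s)
    (hφ : φ ∈ maximalAtlas (𝓡 d) ∞ M) : IsOpen (regularPart g s φ) := by
  have hG := isMetricOn_comp g hφ
  have h1 := hG.grad_smooth (hs.isDefiningOn hφ).smooth
  exact (ContDiffOn.sum fun a _ => (h1 a).mul (hG.raise_smooth h1 a)).continuousOn.isOpen_inter_preimage
    φ.open_target isOpen_Ioi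

theorem mem_regularPart (hs : IsDefiningFunction (d := d) S s)
    (hφ : φ ∈ maximalAtlas (𝓡 d) ∞ M) {x : Coord d} (hx : x ∈ φ.target)
    (h0 : (s ∘ φ.symm) x = 0) : x ∈ regularPart g s φ :=
  ⟨hx, grad_sq_pos hφ hx ((hs.isDefiningOn hφ).regular x hx h0)⟩

theorem IsAsymptoticUnitDefining.isUnitOn (hd : 3 ≤ d) (hs : IsAsymptoticUnitDefining g S s)
    (hφ : φ ∈ maximalAtlas (𝓡 d) ∞ M) :
    IsUnitOn (regularPart g s φ) (g.comp φ) (s ∘ φ.symm) where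
  three_le := hd
  metric := (isMetricOn_comp g hφ).mono (fun _ hx => hx.1) (isOpen_regularPart hs.1 hφ)
  defining := (hs.1.isDefiningOn hφ).mono (fun _ hx => hx.1) (isOpen_regularPart hs.1 hφ)
  unit := by
    obtain ⟨B, hB, hB'⟩ := hs.2 φ hφ
    refine ⟨B, Lead.mono ⟨B, hB, fun x hx => ⟨?_, fun _ => rfl⟩⟩ fun _ hx => hx.1⟩
    dsimp only
    rw [hB' x hx]
    simp
  pos _ hx := hx.2

/-- The trace-free second fundamental form vanishes to order `d - 2` in every chart. -/
def VanishesToHighOrder (g : RMetric d M) (s : M → ℝ) : Prop :=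
  ∀ φ ∈ maximalAtlas (𝓡 d) ∞ M, ∃ F : Cov2 d, ∀ a b, Lead φ.target (s ∘ φ.symm) (d - 2)
    (fun x => secondFFExt (g.comp φ) (s ∘ φ.symm) x a b) fun x => F x a b

theorem lead_of_regularPart (hs : IsDefiningFunction (d := d) S s)
    (hφ : φ ∈ maximalAtlas (𝓡 d) ∞ M) {F : Cov2 d} {m : ℕ} (a b : Fin d)
    (h : Lead (regularPart g s φ) (s ∘ φ.symm) m
      (fun x => secondFFExt (g.comp φ) (s ∘ φ.symm) x a b) fun x => F x a b) :
    Lead φ.target (s ∘ φ.symm) m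
      (fun x => secondFFExt (g.comp φ) (s ∘ φ.symm) x a b) fun x => F x a b :=
  h.of_subset (isOpen_regularPart hs hφ) φ.open_target (hs.isDefiningOn hφ).smooth
    ((isMetricOn_comp g hφ).secondFFExt_smooth (hs.isDefiningOn hφ).smooth a b)
    fun _ hx h0 => mem_regularPart hs hφ hx h0

/-- The equivalence holds chart by chart on the open set where `ds ≠ 0`, which contains the zero
locus and so determines the order of vanishing. The rest is matching the index ranges. -/
theorem vanishesToHighOrder_iff (hd : 3 ≤ d) (hs : IsAsymptoticUnitDefining g S s)
    (ht : IsTrueScale (d := d) t) : VanishesToHighOrder g s ↔ IsUberumbilic g S s t := by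
  have key : ∀ φ ∈ maximalAtlas (𝓡 d) ∞ M, (∃ F : Cov2 d, ∀ a b,
      Lead φ.target (s ∘ φ.symm) (d - 2)
        (fun x => secondFFExt (g.comp φ) (s ∘ φ.symm) x a b) fun x => F x a b) ↔
      ∀ k, k + 3 ≤ d → ∀ x ∈ φ.target, φ.symm x ∈ S → ∀ a b,
        (2 * k + 1 < d → canonicalFF (g.comp φ) (s ∘ φ.symm) (k + 2) x a b = 0) ∧
        (d ≤ 2 * k + 1 →
          conditionalFF (g.comp φ) (s ∘ φ.symm) (t ∘ φ.symm) (k + 2) x a b = 0) := by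
    intro φ hφ
    have h1 := (hs.isUnitOn hd hφ).lead_iff (t := t ∘ φ.symm)
      ((contDiffOn_of_contMDiff ht.1 hφ).mono fun _ hx => hx.1) fun _ _ => ht.2 _
    have h2 : ∀ {x}, φ.symm x ∈ S ↔ (s ∘ φ.symm) x = 0 := fun {x} => hs.1.2.1 _
    constructor
    · rintro ⟨F, hF⟩ k hk x hx hxS
      exact h1.1 ⟨F, fun a b => (hF a b).mono fun _ hx => hx.1⟩ k hk x
        (mem_regularPart hs.1 hφ hx (h2.1 hxS)) (h2.1 hxS)
    · intro h
      obtain ⟨F, hF⟩ := h1.2 fun k hk x hx h0 => h k hk x hx.1 (h2.2 h0)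
      exact ⟨F, fun a b => lead_of_regularPart hs.1 hφ a b (hF a b)⟩
  -- With `n = k + 2`, the two ceilings cut the range `0 ≤ k ≤ d - 3` at `2k + 1 < d` without gap or
  -- overlap.
  have hceil1 : ∀ k : ℕ, k + 2 ≤ ⌈((d : ℚ) + 1) / 2⌉₊ ↔ 2 * k + 1 < d := by
    intro k
    rw [show k + 2 = (k + 1) + 1 by rfl, Nat.succ_le_iff, Nat.lt_ceil, lt_div_iff₀ two_pos]
    constructor
    · intro h
      have : (k + 1) * 2 < d + 1 := by exact_mod_cast h
      omega
    · intro h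
      have : (k + 1) * 2 < d + 1 := by omega
      exact_mod_cast this
  have hceil2 : ∀ k : ℕ, ⌈((d : ℚ) + 3) / 2⌉₊ ≤ k + 2 ↔ d ≤ 2 * k + 1 := by
    intro k
    rw [Nat.ceil_le, div_le_iff₀ two_pos]
    constructor
    · intro h
      have : d + 3 ≤ (k + 2) * 2 := by exact_mod_cast h
      omega
    · intro h
      have : d + 3 ≤ (k + 2) * 2 := by omega
      exact_mod_cast this
  constructor
  · intro h
    refine ⟨fun n hn2 hn φ hφ x hx hxS a b => ?_, fun n hn hnd φ hφ x hx hxS a b => ?_⟩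
    · obtain ⟨k, rfl⟩ : ∃ k, n = k + 2 := ⟨n - 2, by omega⟩
      have hk := (hceil1 k).1 hn
      exact ((key φ hφ).1 (h φ hφ) k (by omega) x hx hxS a b).1 hk
    · have hn2 : 2 ≤ n := by
        have : ((d : ℚ) + 3) / 2 ≤ n := Nat.ceil_le.1 hn
        rw [div_le_iff₀ two_pos] at this
        have : d + 3 ≤ n * 2 := by exact_mod_cast this
        omega
      obtain ⟨k, rfl⟩ : ∃ k, n = k + 2 := ⟨n - 2, by omega⟩
      exact ((key φ hφ).1 (h φ hφ) k (by omega) x hx hxS a b).2 ((hceil2 k).1 hn)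
  · intro h φ hφ
    refine (key φ hφ).2 fun k hk x hx hxS a b => ⟨fun hk2 => ?_, fun hk2 => ?_⟩
    · exact h.1 (k + 2) (by omega) ((hceil1 k).2 hk2) φ hφ x hx hxS a b
    · exact h.2 (k + 2) ((hceil2 k).2 hk2) (by omega) φ hφ x hx hxS a b

/-- The pair `(g, s)` itself serves: the trace-free Schouten tensor of `s⁻²g` is `s⁻¹E`, and
dividing `O(s^(d-2))` by `s` leaves `s^(d-3)` times a smooth tensor. -/
theorem VanishesToHighOrder.admits (hd : 3 ≤ d) {c : Set (RMetric d M)} (hg : g ∈ c)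
    (hs : IsDefiningFunction (d := d) S s) (h : VanishesToHighOrder g s) :
    AdmitsAsymptoticallyPoincareEinstein c S := by
  refine ⟨g, hg, s, hs, fun φ hφ => ?_⟩
  obtain ⟨F, hF⟩ := h φ hφ
  choose k hk hk' using hF
  refine ⟨fun x a b => k a b x, hk, fun x hx hxS a b => ?_⟩
  have hD := hs.isDefiningOn hφ
  have hopen : IsOpen (φ.target ∩ (s ∘ φ.symm) ⁻¹' {0}ᶜ) :=
    hD.smooth.continuousOn.isOpen_inter_preimage φ.open_target isOpen_compl_singleton
  have hsx : s (φ.symm x) ≠ 0 := fun h0 => hxS ((hs.2.1 _).2 h0)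
  rw [symTf_schouten_singular ((isMetricOn_comp g hφ).mono Set.inter_subset_left hopen) hd
    (hD.smooth.mono Set.inter_subset_left) (fun y hy => hy.2)
    (G' := singularMetric g s φ) (fun y _ i j => rfl) ⟨hx, hsx⟩]
  have hE : secondFFExt (g.comp φ) (s ∘ φ.symm) x a b
      = (s ∘ φ.symm) x ^ (d - 2) * k a b x := (hk' a b x hx).1
  rw [hE]
  obtain ⟨e, rfl⟩ : ∃ e, d = e + 3 := ⟨d - 3, by omega⟩
  rw [show e + 3 - 2 = e + 1 by omega, show e + 3 - 3 = e by omega, pow_succ]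
  simp only [Function.comp]
  field_simp

/-- If `g' = Ω²g`, the metric `s'⁻²g'` equals `r⁻²g` with `r = s'/Ω`, a second defining function.
This brings everything to the given `g`, where `r = us` and `lead_of_rescaled` applies. -/
theorem vanishesToHighOrder_of_admits (hd : 3 ≤ d) {c : Set (RMetric d M)}
    (hc : IsConformalClass c) (hg : g ∈ c) (hs : IsAsymptoticUnitDefining g S s)
    (h : AdmitsAsymptoticallyPoincareEinstein c S) : VanishesToHighOrder g s := by
  obtain ⟨g', hg', s', hs', hT⟩ := h
  obtain ⟨Ω, hΩ, hΩ0, hΩg⟩ := (hc.2 g hg g').1 hg'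
  intro φ hφ
  obtain ⟨T, hTs, hT⟩ := hT φ hφ
  have hΩφ := contDiffOn_of_contMDiff hΩ hφ
  have hinv : ContMDiff (𝓡 d) 𝓘(ℝ, ℝ) ∞ fun p => (Ω p)⁻¹ := contMDiff_of_charts fun φ hφ =>
    (contDiffOn_of_contMDiff hΩ hφ).inv fun _ _ => (hΩ0 _).ne'
  have hr := hs'.mul hinv fun p => inv_ne_zero (hΩ0 p).ne'
  have hD := hs.1.isDefiningOn hφ
  have hrD := hr.isDefiningOn hφ
  have hzero : ∀ x, (s ∘ φ.symm) x = 0 → s' (φ.symm x) * (Ω (φ.symm x))⁻¹ = 0 := fun x h0 =>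
    (hr.2.1 _).1 ((hs.1.2.1 _).2 h0)
  -- Both functions have zero locus `S`, so the quotient is smooth. Its sign is not controlled, and
  -- only its nonvanishing along the locus is used below.
  obtain ⟨u, hu, hu'⟩ := hadamard φ.open_target hrD.smooth hD.smooth hD.regular
    fun x _ h0 => hzero x h0
  have hu0 : ∀ x ∈ φ.target, (s ∘ φ.symm) x = 0 → u x ≠ 0 := by
    intro x hx h0 hux
    refine hrD.regular x hx (hzero x h0) ?_
    have h1 : ((fun p => s' p * (Ω p)⁻¹) ∘ φ.symm) =ᶠ[nhds x]
        fun y => (s ∘ φ.symm) y * u y :=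
      Filter.eventually_of_mem (φ.open_target.mem_nhds hx) hu'
    rw [h1.fderiv_eq, fderiv_fun_mul (differentiableAt_of_smooth φ.open_target hD.smooth hx)
      (differentiableAt_of_smooth φ.open_target hu hx), h0, hux, zero_smul, zero_smul, add_zero]
  let r : Coord d → ℝ := fun y => u y * (s ∘ φ.symm) y
  have hrs : ContDiffOn ℝ ∞ r φ.target := hu.mul hD.smooth
  have hr' : ∀ x ∈ φ.target, s' (φ.symm x) = Ω (φ.symm x) * r x := by
    intro x hx
    have h1 := hu' x hx
    simp only [Function.comp] at h1
    have h2 := (hΩ0 (φ.symm x)).ne'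
    simp only [r, Function.comp]
    rw [mul_comm (u x), ← h1]
    field_simp
  have hG := isMetricOn_comp g hφ
  have hopen : IsOpen (φ.target ∩ r ⁻¹' {0}ᶜ) :=
    hrs.continuousOn.isOpen_inter_preimage φ.open_target isOpen_compl_singleton
  have hmetric : ∀ x ∈ φ.target, ∀ i j,
      singularMetric g' s' φ x i j = (r x ^ 2)⁻¹ * g.comp φ x i j := by
    intro x hx i j
    have h1 : g'.comp φ x i j = Ω (φ.symm x) ^ 2 * g.comp φ x i j := hΩg _ _ _
    have h2 := (hΩ0 (φ.symm x)).ne'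
    rw [singularMetric, h1, hr' x hx, mul_pow, mul_inv]
    field_simp
  have hE : ∀ a b, ∀ x ∈ φ.target, r x ≠ 0 → secondFFExt (g.comp φ) r x a b
      = (s ∘ φ.symm) x ^ (d - 2) * (u x ^ (d - 2) * (Ω (φ.symm x) ^ (d - 3) * T x a b)) := by
    intro a b x hx hrx
    have hsx : s (φ.symm x) ≠ 0 := right_ne_zero_of_mul hrx
    have h1 := symTf_schouten_singular (hG.mono Set.inter_subset_left hopen) hd
      (hrs.mono Set.inter_subset_left) (fun y hy => hy.2) (fun y hy => hmetric y hy.1)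
      ⟨hx, hrx⟩ a b
    rw [hT x hx (fun hS => hsx ((hs.1.2.1 _).1 hS)), hr' x hx] at h1
    have h2 : secondFFExt (g.comp φ) r x a b
        = r x * ((Ω (φ.symm x) * r x) ^ (d - 3) * T x a b) := by
      rw [h1, ← mul_assoc, mul_inv_cancel₀ hrx, one_mul]
    rw [h2]
    obtain ⟨e, rfl⟩ : ∃ e, d = e + 3 := ⟨d - 3, by omega⟩
    rw [show e + 3 - 2 = e + 1 by omega, show e + 3 - 3 = e by omega]
    simp only [r]
    ring
  have hE' : ∀ a b, ∃ F, Lead (regularPart g s φ) (s ∘ φ.symm) (d - 2)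
      (fun x => secondFFExt (g.comp φ) r x a b) F := by
    intro a b
    have hk : ContDiffOn ℝ ∞ (fun x => u x ^ (d - 2) * (Ω (φ.symm x) ^ (d - 3) * T x a b))
        φ.target := (hu.pow _).mul ((hΩφ.pow _).mul (hTs a b))
    refine ⟨_, Lead.mono ⟨_, hk, fun x hx => ⟨?_, fun _ => rfl⟩⟩ fun _ hx => hx.1⟩
    -- The formula for `E(us)` is known only off the hypersurface, where the singular metric lives.
    -- Both sides are continuous, so it extends across.
    refine eq_of_eventually_ne_zero (s := s ∘ φ.symm) (hD.regular x hx)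
      ((hG.secondFFExt_smooth hrs a b).contDiffAt (φ.open_target.mem_nhds hx)).continuousAt
      (((hD.smooth.pow _).mul hk).contDiffAt (φ.open_target.mem_nhds hx)).continuousAt ?_
    filter_upwards [φ.open_target.mem_nhds hx] with y hy hy0
    refine hE a b y hy (mul_ne_zero (fun huy => hy0 ?_) hy0)
    have h1 := hr' y hy
    simp only [r, huy, zero_mul, mul_zero] at h1
    exact (hs.1.2.1 _).1 ((hs'.2.1 _).2 h1)
  obtain ⟨⟨F, hF⟩, -⟩ := (hs.isUnitOn hd hφ).lead_of_rescaled (hu.mono fun _ hx => hx.1)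
    (fun x hx h0 => hu0 x hx.1 h0) hE' (d - 2) le_rfl
  exact ⟨F, fun a b => lead_of_regularPart hs.1 hφ a b (hF a b)⟩

end Main

end ConfHyp

end

open scoped Manifold ContDiff
theorem mainTheorem1 (d : ℕ) (hd : 3 ≤ d)
    (M : Type*) [TopologicalSpace M] [T2Space M] [SecondCountableTopology M]
    [ChartedSpace (Coord d) M] [IsManifold (𝓡 d) ∞ M]
    (c : Set (RMetric d M)) (hc : IsConformalClass c)
    (S : Set M) (hS : IsSeparatingHypersurface d S) :
    (∀ g ∈ c, ∃ s : M → ℝ, IsAsymptoticUnitDefining g S s) ∧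
    ∀ g ∈ c, ∀ s t : M → ℝ, IsAsymptoticUnitDefining g S s → IsTrueScale (d := d) t →
      (AdmitsAsymptoticallyPoincareEinstein c S ↔ IsUberumbilic g S s t) := by
  refine ⟨fun g _ => ?_, fun g hg s t hs ht => ?_⟩
  · obtain ⟨s, hs⟩ := hS
    exact exists_isAsymptoticUnitDefining hd g hs
  · exact ⟨fun h => (vanishesToHighOrder_iff hd hs ht).1
      (vanishesToHighOrder_of_admits hd hc hg hs h),
      fun h => ((vanishesToHighOrder_iff hd hs ht).2 h).admits hd hg hs.1⟩
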